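/- Let $n>0$, $s>1$, and let $M$ be a smooth manifold of dimension $2n+s$ with a weak metric $f$-structure $(f,Q,\xi_i,\eta^i,g)$, $1\le i\le s$. That is: $f$ and $Q$ are smooth $(1,1)$-tensors, $f$ of constant rank $2n$ and $Q$ nonsingular, with $f^3+fQ=0$; $\xi_i$ are smooth vector fields and $\eta^i$ smooth 1-forms with $$f^2=-Q+\sum_i\eta^i\otimes\xi_i,\qquad \eta^i(\xi_j)=\delta^i_j,\qquad Q\xi_i=\xi_i;$$ the contact distribution $\mathcal D=\bigcap_i\ker\eta^i$ is $f$-invariant; and $g$ is a Riemannian metric with $g(fX,fY)=g(X,QY)-\sum_i\eta^i(X)\eta^i(Y)$ for all vector fields $X,Y$. Suppose that $M$ is a weak $\beta$-Kenmotsu $f$-manifold, where $\beta$ is a smooth real function on $M$ that is not identically zero. That is, for all smooth vector fields $X,Y$: * (normality) $[f,f](X,Y)+2\sum_i d\eta^i(X,Y)\,\xi_i=0$, where $[f,f](X,Y)=f^2[X,Y]+[fX,fY]-f[fX,Y]-f[X,fY]$ and $2\,d\eta^i(X,Y)=X(\eta^i(Y))-Y(\eta^i(X))-\eta^i([X,Y])$;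 * $(\nabla_Xf)Y=\beta\{g(fX,Y)\,\bar\xi-\bar\eta(Y)\,fX\}$, where $\nabla$ is the Levi-Civita connection of $g$, $\bar\xi=\sum_i\xi_i$ and $\bar\eta=\sum_i\eta^i$. Then for every point $p\in M$ there are a $2n$-dimensional weak Kählerian manifold $(\bar M,\bar g,J)$, i.e. a Riemannian manifold with a smooth skew-symmetric $(1,1)$-tensor $J$ such that $J^2$ is negative definite and $\bar\nabla J=0$ for the Levi-Civita connection $\bar\nabla$ of $\bar g$, a smooth positive function $\sigma$ on $\mathbb R^s\times\bar M$, an open ball $B\subset\mathbb R^s$ centred at $0$, and a diffeomorphism $\Phi$ of $B\times\bar M$ onto an open neighbourhood of $p$ in $M$ such that $\Phi$ is an isometry from the open subset $B\times\bar M$ of the twisted product $\mathbb R^s\times_\sigma\bar M$, whose metric is $g_{\mathbb R^s}\oplus\sigma^2\bar g$ with $g_{\mathbb R^s}$ Euclidean, onto its image. Moreover $\Phi$ carries the coordinate fields $\partial/\partial t_i$ of $\mathbb R^s$ to the fields $\xi_i$ and carries $J$, acting on the slices $\{t\}\times\bar M$, to the restriction of $f$ to $\mathcal D$. If in addition $X(\beta)=0$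 for all $X\in\mathcal D$, then $\sigma$ can moreover be taken of the form $\sigma(t,y)=\rho(t)$ with $\rho$ a smooth function on $\mathbb R^s$, so that the product is a warped product. -/

import Mathlib

open Bundle Manifold VectorField
open scoped ContDiff

namespace WeakKenmotsu

/-! ### Tensor fields on an `m`-dimensional smooth manifold -/

/-- Vector fields, with no regularity condition. -/
abbrev VField (m : ℕ) (M : Type*) [TopologicalSpace M]
    [ChartedSpace (EuclideanSpace ℝ (Fin m)) M] :=
  Π x : M, TangentSpace (𝓡 m) x

/-- (1,1)-tensor fields, with no regularity condition. -/
abbrev EndField (m : ℕ) (M : Type*) [TopologicalSpace M]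
    [ChartedSpace (EuclideanSpace ℝ (Fin m)) M] :=
  Π x : M, TangentSpace (𝓡 m) x →L[ℝ] TangentSpace (𝓡 m) x

/-- Fields of covectors, with no regularity condition. -/
abbrev OneForm (m : ℕ) (M : Type*) [TopologicalSpace M]
    [ChartedSpace (EuclideanSpace ℝ (Fin m)) M] :=
  Π x : M, TangentSpace (𝓡 m) x →L[ℝ] ℝ

section

variable {m : ℕ} {M : Type*} [TopologicalSpace M] [ChartedSpace (EuclideanSpace ℝ (Fin m)) M]

/-- `S X`, for a (1,1)-tensor field `S` and a vector field `X`. -/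
noncomputable def EndField.app (S : EndField m M) (X : VField m M) : VField m M := fun x => S x (X x)

/-- The Nijenhuis torsion
`[S,S](X,Y) = S²[X,Y] + [SX,SY] - S[SX,Y] - S[X,SY]`. -/
noncomputable def nijenhuis (S : EndField m M) (X Y : VField m M) : VField m M := fun x =>
  S x (S x (mlieBracket (𝓡 m) X Y x)) + mlieBracket (𝓡 m) (S.app X) (S.app Y) x
    - S x (mlieBracket (𝓡 m) (S.app X) Y x) - S x (mlieBracket (𝓡 m) X (S.app Y) x)

/-- The exterior derivative of a 1-form, with the normalisation
`dα(X,Y) = ½ {X(α(Y)) - Y(α(X)) - α([X,Y])}`. -/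
noncomputable def extDerivOneForm (α : OneForm m M) (X Y : VField m M) (x : M) : ℝ :=
  (1 / 2 : ℝ) * (mvfderiv (𝓡 m) (fun y => α y (Y y)) x (X x)
    - mvfderiv (𝓡 m) (fun y => α y (X y)) x (Y x) - α x (mlieBracket (𝓡 m) X Y x))

variable [IsManifold (𝓡 m) ∞ M]

/-- Smoothness of a vector field. -/
def IsSmoothVField (X : VField m M) : Prop :=
  ContMDiff (𝓡 m) ((𝓡 m).prod 𝓘(ℝ, EuclideanSpace ℝ (Fin m))) ∞
    (fun x => TotalSpace.mk' (EuclideanSpace ℝ (Fin m)) x (X x))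

/-- Smoothness of a (1,1)-tensor field. -/
def IsSmoothEndField (S : EndField m M) : Prop :=
  ContMDiff (𝓡 m)
    ((𝓡 m).prod 𝓘(ℝ, EuclideanSpace ℝ (Fin m) →L[ℝ] EuclideanSpace ℝ (Fin m))) ∞
    (fun x => TotalSpace.mk' (EuclideanSpace ℝ (Fin m) →L[ℝ] EuclideanSpace ℝ (Fin m))
      (E := fun x : M => TangentSpace (𝓡 m) x →L[ℝ] TangentSpace (𝓡 m) x) x (S x))

/-- Smoothness of a 1-form. -/
def IsSmoothOneForm (α : OneForm m M) : Prop :=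
  ContMDiff (𝓡 m) ((𝓡 m).prod 𝓘(ℝ, EuclideanSpace ℝ (Fin m) →L[ℝ] ℝ)) ∞
    (fun x => TotalSpace.mk' (EuclideanSpace ℝ (Fin m) →L[ℝ] ℝ)
      (E := fun x : M => TangentSpace (𝓡 m) x →L[ℝ] Bundle.Trivial M ℝ x) x (α x))

end

/-! ### Riemannian metrics and the Levi-Civita connection -/

/-- Smooth Riemannian metrics. -/
abbrev RMetric (m : ℕ) (M : Type*) [TopologicalSpace M]
    [ChartedSpace (EuclideanSpace ℝ (Fin m)) M] [IsManifold (𝓡 m) ∞ M] :=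
  ContMDiffRiemannianMetric (𝓡 m) ∞ (EuclideanSpace ℝ (Fin m))
    (fun x : M => TangentSpace (𝓡 m) x)

/-- Linear connections. In Mathlib's order of arguments, `∇ Y x (X x)` is `(∇_X Y)(x)`. -/
abbrev LinearConnection (m : ℕ) (M : Type*) [TopologicalSpace M]
    [ChartedSpace (EuclideanSpace ℝ (Fin m)) M] [IsManifold (𝓡 m) ∞ M] :=
  CovariantDerivative (𝓡 m) (EuclideanSpace ℝ (Fin m)) (fun x : M => TangentSpace (𝓡 m) x)

section

variable {m : ℕ} {M : Type*} [TopologicalSpace M] [ChartedSpace (EuclideanSpace ℝ (Fin m)) M]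
  [IsManifold (𝓡 m) ∞ M]

/-- `nabla` is the Levi-Civita connection of `g`: torsion-free and metric,
`v(g(Y,Z)) = g(∇_v Y, Z) + g(Y, ∇_v Z)`. -/
structure IsLeviCivita (g : RMetric m M) (nabla : LinearConnection m M) : Prop where
  torsion_free : nabla.torsion = 0
  metric : ∀ (Y Z : VField m M), IsSmoothVField Y → IsSmoothVField Z →
    ∀ (x : M) (v : TangentSpace (𝓡 m) x),
      mvfderiv (𝓡 m) (fun y => g.inner y (Y y) (Z y)) x v
        = g.inner x (nabla Y x v) (Z x) + g.inner x (Y x) (nabla Z x v)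

/-- `(∇_X S) Y = ∇_X (S Y) - S (∇_X Y)` for a (1,1)-tensor field `S`. -/
noncomputable def covDerivEnd (nabla : LinearConnection m M) (S : EndField m M) (X Y : VField m M) :
    VField m M :=
  fun x => nabla (S.app Y) x (X x) - S x (nabla Y x (X x))

/-- `(M, g)` with the (1,1)-tensor field `J` is a weak Kählerian manifold: `J` is skew-symmetric,
`J²` is negative definite, and `J` is parallel for the Levi-Civita connection of `g`. -/
structure IsWeakKahlerian (g : RMetric m M) (J : EndField m M) : Prop where
  smooth : IsSmoothEndField J
  skew : ∀ (x : M) (v w : TangentSpace (𝓡 m) x), g.inner x (J x v) w = - g.inner x v (J x w)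
  sq_neg : ∀ (x : M) (v : TangentSpace (𝓡 m) x), v ≠ 0 → g.inner x (J x (J x v)) v < 0
  parallel : ∃ nabla : LinearConnection m M, IsLeviCivita g nabla ∧
    ∀ X Y : VField m M, IsSmoothVField X → IsSmoothVField Y →
      ∀ x, covDerivEnd nabla J X Y x = 0

end

/-! ### Weak metric f-structures -/

/-- A weak metric `f`-structure `(f, Q, ξ_i, η^i, g)` on a manifold of dimension `2n + s`. -/
structure WeakMetricFStructure (n s : ℕ) (M : Type*) [TopologicalSpace M]
    [ChartedSpace (EuclideanSpace ℝ (Fin (2 * n + s))) M]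
    [IsManifold (𝓡 (2 * n + s)) ∞ M] where
  f : EndField (2 * n + s) M
  Q : EndField (2 * n + s) M
  ξ : Fin s → VField (2 * n + s) M
  η : Fin s → OneForm (2 * n + s) M
  g : RMetric (2 * n + s) M
  smooth_f : IsSmoothEndField f
  smooth_Q : IsSmoothEndField Q
  smooth_ξ : ∀ i, IsSmoothVField (ξ i)
  smooth_η : ∀ i, IsSmoothOneForm (η i)
  /-- `f` has rank `2n`. -/
  rank_f : ∀ x, Module.finrank ℝ (LinearMap.range (f x).toLinearMap) = 2 * n
  /-- `Q` is nonsingular. -/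
  nonsingular_Q : ∀ x, Function.Bijective (Q x)
  /-- `f³ + fQ = 0`. -/
  f_cube : ∀ x v, f x (f x (f x v)) + f x (Q x v) = 0
  /-- `f² = -Q + ∑ η^i ⊗ ξ_i`. -/
  f_sq : ∀ x v, f x (f x v) = - Q x v + ∑ i, η i x v • ξ i x
  /-- `η^i(ξ_j) = δ^i_j`. -/
  η_ξ : ∀ x i j, η i x (ξ j x) = if i = j then 1 else 0
  /-- `Q ξ_i = ξ_i`. -/
  Q_ξ : ∀ x i, Q x (ξ i x) = ξ i x
  /-- The contact distribution `⋂ ker η^i` is `f`-invariant. -/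
  f_invariant : ∀ x v, (∀ i, η i x v = 0) → ∀ i, η i x (f x v) = 0
  /-- The metric is compatible: `g(fX, fY) = g(X, QY) - ∑ η^i(X) η^i(Y)`. -/
  compatible : ∀ x v w,
    g.inner x (f x v) (f x w) = g.inner x v (Q x w) - ∑ i, η i x v * η i x w

namespace WeakMetricFStructure

variable {n s : ℕ} {M : Type*} [TopologicalSpace M]
  [ChartedSpace (EuclideanSpace ℝ (Fin (2 * n + s))) M] [IsManifold (𝓡 (2 * n + s)) ∞ M]

/-- `v` belongs to the contact distribution `𝒟 = ⋂ ker η^i`. -/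
def InContact (S : WeakMetricFStructure n s M) {x : M} (v : TangentSpace (𝓡 (2 * n + s)) x) :
    Prop :=
  ∀ i, S.η i x v = 0

/-- `ξ̄ = ∑ ξ_i`. -/
noncomputable def xiBar (S : WeakMetricFStructure n s M) : VField (2 * n + s) M := fun x => ∑ i, S.ξ i x

/-- `η̄ = ∑ η^i`. -/
noncomputable def etaBar (S : WeakMetricFStructure n s M) : OneForm (2 * n + s) M := fun x => ∑ i, S.η i x

/-- Normality: `[f,f](X,Y) + 2 ∑ dη^i(X,Y) ξ_i = 0`. -/
def IsNormal (S : WeakMetricFStructure n s M) : Prop :=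
  ∀ X Y : VField (2 * n + s) M, IsSmoothVField X → IsSmoothVField Y → ∀ x,
    nijenhuis S.f X Y x + ∑ i, (2 * extDerivOneForm (S.η i) X Y x) • S.ξ i x = 0

/-- A weak `β`-Kenmotsu `f`-structure: a normal weak metric `f`-structure with
`(∇_X f)Y = β {g(fX, Y) ξ̄ - η̄(Y) fX}`, where `∇` is the Levi-Civita connection of `g` and
`β` is a smooth function that is not identically zero. -/
structure IsWeakKenmotsu (S : WeakMetricFStructure n s M) (β : M → ℝ) : Prop where
  normal : S.IsNormal
  smooth_β : ContMDiff (𝓡 (2 * n + s)) 𝓘(ℝ, ℝ) ∞ β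
  β_ne_zero : β ≠ 0
  nabla_f : ∃ nabla : LinearConnection (2 * n + s) M, IsLeviCivita S.g nabla ∧
    ∀ X Y : VField (2 * n + s) M, IsSmoothVField X → IsSmoothVField Y → ∀ x,
      covDerivEnd nabla S.f X Y x
        = β x • (S.g.inner x (S.f x (X x)) (Y x) • S.xiBar x - S.etaBar x (Y x) • S.f x (X x))

end WeakMetricFStructure

/-! ### Twisted products `ℝ^s ×_σ N` -/

/-- The metric of the twisted product `ℝ^s ×_σ N` at the point `q = (t, y)`:
`π₁^* g_{ℝ^s} + σ² π₂^* h`, with the Euclidean metric on `ℝ^s` and the metric `h` on `N`. -/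
noncomputable def twistedInner {s k : ℕ} {N : Type*} [TopologicalSpace N]
    [ChartedSpace (EuclideanSpace ℝ (Fin k)) N] [IsManifold (𝓡 k) ∞ N] (h : RMetric k N)
    (σ : EuclideanSpace ℝ (Fin s) × N → ℝ) (q : EuclideanSpace ℝ (Fin s) × N)
    (v w : TangentSpace ((𝓡 s).prod (𝓡 k)) q) : ℝ :=
  inner ℝ (mvfderiv ((𝓡 s).prod (𝓡 k)) (fun z : EuclideanSpace ℝ (Fin s) × N => z.1) q v)
      (mvfderiv ((𝓡 s).prod (𝓡 k)) (fun z : EuclideanSpace ℝ (Fin s) × N => z.1) q w)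
    + σ q ^ 2 *
      h.inner q.2
        (mfderiv ((𝓡 s).prod (𝓡 k)) (𝓡 k) (fun z : EuclideanSpace ℝ (Fin s) × N => z.2) q v)
        (mfderiv ((𝓡 s).prod (𝓡 k)) (𝓡 k) (fun z : EuclideanSpace ℝ (Fin s) × N => z.2) q w)

/-- `Φ` is a parametrisation of a neighbourhood of `p` by the open part `B(0,r) × N` of the twisted
product `ℝ^s ×_σ N`: a diffeomorphism onto an open neighbourhood of `p` that is an isometry,
carries the coordinate fields `∂/∂t_i` of `ℝ^s` to the `ξ_i`, and carries `J` on the slices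
`{t} × N` to `f`. -/
structure IsTwistedProductChart {n s : ℕ} {M : Type*} [TopologicalSpace M]
    [ChartedSpace (EuclideanSpace ℝ (Fin (2 * n + s))) M] [IsManifold (𝓡 (2 * n + s)) ∞ M]
    (S : WeakMetricFStructure n s M) (p : M) {N : Type*} [TopologicalSpace N]
    [ChartedSpace (EuclideanSpace ℝ (Fin (2 * n))) N] [IsManifold (𝓡 (2 * n)) ∞ N]
    (h : RMetric (2 * n) N) (J : EndField (2 * n) N) (σ : EuclideanSpace ℝ (Fin s) × N → ℝ)
    (r : ℝ) (Φ : OpenPartialHomeomorph (EuclideanSpace ℝ (Fin s) × N) M) : Prop where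
  source_eq : Φ.source = Metric.ball (0 : EuclideanSpace ℝ (Fin s)) r ×ˢ (Set.univ : Set N)
  mem_target : p ∈ Φ.target
  smooth : ContMDiffOn ((𝓡 s).prod (𝓡 (2 * n))) (𝓡 (2 * n + s)) ∞ Φ Φ.source
  smooth_symm : ContMDiffOn (𝓡 (2 * n + s)) ((𝓡 s).prod (𝓡 (2 * n))) ∞ Φ.symm Φ.target
  isometry : ∀ q ∈ Φ.source, ∀ v w : TangentSpace ((𝓡 s).prod (𝓡 (2 * n))) q,
    S.g.inner (Φ q) (mfderiv ((𝓡 s).prod (𝓡 (2 * n))) (𝓡 (2 * n + s)) Φ q v)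
        (mfderiv ((𝓡 s).prod (𝓡 (2 * n))) (𝓡 (2 * n + s)) Φ q w)
      = twistedInner h σ q v w
  map_ξ : ∀ q ∈ Φ.source, ∀ i,
    mfderiv (𝓡 s) (𝓡 (2 * n + s)) (fun t => Φ (t, q.2)) q.1 (EuclideanSpace.single i (1 : ℝ))
      = S.ξ i (Φ q)
  map_f : ∀ q ∈ Φ.source, ∀ w : TangentSpace (𝓡 (2 * n)) q.2,
    mfderiv (𝓡 (2 * n)) (𝓡 (2 * n + s)) (fun y => Φ (q.1, y)) q.2 (J q.2 w)
      = S.f (Φ q) (mfderiv (𝓡 (2 * n)) (𝓡 (2 * n + s)) (fun y => Φ (q.1, y)) q.2 w)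

end WeakKenmotsu

/-
The argument is local. From the formula for `∇ f` one computes `∇ ξ_i`: it is `β` times the
projection onto the contact distribution. Hence the fields `ξ_i` commute and the `η^i` are
closed, so the joint flow of the `ξ_i` yields coordinates `(t, y)` in which `ξ_i = ∂/∂t_i` and
`η^i = dt_i`; the slices `t = const` are the leaves of the contact distribution. Along `ξ_i` the
tensor `f` is constant while the metric of the leaves obeys `∂_i g = 2 β g`. Solutions of this
linear equation are determined up to a constant, so all the leaf metrics are conformal to the
one on `t = 0`, where `∇ f = 0` on the contact distribution makes `f` a parallel tensor.
-/

namespace WeakKenmotsu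

open Set Filter Topology

/-! ### Joint flows of commuting vector fields -/

section Superposition

variable {K : Type*} [TopologicalSpace K] [CompactSpace K]

set_option synthInstance.maxHeartbeats 200000 in
-- the norm on `C(K, E →L[ℝ] F)` is slow to synthesise
/-- Pointwise application of a continuous family of operators to a continuous family of vectors,
as a continuous bilinear map. -/
noncomputable def pointwiseApply (K : Type*) [TopologicalSpace K] [CompactSpace K]
    (E F : Type*) [NormedAddCommGroup E] [NormedSpace ℝ E] [NormedAddCommGroup F]
    [NormedSpace ℝ F] : C(K, E →L[ℝ] F) →L[ℝ] C(K, E) →L[ℝ] C(K, F) :=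
  LinearMap.mkContinuous₂
    (LinearMap.mk₂ ℝ (fun (A : C(K, E →L[ℝ] F)) (γ : C(K, E)) =>
        (⟨fun k => A k (γ k), by fun_prop⟩ : C(K, F)))
      (fun _ _ _ => by ext; simp) (fun _ _ _ => by ext; simp)
      (fun _ _ _ => by ext; simp) (fun _ _ _ => by ext; simp)) 1
    (fun A γ => by
      rw [one_mul]
      refine (ContinuousMap.norm_le _ (by positivity)).2 fun k => ?_
      exact (A k).le_opNorm_of_le (γ.norm_coe_le_norm k) |>.trans
        (mul_le_mul_of_nonneg_right (A.norm_coe_le_norm k) (norm_nonneg _)))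

@[simp] lemma pointwiseApply_apply {E F : Type*} [NormedAddCommGroup E] [NormedSpace ℝ E]
    [NormedAddCommGroup F] [NormedSpace ℝ F] (A : C(K, E →L[ℝ] F)) (γ : C(K, E)) (k : K) :
    pointwiseApply K E F A γ k = A k (γ k) := rfl

set_option synthInstance.maxHeartbeats 200000 in
-- the norm on `C(K, E →L[ℝ] F)` is slow to synthesise
lemma hasFDerivAt_continuousMap_comp {E F : Type*} [NormedAddCommGroup E] [NormedSpace ℝ E]
    [NormedAddCommGroup F] [NormedSpace ℝ F] (f : C(E, F)) (f' : C(E, E →L[ℝ] F))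
    (hf : ∀ x, HasFDerivAt f (f' x) x) (γ : C(K, E)) :
    HasFDerivAt (fun γ : C(K, E) => f.comp γ) (pointwiseApply K E F (f'.comp γ)) γ := by
  rw [hasFDerivAt_iff_isLittleO_nhds_zero, Asymptotics.isLittleO_iff]
  intro c hc
  have hcont : ContinuousAt (fun γ : C(K, E) => f'.comp γ) γ :=
    (ContinuousMap.continuous_postcomp f').continuousAt
  obtain ⟨δ, hδ, hδ'⟩ :=
    (Metric.continuousAt_iff (α := C(K, E)) (β := C(K, E →L[ℝ] F))).1 hcont c hc
  filter_upwards [Metric.ball_mem_nhds (0 : C(K, E)) hδ] with h hh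
  rw [mem_ball_zero_iff] at hh
  refine (ContinuousMap.norm_le _ (by positivity)).2 fun k => ?_
  have hbound : ∀ z ∈ Metric.ball (γ k) δ, ‖f' z - f' (γ k)‖ ≤ c := by
    intro z hz
    -- `f'` varies by at most `c` along the translate of `γ` that passes through `z`
    have htranslate : dist (γ + ContinuousMap.const K (z - γ k)) γ < δ := by
      rw [dist_eq_norm, add_sub_cancel_left]
      refine lt_of_le_of_lt
        ((ContinuousMap.norm_le _ (norm_nonneg (z - γ k))).2 fun _ => le_rfl) ?_
      simpa [dist_eq_norm] using hz
    simpa [dist_eq_norm] using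
      ((ContinuousMap.dist_apply_le_dist k).trans_lt (hδ' htranslate)).le
  have hmean := Convex.norm_image_sub_le_of_norm_hasFDerivWithin_le' (𝕜 := ℝ) (f := f)
    (fun x _ => (hf x).hasFDerivWithinAt) hbound (convex_ball (γ k) δ)
    (Metric.mem_ball_self hδ) (y := γ k + h k) (by
      simpa [dist_eq_norm] using (h.norm_coe_le_norm k).trans_lt hh)
  rw [add_sub_cancel_left] at hmean
  exact hmean.trans (mul_le_mul_of_nonneg_left (h.norm_coe_le_norm k) hc.le)

universe u

set_option synthInstance.maxHeartbeats 200000 in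
-- the norm on `C(K, E →L[ℝ] F)` is slow to synthesise
lemma contDiff_continuousMap_comp_nat {E : Type u} [NormedAddCommGroup E] [NormedSpace ℝ E]
    (n : ℕ) : ∀ {F : Type u} [NormedAddCommGroup F] [NormedSpace ℝ F] (f : C(E, F)),
    ContDiff ℝ ∞ f → ContDiff ℝ n (fun γ : C(K, E) => f.comp γ) := by
  induction n with
  | zero => exact fun f _ => contDiff_zero.2 (ContinuousMap.continuous_postcomp f)
  | succ n ih =>
    intro F _ _ f hf
    have hf' : ContDiff ℝ ∞ (fderiv ℝ f) := hf.fderiv_right (by simp)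
    refine contDiff_succ_iff_hasFDerivAt.2 ⟨_, (pointwiseApply K E F).contDiff.comp
      (ih (⟨fderiv ℝ f, hf'.continuous⟩ : C(E, E →L[ℝ] F)) hf'), ?_⟩
    exact hasFDerivAt_continuousMap_comp f _
      (fun x => (hf.differentiable (by simp) x).hasFDerivAt)

set_option synthInstance.maxHeartbeats 200000 in
-- the norm on `C(K, E →L[ℝ] F)` is slow to synthesise
lemma contDiff_continuousMap_comp {E F : Type u} [NormedAddCommGroup E] [NormedSpace ℝ E]
    [NormedAddCommGroup F] [NormedSpace ℝ F] (f : C(E, F)) (hf : ContDiff ℝ ∞ f) :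
    ContDiff ℝ ∞ (fun γ : C(K, E) => f.comp γ) :=
  contDiff_infty.2 fun n => contDiff_continuousMap_comp_nat n f hf

end Superposition

section PathIntegral

variable {E : Type*} [NormedAddCommGroup E] [NormedSpace ℝ E]

/-- Integration of paths from the left end point, as a continuous linear operator on paths. -/
noncomputable def pathIntegral (E : Type*) [NormedAddCommGroup E] [NormedSpace ℝ E] :
    C(unitInterval, E) →L[ℝ] C(unitInterval, E) :=
  LinearMap.mkContinuous
    { toFun := fun γ => ⟨fun τ => ∫ u in (0 : ℝ)..τ, γ (projIcc 0 1 zero_le_one u),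
        (intervalIntegral.continuous_primitive
          (fun _ _ => (by fun_prop : Continuous _).intervalIntegrable _ _) 0).comp
          continuous_subtype_val⟩
      map_add' := fun γ γ' => by
        ext τ
        simpa using intervalIntegral.integral_add
          ((by fun_prop : Continuous fun u => γ (projIcc 0 1 _ u)).intervalIntegrable _ _)
          ((by fun_prop : Continuous fun u => γ' (projIcc 0 1 _ u)).intervalIntegrable _ _)
      map_smul' := fun c γ => by
        ext τ
        simp } 1
    (fun γ => by
      rw [one_mul]
      refine (ContinuousMap.norm_le _ (norm_nonneg _)).2 fun τ => ?_
      refine (intervalIntegral.norm_integral_le_of_norm_le_const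
        (fun u _ => γ.norm_coe_le_norm _)).trans ?_
      rw [sub_zero, abs_of_nonneg τ.2.1]
      exact mul_le_of_le_one_right (norm_nonneg _) τ.2.2)

lemma pathIntegral_apply (γ : C(unitInterval, E)) (τ : unitInterval) :
    pathIntegral E γ τ = ∫ u in (0 : ℝ)..τ, γ (projIcc 0 1 zero_le_one u) := rfl

variable [CompleteSpace E]

lemma pathIntegral_eq_sub_of_hasDerivAt {G G' : ℝ → E} (hG : ∀ u, HasDerivAt G (G' u) u)
    (hG' : Continuous G') {γ : C(unitInterval, E)} (hγ : ∀ τ : unitInterval, γ τ = G' τ)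
    (τ : unitInterval) : pathIntegral E γ τ = G τ - G 0 := by
  rw [pathIntegral_apply, ← intervalIntegral.integral_eq_sub_of_hasDerivAt (fun u _ => hG u)
    (hG'.intervalIntegrable _ _)]
  refine intervalIntegral.integral_congr fun u hu => ?_
  rw [uIcc_of_le τ.2.1] at hu
  have hu' : u ∈ Icc (0 : ℝ) 1 := ⟨hu.1, hu.2.trans τ.2.2⟩
  exact (congrArg γ (projIcc_of_mem zero_le_one hu')).trans (hγ ⟨u, hu'⟩)

lemma pathIntegral_eq_smul_comp {v : E → E} (hv : ContDiff ℝ 1 v) {γ c d : C(unitInterval, E)}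
    {x : E} (hγ : ∀ τ, γ τ = x + pathIntegral E c τ)
    (hd : ∀ τ, d τ = v (γ τ) + (τ : ℝ) • fderiv ℝ v (γ τ) (c τ)) (τ : unitInterval) :
    pathIntegral E d τ = (τ : ℝ) • v (γ τ) := by
  set C : ℝ → E := fun u => c (projIcc 0 1 zero_le_one u) with hC
  have hCc : Continuous C := by fun_prop
  set G : ℝ → E := fun u => x + ∫ w in (0 : ℝ)..u, C w
  have hG : ∀ u, HasDerivAt G (C u) u := fun u =>
    (hCc.integral_hasStrictDerivAt 0 u).hasDerivAt.const_add x
  have hGc : Continuous G := continuous_iff_continuousAt.2 fun u => (hG u).continuousAt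
  have hGγ : ∀ σ : unitInterval, G σ = γ σ := fun σ => (hγ σ).symm
  have hprod : ∀ u, HasDerivAt (fun u => u • v (G u)) (v (G u) + u • fderiv ℝ v (G u) (C u)) u :=
    fun u => ((hasDerivAt_id u).smul
      (((hv.differentiable (by simp) (G u)).hasFDerivAt).comp_hasDerivAt u (hG u))).congr_deriv
        (by simp [add_comm])
  have hcont : Continuous fun u => v (G u) + u • fderiv ℝ v (G u) (C u) := by
    have := hv.continuous
    have := hv.continuous_fderiv (by simp)
    fun_prop
  have hintegral := pathIntegral_eq_sub_of_hasDerivAt hprod hcont (γ := d) (fun σ => by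
    rw [hd, hGγ, hC]
    simp [projIcc_val]) τ
  simpa only [hGγ, zero_smul, sub_zero] using hintegral

end PathIntegral

section ImplicitFunction

variable {P C F : Type*} [NormedAddCommGroup P] [NormedSpace ℝ P] [CompleteSpace P]
  [NormedAddCommGroup C] [NormedSpace ℝ C] [CompleteSpace C]
  [NormedAddCommGroup F] [NormedSpace ℝ F] [CompleteSpace F]

lemma contDiffAt_of_apply_eq {n : ℕ∞ω} (hn : n ≠ 0) {G : P × C → F} {Γ : P → C} {p : P} {c : F}
    (hG : ContDiffAt ℝ n G (p, Γ p)) (hinv : (fderiv ℝ G (p, Γ p) ∘L .inr ℝ P C).IsInvertible)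
    (hΓ : ContinuousAt Γ p) (hΓG : ∀ᶠ p' in 𝓝 p, G (p', Γ p') = c) : ContDiffAt ℝ n Γ p := by
  refine (hG.contDiffAt_implicitFunction hn hinv).congr_of_eventuallyEq ?_
  filter_upwards [hΓG, (continuousAt_id.prodMk hΓ).eventually
    (hG.eventually_apply_eq_iff_implicitFunction hn hinv)] with p' hp' huniq
  exact (huniq.1 (hp'.trans hΓG.self_of_nhds.symm)).symm

lemma exists_contDiffOn_implicitFunction {G : P × C → F} (hG : ContDiff ℝ ∞ G) {O : Set (P × C)}
    (hO : IsOpen O) {q : P × C} (hq : q ∈ O)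
    (hinv : (fderiv ℝ G q ∘L .inr ℝ P C).IsInvertible) :
    ∃ (Γ : P → C) (W : Set P), IsOpen W ∧ q.1 ∈ W ∧ ContDiffOn ℝ ∞ Γ W ∧
      (∀ p ∈ W, (p, Γ p) ∈ O ∧ G (p, Γ p) = G q ∧
        (fderiv ℝ G (p, Γ p) ∘L .inr ℝ P C).IsInvertible) ∧
      ∀ᶠ q' in 𝓝 q, G q' = G q → Γ q'.1 = q'.2 := by
  set Γ := hG.contDiffAt.implicitFunction (by simp) hinv
  have hΓq : Γ q.1 = q.2 := hG.contDiffAt.implicitFunction_apply_self _ hinv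
  set I : Set (P × C) := {q' | (fderiv ℝ G q' ∘L .inr ℝ P C).IsInvertible}
  have hI : IsOpen I := ContinuousLinearEquiv.isOpen.preimage
    ((hG.continuous_fderiv (by simp)).clm_comp continuous_const)
  have hΓc : ∀ᶠ p in 𝓝 q.1, ContinuousAt Γ p :=
    (((hG.contDiffAt.contDiffAt_implicitFunction (by simp) hinv).of_le
      (m := 1) (by simp)).eventually (by simp)).mono fun _ h => h.continuousAt
  have hmem : ∀ᶠ p in 𝓝 q.1, (p, Γ p) ∈ O ∩ I :=
    (continuousAt_id.prodMk hΓc.self_of_nhds).eventually_mem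
      (by simpa [hΓq] using (hO.inter hI).mem_nhds ⟨hq, hinv⟩)
  obtain ⟨W, hW, hWo, hqW⟩ := eventually_nhds_iff.1
    ((hΓc.and hmem).and (hG.contDiffAt.eventually_apply_implicitFunction (by simp) hinv))
  refine ⟨Γ, W, hWo, hqW, fun p hp => ?_, fun p hp => ⟨(hW p hp).1.2.1, (hW p hp).2,
    (hW p hp).1.2.2⟩, ?_⟩
  · exact (contDiffAt_of_apply_eq (n := ∞) (by simp) hG.contDiffAt (hW p hp).1.2.2
      (hW p hp).1.1 (Filter.eventually_of_mem (hWo.mem_nhds hp) fun p' hp' =>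
        (hW p' hp').2)).contDiffWithinAt
  · exact (hG.contDiffAt.eventually_apply_eq_iff_implicitFunction (by simp) hinv).mono
      fun _ h => h.1

end ImplicitFunction

section JointFlow

universe u

variable {T E : Type u} [NormedAddCommGroup T] [NormedSpace ℝ T]
  [NormedAddCommGroup E] [NormedSpace ℝ E]

/-- The path `τ ↦ A (γ τ) t` of values along `γ` of the vector field `A t`, where `A` is a linear
family of vector fields. -/
noncomputable def velocity (A : C(E, T →L[ℝ] E)) (q : T × C(unitInterval, E)) :
    C(unitInterval, E) :=
  pointwiseApply unitInterval T E (A.comp q.2) (ContinuousMap.const unitInterval q.1)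

/-- The defect in the integral equation `γ = x + ∫ A(γ) t`, whose solution is the path
`τ ↦ exp(τ A t)(x)`. The end point of the path depends on `t` as the joint flow does. -/
noncomputable def flowDefect (A : C(E, T →L[ℝ] E)) (q : (T × E) × C(unitInterval, E)) :
    C(unitInterval, E) :=
  q.2 - ContinuousMap.const unitInterval q.1.2 - pathIntegral E (velocity A (q.1.1, q.2))

lemma flowDefect_eq_zero_iff {A : C(E, T →L[ℝ] E)} {q : (T × E) × C(unitInterval, E)} :
    flowDefect A q = 0 ↔ ∀ τ, q.2 τ = q.1.2 + pathIntegral E (velocity A (q.1.1, q.2)) τ := by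
  simp [flowDefect, ContinuousMap.ext_iff, sub_sub, sub_eq_zero]

lemma flowDefect_zero_const (A : C(E, T →L[ℝ] E)) (x : E) :
    flowDefect A ((0, x), ContinuousMap.const unitInterval x) = 0 := by
  have : velocity A (0, ContinuousMap.const unitInterval x) = 0 := by ext τ; simp [velocity]
  simp [flowDefect, this]

set_option synthInstance.maxHeartbeats 200000 in
-- the norm on `C(K, E →L[ℝ] F)` is slow to synthesise
lemma contDiff_velocity {A : C(E, T →L[ℝ] E)} (hA : ContDiff ℝ ∞ A) :
    ContDiff ℝ ∞ (velocity A) :=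
  ((pointwiseApply unitInterval T E).contDiff.comp
    ((contDiff_continuousMap_comp A hA).comp contDiff_snd)).clm_apply
      ((ContinuousLinearMap.const ℝ unitInterval : T →L[ℝ] _).contDiff.comp contDiff_fst)

lemma contDiff_flowDefect {A : C(E, T →L[ℝ] E)} (hA : ContDiff ℝ ∞ A) :
    ContDiff ℝ ∞ (flowDefect A) :=
  (contDiff_snd.sub ((ContinuousLinearMap.const ℝ unitInterval : E →L[ℝ] _).contDiff.comp
    (contDiff_snd.comp contDiff_fst))).sub ((pathIntegral E).contDiff.comp
      ((contDiff_velocity hA).comp ((contDiff_fst.comp contDiff_fst).prodMk contDiff_snd)))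

lemma fderiv_velocity_apply {A : C(E, T →L[ℝ] E)} (hA : ContDiff ℝ ∞ A)
    (q : T × C(unitInterval, E)) (a : T) (w : C(unitInterval, E)) (τ : unitInterval) :
    fderiv ℝ (velocity A) q (a, w) τ
      = fderiv ℝ A (q.2 τ) (w τ) q.1 + A (q.2 τ) a := by
  have hev : HasFDerivAt (fun q => velocity A q τ) _ q :=
    (ContinuousMap.evalCLM ℝ τ : C(unitInterval, E) →L[ℝ] E).hasFDerivAt.comp q
      ((contDiff_velocity hA).differentiable (by simp) q).hasFDerivAt
  have hpt : HasFDerivAt (fun q : T × C(unitInterval, E) => A (q.2 τ) q.1) _ q :=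
    ((hA.differentiable (by simp) (q.2 τ)).hasFDerivAt.comp q
      ((ContinuousMap.evalCLM ℝ τ : C(unitInterval, E) →L[ℝ] E).hasFDerivAt.comp q
        hasFDerivAt_snd)).clm_apply hasFDerivAt_fst
  simpa [add_comm] using DFunLike.congr_fun (hev.unique hpt) (a, w)

lemma fderiv_flowDefect_apply {A : C(E, T →L[ℝ] E)} (hA : ContDiff ℝ ∞ A)
    (q : (T × E) × C(unitInterval, E)) (a : T) (v : E) (w : C(unitInterval, E)) :
    fderiv ℝ (flowDefect A) q ((a, v), w) = w - ContinuousMap.const unitInterval v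
      - pathIntegral E (fderiv ℝ (velocity A) (q.1.1, q.2) (a, w)) := by
  have hvel := ((contDiff_velocity hA).differentiable (by simp) (q.1.1, q.2)).hasFDerivAt.comp q
    (f := fun q : (T × E) × C(unitInterval, E) => (q.1.1, q.2))
    ((hasFDerivAt_fst.comp q hasFDerivAt_fst).prodMk hasFDerivAt_snd)
  have hdefect : HasFDerivAt (flowDefect A) _ q := (hasFDerivAt_snd.sub
    ((ContinuousLinearMap.const ℝ unitInterval : E →L[ℝ] _).hasFDerivAt.comp q
      (hasFDerivAt_snd.comp q hasFDerivAt_fst))).sub ((pathIntegral E).hasFDerivAt.comp q hvel)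
  rw [hdefect.fderiv]
  rfl

lemma isInvertible_fderiv_flowDefect {A : C(E, T →L[ℝ] E)} (hA : ContDiff ℝ ∞ A) (x : E)
    (γ : C(unitInterval, E)) :
    (fderiv ℝ (flowDefect A) ((0, x), γ) ∘L .inr ℝ (T × E) C(unitInterval, E)).IsInvertible := by
  refine ⟨ContinuousLinearEquiv.refl ℝ _, ContinuousLinearMap.ext fun w => ?_⟩
  have hvel : fderiv ℝ (velocity A) (0, γ) (0, w) = 0 := by
    ext τ
    simp [fderiv_velocity_apply hA]
  have hw := fderiv_flowDefect_apply hA ((0, x), γ) 0 0 w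
  rw [hvel] at hw
  simpa only [map_zero, sub_zero, ContinuousMap.const_zero] using! hw.symm

lemma fderiv_flowDefect_smul_eq_zero [CompleteSpace E] {A : C(E, T →L[ℝ] E)}
    (hA : ContDiff ℝ ∞ A) {q : (T × E) × C(unitInterval, E)}
    (hcomm : ∀ (τ : unitInterval) (a b : T), fderiv ℝ A (q.2 τ) (A (q.2 τ) a) b
      = fderiv ℝ A (q.2 τ) (A (q.2 τ) b) a)
    (hq : flowDefect A q = 0) (a : T) {u : C(unitInterval, E)}
    (hu : ∀ τ : unitInterval, u τ = (τ : ℝ) • A (q.2 τ) a) :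
    fderiv ℝ (flowDefect A) q ((a, 0), u) = 0 := by
  have hval : ContDiff ℝ 1 fun x => A x a := (hA.of_le (by simp)).clm_apply contDiff_const
  have hfderiv (x w : E) : fderiv ℝ (fun x => A x a) x w = fderiv ℝ A x w a := by
    rw [fderiv_clm_apply (hA.differentiable (by simp) x) (by fun_prop)]
    simp
  ext τ
  have hintegral := pathIntegral_eq_smul_comp hval (flowDefect_eq_zero_iff.1 hq)
    (d := fderiv ℝ (velocity A) (q.1.1, q.2) (a, u)) (fun σ => by
      rw [fderiv_velocity_apply hA, hu, hfderiv, map_smul, add_comm]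
      simp [velocity, hcomm σ a]) τ
  simp [fderiv_flowDefect_apply hA, hintegral, hu]

lemma fderiv_eq_smul_of_flowDefect_eq_zero [CompleteSpace E] {A : C(E, T →L[ℝ] E)}
    (hA : ContDiff ℝ ∞ A) {Γ : T × E → C(unitInterval, E)} {p : T × E}
    (hΓ : DifferentiableAt ℝ Γ p) (hzero : ∀ᶠ p' in 𝓝 p, flowDefect A (p', Γ p') = 0)
    (hinv : (fderiv ℝ (flowDefect A) (p, Γ p) ∘L .inr ℝ (T × E) C(unitInterval, E)).IsInvertible)
    (hcomm : ∀ (τ : unitInterval) (a b : T), fderiv ℝ A (Γ p τ) (A (Γ p τ) a) b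
      = fderiv ℝ A (Γ p τ) (A (Γ p τ) b) a) (a : T) (τ : unitInterval) :
    fderiv ℝ Γ p (a, 0) τ = (τ : ℝ) • A (Γ p τ) a := by
  set u : C(unitInterval, E) := ⟨fun τ => (τ : ℝ) • A (Γ p τ) a, by fun_prop⟩ with hu
  have hlin := fderiv_flowDefect_smul_eq_zero hA (q := (p, Γ p)) hcomm hzero.self_of_nhds a
    (u := u) fun _ => rfl
  have hder : fderiv ℝ (flowDefect A) (p, Γ p) ((a, 0), fderiv ℝ Γ p (a, 0)) = 0 := by
    have hcomp := ((contDiff_flowDefect hA).differentiable (by simp) (p, Γ p)).hasFDerivAt.comp p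
      (f := fun p => (p, Γ p)) ((hasFDerivAt_id p).prodMk hΓ.hasFDerivAt)
    have hconst :=
      (hasFDerivAt_const (𝕜 := ℝ) (0 : C(unitInterval, E)) p).congr_of_eventuallyEq hzero
    simpa using congrArg (fun B : T × E →L[ℝ] C(unitInterval, E) => B (a, 0))
      (hcomp.unique hconst)
  have heq : fderiv ℝ Γ p (a, 0) = u := by
    obtain ⟨e, he⟩ := hinv
    refine e.injective ?_
    have happly (w : C(unitInterval, E)) : e w = fderiv ℝ (flowDefect A) (p, Γ p) ((a, 0), w)
        - fderiv ℝ (flowDefect A) (p, Γ p) ((a, 0), 0) := by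
      rw [← map_sub]
      simpa using DFunLike.congr_fun he w
    rw [happly, happly, hlin, hder]
  rw [heq, hu]
  rfl

theorem exists_joint_flow [CompleteSpace T] [CompleteSpace E] {A : E → T →L[ℝ] E}
    (hA : ContDiff ℝ ∞ A) {V : Set E} (hV : IsOpen V) {x₀ : E} (hx₀ : x₀ ∈ V)
    (hcomm : ∀ x ∈ V, ∀ a b, fderiv ℝ A x (A x a) b = fderiv ℝ A x (A x b) a) :
    ∃ (Ψ : T × E → E) (W : Set (T × E)), IsOpen W ∧ (0, x₀) ∈ W ∧ ContDiffOn ℝ ∞ Ψ W ∧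
      MapsTo Ψ W V ∧ (∀ x, (0, x) ∈ W → Ψ (0, x) = x) ∧
      ∀ q ∈ W, ∀ a, fderiv ℝ Ψ q (a, 0) = A (Ψ q) a := by
  set A' : C(E, T →L[ℝ] E) := ⟨A, hA.continuous⟩
  have hA' : ContDiff ℝ ∞ A' := hA
  set O : Set ((T × E) × C(unitInterval, E)) := {q | MapsTo q.2 univ V}
  have hO : IsOpen O :=
    (ContinuousMap.isOpen_setOfPred_mapsTo isCompact_univ hV).preimage continuous_snd
  obtain ⟨Γ, W, hWo, hxW, hΓ, hΓW, huniq⟩ := exists_contDiffOn_implicitFunction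
    (contDiff_flowDefect hA') hO (q := ((0, x₀), .const unitInterval x₀)) (fun _ _ => hx₀)
    (isInvertible_fderiv_flowDefect hA' x₀ _)
  rw [flowDefect_zero_const] at hΓW huniq
  have hconst : Continuous fun p : T × E => (p, ContinuousMap.const unitInterval p.2) := by
    fun_prop
  obtain ⟨U, hU, hUo, hxU⟩ := eventually_nhds_iff.1
    ((hconst.tendsto (0, x₀)).eventually huniq)
  refine ⟨fun p => Γ p 1, W ∩ U, hWo.inter hUo, ⟨hxW, hxU⟩, ?_, fun p hp =>
    (hΓW p hp.1).1 (mem_univ _), fun x hx => ?_, fun p hp a => ?_⟩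
  · exact (ContinuousMap.evalCLM ℝ (1 : unitInterval)).contDiff.comp_contDiffOn
      (hΓ.mono inter_subset_left)
  · exact DFunLike.congr_fun (hU _ hx.2 (flowDefect_zero_const A' x)) 1
  · have hd : DifferentiableAt ℝ Γ p :=
      (hΓ.contDiffAt (hWo.mem_nhds hp.1)).differentiableAt (by simp)
    have hderiv := fderiv_eq_smul_of_flowDefect_eq_zero hA' hd
      (Filter.eventually_of_mem (hWo.mem_nhds hp.1) fun p' hp' => (hΓW p' hp').2.1)
      (hΓW p hp.1).2.2 (fun τ => hcomm _ ((hΓW p hp.1).1 (mem_univ τ))) a 1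
    have hend : HasFDerivAt (fun p => Γ p 1) _ p :=
      (ContinuousMap.evalCLM ℝ (1 : unitInterval) : C(unitInterval, E) →L[ℝ] E).hasFDerivAt.comp p
        hd.hasFDerivAt
    simpa [hend.fderiv] using! hderiv

end JointFlow

/-! ### Coordinates adapted to a commuting frame -/

section StraightenedFlow

lemma exists_contDiff_eqOn_ball {E F : Type*} [NormedAddCommGroup E] [NormedSpace ℝ E]
    [FiniteDimensional ℝ E] [NormedAddCommGroup F] [NormedSpace ℝ F] {V : Set E} (hV : IsOpen V)
    {f : E → F} (hf : ContDiffOn ℝ ∞ f V) {x₀ : E} (hx₀ : x₀ ∈ V) :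
    ∃ g : E → F, ContDiff ℝ ∞ g ∧ ∃ δ > 0, Metric.ball x₀ δ ⊆ V ∧
      EqOn g f (Metric.ball x₀ δ) := by
  obtain ⟨R, hR, hRV⟩ := Metric.isOpen_iff.1 hV x₀ hx₀
  let χ : ContDiffBump x₀ := ⟨R / 4, R / 2, by positivity, by linarith⟩
  refine ⟨fun x => χ x • f x, contDiff_iff_contDiffAt.2 fun x => ?_, R / 4, by positivity,
    (Metric.ball_subset_ball (by linarith)).trans hRV, fun x hx => ?_⟩
  · by_cases hx : x ∈ tsupport χ
    · rw [χ.tsupport_eq] at hx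
      have hxV : x ∈ V := hRV (lt_of_le_of_lt (Metric.mem_closedBall.1 hx)
        (show R / 2 < R by linarith))
      exact χ.contDiffAt.smul (hf.contDiffAt (hV.mem_nhds hxV))
    · have : (fun x => χ x • f x) =ᶠ[𝓝 x] fun _ => 0 := by
        filter_upwards [(isClosed_tsupport χ).isOpen_compl.mem_nhds hx] with y hy
        rw [image_eq_zero_of_notMem_tsupport hy, zero_smul]
      exact contDiffAt_const.congr_of_eventuallyEq this
  · simp only [χ.one_of_mem_closedBall (Metric.ball_subset_closedBall hx), one_smul]

universe u

variable {T E : Type u} [NormedAddCommGroup T] [NormedSpace ℝ T]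
  [NormedAddCommGroup E] [NormedSpace ℝ E]

lemma apply_jointFlow {A : E → T →L[ℝ] E} {α : E → E →L[ℝ] T} {H : E → T} {V : Set E}
    {Ψ : T × E → E} {B : Set T} (hB : IsOpen B) (hBc : IsPreconnected B) (h0 : 0 ∈ B) {x : E}
    (hdual : ∀ x ∈ V, ∀ a, α x (A x a) = a) (hH : ∀ x ∈ V, HasFDerivAt H (α x) x)
    (hΨV : ∀ t ∈ B, Ψ (t, x) ∈ V) (hΨ0 : Ψ (0, x) = x)
    (hΨd : ∀ t ∈ B, DifferentiableAt ℝ Ψ (t, x))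
    (hΨ : ∀ t ∈ B, ∀ a, fderiv ℝ Ψ (t, x) (a, 0) = A (Ψ (t, x)) a) {t : T} (ht : t ∈ B) :
    H (Ψ (t, x)) = t + H x := by
  have hder (t) (ht : t ∈ B) :
      HasFDerivAt (fun t => H (Ψ (t, x))) (ContinuousLinearMap.id ℝ T) t := by
    have hpath : HasFDerivAt (fun t => Ψ (t, x)) _ t :=
      (hΨd t ht).hasFDerivAt.comp t (hasFDerivAt_prodMk_left t x)
    refine ((hH _ (hΨV t ht)).comp t hpath).congr_fderiv (ContinuousLinearMap.ext fun a => ?_)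
    simp [hΨ t ht, hdual _ (hΨV t ht)]
  obtain ⟨c, hc⟩ := hB.exists_eq_add_of_fderiv_eq hBc
    (fun t ht => (hder t ht).differentiableAt.differentiableWithinAt) differentiableOn_id
    fun t ht => (hder t ht).fderiv.trans fderiv_id.symm
  have h0' := hc h0
  simp only [id, hΨ0, zero_add] at h0'
  rw [h0']
  exact hc ht

/-- `A` is a linear family of commuting vector fields on the open set `V`, indexed by `T` and dual
to the closed `T`-valued `1`-form `α`. -/
structure IsCommutingFrame (A : E → T →L[ℝ] E) (α : E → E →L[ℝ] T) (V : Set E) : Prop where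
  isOpen : IsOpen V
  contDiffOn_frame : ContDiffOn ℝ ∞ A V
  contDiffOn_form : ContDiffOn ℝ ∞ α V
  form_frame : ∀ x ∈ V, ∀ a, α x (A x a) = a
  comm : ∀ x ∈ V, ∀ a b, fderiv ℝ A x (A x a) b = fderiv ℝ A x (A x b) a
  closed : ∀ x ∈ V, ∀ u v, fderiv ℝ α x u v = fderiv ℝ α x v u

/-- `H` straightens the joint flow `Ψ` of `A` to translations: `α = dH` and
`H(Ψ(t, x)) = t + H(x)`. -/
structure IsStraightenedFlow (A : E → T →L[ℝ] E) (α : E → E →L[ℝ] T) (V : Set E) (x₀ : E)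
    (r : ℝ) (Ψ : T × E → E) (H : E → T) : Prop where
  contDiffOn : ContDiffOn ℝ ∞ Ψ (Metric.ball 0 r ×ˢ Metric.ball x₀ r)
  mapsTo : MapsTo Ψ (Metric.ball 0 r ×ˢ Metric.ball x₀ r) V
  apply_zero : ∀ x ∈ Metric.ball x₀ r, Ψ (0, x) = x
  fderiv_apply : ∀ q ∈ Metric.ball 0 r ×ˢ Metric.ball x₀ r, ∀ a,
    fderiv ℝ Ψ q (a, 0) = A (Ψ q) a
  contDiffOn_primitive : ContDiffOn ℝ ∞ H (Metric.ball x₀ r)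
  hasFDerivAt : ∀ x ∈ Metric.ball x₀ r, HasFDerivAt H (α x) x
  primitive_base : H x₀ = 0
  form_fderiv : ∀ q ∈ Metric.ball 0 r ×ˢ Metric.ball x₀ r, ∀ w,
    α (Ψ q) (fderiv ℝ Ψ q w) = w.1 + α q.2 w.2

lemma exists_primitive {α : E → E →L[ℝ] T} [CompleteSpace T] {x₀ : E} {δ : ℝ}
    (hα : ContDiffOn ℝ ∞ α (Metric.ball x₀ δ))
    (hclosed : ∀ x ∈ Metric.ball x₀ δ, ∀ u v, fderiv ℝ α x u v = fderiv ℝ α x v u) :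
    ∃ H : E → T, ContDiffOn ℝ ∞ H (Metric.ball x₀ δ) ∧
      (∀ x ∈ Metric.ball x₀ δ, HasFDerivAt H (α x) x) ∧ H x₀ = 0 := by
  obtain ⟨H, hH⟩ := (convex_ball x₀ δ).exists_forall_hasFDerivAt_of_fderiv_symmetric
    Metric.isOpen_ball (hα.differentiableOn (by simp)) hclosed
  refine ⟨fun x => H x - H x₀, ?_, fun x hx => (hH x hx).sub_const _, sub_self _⟩
  refine ContDiffOn.sub ((contDiffOn_infty_iff_fderiv_of_isOpen Metric.isOpen_ball).2
    ⟨fun x hx => (hH x hx).differentiableAt.differentiableWithinAt, hα.congr fun x hx =>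
      (hH x hx).fderiv⟩) contDiffOn_const

lemma exists_straightenedFlow [CompleteSpace T] [FiniteDimensional ℝ E] {A : E → T →L[ℝ] E}
    {α : E → E →L[ℝ] T} {V : Set E} (h : IsCommutingFrame A α V) {x₀ : E} (hx₀ : x₀ ∈ V) :
    ∃ r > 0, ∃ (Ψ : T × E → E) (H : E → T), IsStraightenedFlow A α V x₀ r Ψ H := by
  have : CompleteSpace E := FiniteDimensional.complete ℝ E
  obtain ⟨A', hA', δ, hδ, hδV, hAA'⟩ := exists_contDiff_eqOn_ball h.isOpen h.contDiffOn_frame hx₀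
  have hfderivA (x) (hx : x ∈ Metric.ball x₀ δ) : fderiv ℝ A' x = fderiv ℝ A x :=
    (hAA'.eventuallyEq_of_mem (Metric.isOpen_ball.mem_nhds hx)).fderiv_eq
  obtain ⟨H, hHs, hH, hH0⟩ := exists_primitive (h.contDiffOn_form.mono hδV) fun x hx =>
    h.closed x (hδV hx)
  obtain ⟨Ψ, W, hWo, hxW, hΨs, hΨV, hΨ0, hΨd⟩ := exists_joint_flow hA' Metric.isOpen_ball
    (Metric.mem_ball_self hδ) fun x hx a b => by
      rw [hfderivA x hx, hAA' hx]
      exact h.comm x (hδV hx) a b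
  obtain ⟨ε, hε, hεW⟩ := Metric.isOpen_iff.1 hWo _ hxW
  rw [← ball_prod_same] at hεW
  set r := min δ ε
  have hr : 0 < r := lt_min hδ hε
  have hrδ : Metric.ball x₀ r ⊆ Metric.ball x₀ δ := Metric.ball_subset_ball (min_le_left _ _)
  have hrW : Metric.ball (0 : T) r ×ˢ Metric.ball x₀ r ⊆ W := (Set.prod_mono
    (Metric.ball_subset_ball (min_le_right _ _))
    (Metric.ball_subset_ball (min_le_right _ _))).trans hεW
  have hd (q) (hq : q ∈ W) : DifferentiableAt ℝ Ψ q :=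
    (hΨs.contDiffAt (hWo.mem_nhds hq)).differentiableAt (by simp)
  have hΨA (q) (hq : q ∈ W) (a : T) : fderiv ℝ Ψ q (a, 0) = A (Ψ q) a := by
    rw [hΨd q hq, hAA' (hΨV hq)]
  have htranslate : EqOn (H ∘ Ψ) (fun q => q.1 + H q.2)
      (Metric.ball (0 : T) r ×ˢ Metric.ball x₀ r) := fun q hq =>
    apply_jointFlow (V := Metric.ball x₀ δ) Metric.isOpen_ball
      (convex_ball (0 : T) r).isPreconnected (Metric.mem_ball_self hr)
      (fun x hx => h.form_frame x (hδV hx)) hH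
      (fun t ht => hΨV (hrW ⟨ht, hq.2⟩)) (hΨ0 _ (hrW ⟨Metric.mem_ball_self hr, hq.2⟩))
      (fun t ht => hd _ (hrW ⟨ht, hq.2⟩)) (fun t ht => hΨA _ (hrW ⟨ht, hq.2⟩)) hq.1
  refine ⟨r, hr, Ψ, H, hΨs.mono hrW, fun q hq => hδV (hΨV (hrW hq)),
    fun x hx => hΨ0 x (hrW ⟨Metric.mem_ball_self hr, hx⟩), fun q hq => hΨA q (hrW hq),
    hHs.mono hrδ, fun x hx => hH x (hrδ hx), hH0, fun q hq w => ?_⟩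
  have hleft := (hH _ (hΨV (hrW hq))).comp q (hd q (hrW hq)).hasFDerivAt
  have hright : HasFDerivAt (fun q : T × E => q.1 + H q.2) _ q :=
    hasFDerivAt_fst.add ((hH _ (hrδ hq.2)).comp q hasFDerivAt_snd)
  have hopen : IsOpen (Metric.ball (0 : T) r ×ˢ Metric.ball x₀ r) :=
    Metric.isOpen_ball.prod Metric.isOpen_ball
  exact DFunLike.congr_fun (hleft.unique (hright.congr_of_eventuallyEq
    (htranslate.eventuallyEq_of_mem (hopen.mem_nhds hq)))) w

lemma exists_injective_comp_eq_zero {T E F : Type*} [NormedAddCommGroup T] [NormedSpace ℝ T]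
    [NormedAddCommGroup E] [NormedSpace ℝ E] [NormedAddCommGroup F] [NormedSpace ℝ F]
    [FiniteDimensional ℝ E] [FiniteDimensional ℝ F] {α : E →L[ℝ] T}
    (hα : Function.Surjective α)
    (hdim : Module.finrank ℝ E = Module.finrank ℝ T + Module.finrank ℝ F) :
    ∃ L : F →L[ℝ] E, Function.Injective L ∧ ∀ y, α (L y) = 0 := by
  have hker : Module.finrank ℝ F = Module.finrank ℝ α.ker := by
    have := α.toLinearMap.finrank_range_add_finrank_ker
    rw [LinearMap.range_eq_top.2 hα, finrank_top] at this
    lia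
  let e : F ≃ₗ[ℝ] α.ker := LinearEquiv.ofFinrankEq _ _ hker
  exact ⟨(α.ker.subtype ∘ₗ e.toLinearMap).toContinuousLinearMap,
    Subtype.val_injective.comp e.injective, fun y => (e y).2⟩

lemma IsStraightenedFlow.fderiv_base {A : E → T →L[ℝ] E} {α : E → E →L[ℝ] T} {V : Set E}
    {x₀ : E} {r : ℝ} (hr : 0 < r) {Ψ : T × E → E} {H : E → T}
    (h : IsStraightenedFlow A α V x₀ r Ψ H) (v : E) : fderiv ℝ Ψ (0, x₀) (0, v) = v := by
  have hx₀ : x₀ ∈ Metric.ball x₀ r := Metric.mem_ball_self hr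
  have hd : DifferentiableAt ℝ Ψ (0, x₀) := (h.contDiffOn.contDiffAt
    ((Metric.isOpen_ball.prod Metric.isOpen_ball).mem_nhds
      ⟨Metric.mem_ball_self hr, hx₀⟩)).differentiableAt (by simp)
  have hid : (fun x => Ψ (0, x)) =ᶠ[𝓝 x₀] id :=
    eventuallyEq_of_mem (Metric.isOpen_ball.mem_nhds hx₀) h.apply_zero
  exact DFunLike.congr_fun ((hd.hasFDerivAt.comp x₀ (hasFDerivAt_prodMk_right 0 x₀)).unique
    ((hasFDerivAt_id x₀).congr_of_eventuallyEq hid)) v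

variable {F : Type*} [NormedAddCommGroup F]

lemma IsStraightenedFlow.exists_adapted [NormedSpace ℝ F] {A : E → T →L[ℝ] E}
    {α : E → E →L[ℝ] T} {V : Set E} {x₀ : E} {r : ℝ} (hr : 0 < r) {Ψ : T × E → E} {H : E → T}
    (h : IsStraightenedFlow A α V x₀ r Ψ H) {L : F →L[ℝ] E} (hL : Function.Injective L)
    (hαL : ∀ y, α x₀ (L y) = 0) :
    ∃ (Θ : T × F → E) (U : Set (T × F)), IsOpen U ∧ 0 ∈ U ∧ ContDiffOn ℝ ∞ Θ U ∧ MapsTo Θ U V ∧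
      Θ 0 = x₀ ∧ (∀ q ∈ U, ∀ a, fderiv ℝ Θ q (a, 0) = A (Θ q) a) ∧
      (∀ q ∈ U, ∀ w, α (Θ q) (fderiv ℝ Θ q w) = w.1) ∧ Function.Injective (fderiv ℝ Θ 0) := by
  set c : F → E := fun y => x₀ + L y with hc
  have hcs : ContDiff ℝ ∞ c := contDiff_const.add L.contDiff
  set κ : T × F → T × E := fun q => (q.1 - H (c q.2), c q.2) with hκ
  have hκd (q) (hq : c q.2 ∈ Metric.ball x₀ r) : HasFDerivAt κ
      ((ContinuousLinearMap.fst ℝ T F - α (c q.2) ∘L L ∘L .snd ℝ T F).prod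
        (L ∘L .snd ℝ T F)) q := by
    have hcd : HasFDerivAt (fun q : T × F => c q.2) (L ∘L .snd ℝ T F) q :=
      (L ∘L .snd ℝ T F).hasFDerivAt.const_add x₀
    exact (hasFDerivAt_fst.sub ((h.hasFDerivAt _ hq).comp q hcd)).prodMk hcd
  have hκs : ContDiffOn ℝ ∞ κ (univ ×ˢ (c ⁻¹' Metric.ball x₀ r)) :=
    (contDiffOn_fst.sub (h.contDiffOn_primitive.comp (hcs.comp contDiff_snd).contDiffOn
      fun q hq => hq.2)).prodMk (hcs.comp contDiff_snd).contDiffOn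
  have hκ0 : κ 0 = (0, x₀) := by simp [hκ, hc, h.primitive_base]
  set U : Set (T × F) := univ ×ˢ (c ⁻¹' Metric.ball x₀ r) ∩
    κ ⁻¹' (Metric.ball 0 r ×ˢ Metric.ball x₀ r)
  have hballs : IsOpen (Metric.ball (0 : T) r ×ˢ Metric.ball x₀ r) :=
    Metric.isOpen_ball.prod Metric.isOpen_ball
  have hU : IsOpen U := hκs.continuousOn.isOpen_inter_preimage
    (isOpen_univ.prod (Metric.isOpen_ball.preimage hcs.continuous)) hballs
  have h0U : (0 : T × F) ∈ U := by
    refine ⟨⟨mem_univ _, by simpa [hc] using hr⟩, ?_⟩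
    simpa [mem_preimage, hκ0] using hr
  have hΘd (q) (hq : q ∈ U) := ((h.contDiffOn.contDiffAt (hballs.mem_nhds hq.2)).differentiableAt
    (by simp)).hasFDerivAt.comp q (hκd q hq.1.2)
  refine ⟨Ψ ∘ κ, U, hU, h0U, h.contDiffOn.comp (hκs.mono inter_subset_left) fun q hq => hq.2,
    fun q hq => h.mapsTo hq.2, ?_, fun q hq a => ?_, fun q hq w => ?_, ?_⟩
  · rw [Function.comp_apply, hκ0, h.apply_zero _ (Metric.mem_ball_self hr)]
  · simpa [(hΘd q hq).fderiv] using h.fderiv_apply _ hq.2 a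
  · rw [(hΘd q hq).fderiv]
    simpa [hκ] using h.form_fderiv _ hq.2 (w.1 - α (c q.2) (L w.2), L w.2)
  · refine (injective_iff_map_eq_zero _).2 fun w hw => ?_
    have hform := h.form_fderiv _ h0U.2 (w.1 - α (c 0) (L w.2), L w.2)
    rw [(hΘd 0 h0U).fderiv] at hw
    have hw' : fderiv ℝ Ψ (κ 0) (w.1 - α (c 0) (L w.2), L w.2) = 0 := by simpa using hw
    have hc0 : c 0 = x₀ := by simp [hc]
    rw [hw', map_zero, hκ0, hc0, hαL, sub_zero, add_zero] at hform
    rw [hκ0, hc0, hαL, ← hform, sub_zero, h.fderiv_base hr] at hw'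
    exact Prod.ext hform.symm (hL (hw'.trans (map_zero L).symm))

end StraightenedFlow

section AdaptedCoordinates

lemma exists_openPartialHomeomorph_of_isInvertible {E F : Type*} [NormedAddCommGroup E]
    [NormedSpace ℝ E] [CompleteSpace E] [NormedAddCommGroup F] [NormedSpace ℝ F]
    {f : E → F} {U : Set E} (hU : IsOpen U) (hf : ContDiffOn ℝ ∞ f U)
    {a : E} (ha : a ∈ U) (hfa : (fderiv ℝ f a).IsInvertible) :
    ∃ e : OpenPartialHomeomorph E F, ⇑e = f ∧ a ∈ e.source ∧ e.source ⊆ U ∧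
      ContDiffOn ℝ ∞ e.symm e.target := by
  have hfU {x} (hx : x ∈ U) : ContDiffAt ℝ ∞ f x := hf.contDiffAt (hU.mem_nhds hx)
  have hd {x} (hx : x ∈ U) : DifferentiableAt ℝ f x := (hfU hx).differentiableAt (by simp)
  obtain ⟨f', hf'⟩ := hfa
  let e₀ := (hfU ha).toOpenPartialHomeomorph f (f' := f')
    (hf' ▸ (hd ha).hasFDerivAt) (by simp)
  let W := U ∩ fderiv ℝ f ⁻¹' range ((↑) : (E ≃L[ℝ] F) → E →L[ℝ] F)
  have hW : IsOpen W := (hf.continuousOn_fderiv_of_isOpen hU (by simp)).isOpen_inter_preimage hU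
    ContinuousLinearEquiv.isOpen
  have haW : a ∈ W := ⟨ha, f', hf'⟩
  have ha₀ : a ∈ e₀.source := (hfU ha).mem_toOpenPartialHomeomorph_source _ _
  refine ⟨e₀.restrOpen W hW, rfl, ⟨ha₀, haW⟩, fun x hx => hx.2.1, fun b hb =>
    ContDiffAt.contDiffWithinAt ?_⟩
  obtain ⟨hbU, g', hg'⟩ : e₀.symm b ∈ W := ((e₀.restrOpen W hW).map_target hb).2
  exact (e₀.restrOpen W hW).contDiffAt_symm hb (f₀' := g') (hg' ▸ (hd hbU).hasFDerivAt) (hfU hbU)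

lemma isInvertible_of_injective_of_finrank_eq {E F : Type*} [NormedAddCommGroup E]
    [NormedSpace ℝ E] [FiniteDimensional ℝ E] [NormedAddCommGroup F] [NormedSpace ℝ F]
    [FiniteDimensional ℝ F] {L : E →L[ℝ] F} (hL : Function.Injective L)
    (hdim : Module.finrank ℝ E = Module.finrank ℝ F) : L.IsInvertible :=
  ⟨(L.toLinearMap.linearEquivOfInjective hL hdim).toContinuousLinearEquiv,
    ContinuousLinearMap.ext fun _ => rfl⟩

/-- The local diffeomorphism `(t, y) ↦ (t, u(y))` of `T × F`, where `u` is the radial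
diffeomorphism of `F` onto `ball 0 r`. -/
noncomputable def ballProdUnivBall (T F : Type*) [NormedAddCommGroup T] [NormedAddCommGroup F]
    [InnerProductSpace ℝ F] (r : ℝ) : OpenPartialHomeomorph (T × F) (T × F) :=
  (OpenPartialHomeomorph.ofSet (Metric.ball (0 : T) r) Metric.isOpen_ball).prod
    (OpenPartialHomeomorph.univBall (0 : F) r)

section BallProdUnivBall

variable {T F : Type*} [NormedAddCommGroup T] [NormedAddCommGroup F] [InnerProductSpace ℝ F]
  {r : ℝ}

lemma ballProdUnivBall_source :
    (ballProdUnivBall T F r).source = Metric.ball (0 : T) r ×ˢ univ := by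
  simp [ballProdUnivBall]

lemma ballProdUnivBall_target (hr : 0 < r) :
    (ballProdUnivBall T F r).target = Metric.ball (0 : T) r ×ˢ Metric.ball (0 : F) r := by
  simp [ballProdUnivBall, OpenPartialHomeomorph.univBall_target (0 : F) hr]

lemma ballProdUnivBall_zero (r : ℝ) : ballProdUnivBall T F r 0 = 0 :=
  Prod.ext rfl (OpenPartialHomeomorph.univBall_apply_zero (0 : F) r)

variable [NormedSpace ℝ T]

lemma hasFDerivAt_ballProdUnivBall (r : ℝ) (q : T × F) :
    HasFDerivAt (ballProdUnivBall T F r) ((ContinuousLinearMap.id ℝ T).prodMap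
      (fderiv ℝ (OpenPartialHomeomorph.univBall (0 : F) r) q.2)) q :=
  HasFDerivAt.prodMap q (hasFDerivAt_id q.1)
    (OpenPartialHomeomorph.contDiff_univBall.differentiable (n := ∞) (by simp) _).hasFDerivAt

lemma contDiff_ballProdUnivBall : ContDiff ℝ ∞ (ballProdUnivBall T F r) :=
  contDiff_fst.prodMk (OpenPartialHomeomorph.contDiff_univBall.comp contDiff_snd)

lemma contDiffOn_ballProdUnivBall_symm (hr : 0 < r) :
    ContDiffOn ℝ ∞ (ballProdUnivBall T F r).symm (ballProdUnivBall T F r).target := by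
  rw [ballProdUnivBall_target hr]
  exact contDiffOn_fst.prodMk
    (OpenPartialHomeomorph.contDiffOn_univBall_symm.comp contDiffOn_snd fun q hq => hq.2)

end BallProdUnivBall

universe u

variable {T E : Type u} [NormedAddCommGroup T] [NormedSpace ℝ T] [FiniteDimensional ℝ T]
  [NormedAddCommGroup E] [NormedSpace ℝ E] [FiniteDimensional ℝ E]
  {F : Type*} [NormedAddCommGroup F] [InnerProductSpace ℝ F] [FiniteDimensional ℝ F]

lemma exists_adapted_openPartialHomeomorph {A : E → T →L[ℝ] E}
    {α : E → E →L[ℝ] T} {V : Set E} (h : IsCommutingFrame A α V) {x₀ : E} (hx₀ : x₀ ∈ V)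
    (hdim : Module.finrank ℝ E = Module.finrank ℝ T + Module.finrank ℝ F) :
    ∃ e : OpenPartialHomeomorph (T × F) E, 0 ∈ e.source ∧ e 0 = x₀ ∧ MapsTo e e.source V ∧
      ContDiffOn ℝ ∞ e e.source ∧ ContDiffOn ℝ ∞ e.symm e.target ∧
      (∀ q ∈ e.source, ∀ a, fderiv ℝ e q (a, 0) = A (e q) a) ∧
      ∀ q ∈ e.source, ∀ w, α (e q) (fderiv ℝ e q w) = w.1 := by
  have : CompleteSpace T := FiniteDimensional.complete ℝ T
  have : CompleteSpace (T × F) := FiniteDimensional.complete ℝ (T × F)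
  obtain ⟨r, hr, Ψ, H, hΨ⟩ := exists_straightenedFlow h hx₀
  obtain ⟨L, hL, hαL⟩ := exists_injective_comp_eq_zero (F := F)
    (fun a => ⟨A x₀ a, h.form_frame x₀ hx₀ a⟩) hdim
  obtain ⟨Θ, U, hU, h0U, hΘ, hUV, hΘ0, hΘA, hΘα, hinj⟩ := hΨ.exists_adapted hr hL hαL
  obtain ⟨e, rfl, h0e, heU, hes⟩ := exists_openPartialHomeomorph_of_isInvertible hU hΘ h0U
    (isInvertible_of_injective_of_finrank_eq hinj (by simpa using hdim.symm))
  exact ⟨e, h0e, hΘ0, fun q hq => hUV (heU hq), hΘ.mono heU, hes,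
    fun q hq => hΘA q (heU hq), fun q hq => hΘα q (heU hq)⟩

lemma exists_adapted_coordinates {A : E → T →L[ℝ] E}
    {α : E → E →L[ℝ] T} {V : Set E} (h : IsCommutingFrame A α V) {x₀ : E} (hx₀ : x₀ ∈ V)
    (hdim : Module.finrank ℝ E = Module.finrank ℝ T + Module.finrank ℝ F) :
    ∃ r > 0, ∃ Θ : OpenPartialHomeomorph (T × F) E,
      Θ.source = Metric.ball (0 : T) r ×ˢ univ ∧ Θ 0 = x₀ ∧ MapsTo Θ Θ.source V ∧
      ContDiffOn ℝ ∞ Θ Θ.source ∧ ContDiffOn ℝ ∞ Θ.symm Θ.target ∧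
      (∀ q ∈ Θ.source, ∀ a, fderiv ℝ Θ q (a, 0) = A (Θ q) a) ∧
      ∀ q ∈ Θ.source, ∀ w, α (Θ q) (fderiv ℝ Θ q w) = w.1 := by
  obtain ⟨e, h0e, he0, heV, hes, hes', heA, heα⟩ :=
    exists_adapted_openPartialHomeomorph (F := F) h hx₀ hdim
  obtain ⟨r, hr, hre⟩ := Metric.isOpen_iff.1 e.open_source _ h0e
  rw [Prod.zero_eq_mk, ← ball_prod_same] at hre
  set b := ballProdUnivBall T F r
  have hbt : b.target = Metric.ball 0 r ×ˢ Metric.ball 0 r := ballProdUnivBall_target hr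
  have hbmaps : MapsTo b b.source e.source := fun q hq => hre (hbt ▸ b.map_source hq)
  have hsource : (b.trans e).source = b.source := by
    rw [OpenPartialHomeomorph.trans_source]
    exact inter_eq_left.2 hbmaps
  have hd {q} (hq : q ∈ b.source) := ((hes.contDiffAt (e.open_source.mem_nhds
    (hbmaps hq))).differentiableAt (by simp)).hasFDerivAt.comp q
    (hasFDerivAt_ballProdUnivBall r q)
  refine ⟨r, hr, b.trans e, hsource.trans ballProdUnivBall_source,
    (congrArg e (ballProdUnivBall_zero r)).trans he0, ?_, ?_, ?_, ?_, ?_⟩ <;>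
    try rw [hsource]
  · exact fun q hq => heV (hbmaps hq)
  · exact hes.comp contDiff_ballProdUnivBall.contDiffOn hbmaps
  · rw [OpenPartialHomeomorph.trans_target]
    exact (contDiffOn_ballProdUnivBall_symm hr).comp (hes'.mono inter_subset_left) fun q hq => hq.2
  · exact fun q hq a => by simpa [(hd hq).fderiv] using heA _ (hbmaps hq) a
  · exact fun q hq w => by
      simpa [(hd hq).fderiv, Prod.map] using heα _ (hbmaps hq) (w.1, fderiv ℝ _ q.2 w.2)

end AdaptedCoordinates

/-! ### Consequences of the Kenmotsu condition -/

lemma eq_zero_of_symm_of_antisymm {ι : Type*} {c : ι → ι → ι → ℝ}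
    (hsymm : ∀ i j k, c i j k = c j i k) (hanti : ∀ i j k, c i j k = -c k j i) (i j k : ι) :
    c i j k = 0 := by
  have h : c i j k = -c i j k := calc
    c i j k = -c k j i := hanti i j k
    _ = -c j k i := by rw [hsymm]
    _ = c i k j := by rw [hanti j k i, neg_neg]
    _ = c k i j := hsymm i k j
    _ = -c j i k := hanti k i j
    _ = -c i j k := by rw [hsymm]
  linarith

section Smoothness

variable {m : ℕ} {M : Type*} [TopologicalSpace M] [ChartedSpace (EuclideanSpace ℝ (Fin m)) M]
  [IsManifold (𝓡 m) ∞ M]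

lemma IsSmoothEndField.app {S : EndField m M} (hS : IsSmoothEndField S) {X : VField m M}
    (hX : IsSmoothVField X) : IsSmoothVField (S.app X) :=
  ContMDiff.clm_bundle_apply (b := fun x : M => x) hS hX

lemma IsSmoothVField.mdifferentiableAt {X : VField m M} (hX : IsSmoothVField X) (x : M) :
    MDifferentiableAt (𝓡 m) ((𝓡 m).prod 𝓘(ℝ, EuclideanSpace ℝ (Fin m)))
      (fun x => TotalSpace.mk' (EuclideanSpace ℝ (Fin m)) x (X x)) x :=
  ContMDiff.mdifferentiableAt hX (by simp)

lemma IsLeviCivita.sub_eq {g : RMetric m M} {nabla : LinearConnection m M}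
    (h : IsLeviCivita g nabla) {X Y : VField m M} (hX : IsSmoothVField X) (hY : IsSmoothVField Y)
    (x : M) : nabla Y x (X x) - nabla X x (Y x) = mlieBracket (𝓡 m) X Y x :=
  (nabla.torsion_eq_zero_iff.1 h.torsion_free) (hX.mdifferentiableAt x) (hY.mdifferentiableAt x)

lemma IsLeviCivita.koszul {g : RMetric m M} {nabla : LinearConnection m M}
    (h : IsLeviCivita g nabla) {X Y Z : VField m M} (hX : IsSmoothVField X)
    (hY : IsSmoothVField Y) (hZ : IsSmoothVField Z) (x : M) :
    2 * g.inner x (nabla Y x (X x)) (Z x)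
      = mvfderiv (𝓡 m) (fun y => g.inner y (Y y) (Z y)) x (X x)
        + mvfderiv (𝓡 m) (fun y => g.inner y (X y) (Z y)) x (Y x)
        - mvfderiv (𝓡 m) (fun y => g.inner y (X y) (Y y)) x (Z x)
        + g.inner x (mlieBracket (𝓡 m) X Y x) (Z x)
        - g.inner x (mlieBracket (𝓡 m) X Z x) (Y x)
        - g.inner x (mlieBracket (𝓡 m) Y Z x) (X x) := by
  rw [h.metric Y Z hY hZ, h.metric X Z hX hZ, h.metric X Y hX hY, ← h.sub_eq hX hY,
    ← h.sub_eq hX hZ, ← h.sub_eq hY hZ]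
  simp only [map_sub, sub_apply]
  rw [g.symm x (Y x) (nabla Z x (X x)), g.symm x (X x) (nabla Z x (Y x)),
    g.symm x (X x) (nabla Y x (Z x))]
  ring

end Smoothness

namespace WeakMetricFStructure

variable {n s : ℕ} {M : Type*} [TopologicalSpace M]
  [ChartedSpace (EuclideanSpace ℝ (Fin (2 * n + s))) M] [IsManifold (𝓡 (2 * n + s)) ∞ M]
  (S : WeakMetricFStructure n s M)

lemma f_ξ (x : M) (i : Fin s) : S.f x (S.ξ i x) = 0 := by
  have hff : S.f x (S.f x (S.ξ i x)) = 0 := by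
    rw [S.f_sq, S.Q_ξ]
    simp [S.η_ξ]
  have hcube := S.f_cube x (S.ξ i x)
  rwa [hff, map_zero, zero_add, S.Q_ξ] at hcube

lemma η_sub_sum (x : M) (v : TangentSpace (𝓡 (2 * n + s)) x) (i : Fin s) :
    S.η i x (v - ∑ j, S.η j x v • S.ξ j x) = 0 := by
  rw [map_sub, map_sum]
  simp [S.η_ξ]

lemma f_sub_sum (x : M) (v : TangentSpace (𝓡 (2 * n + s)) x) :
    S.f x (v - ∑ j, S.η j x v • S.ξ j x) = S.f x v := by
  rw [map_sub, map_sum]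
  simp [S.f_ξ]

lemma η_f (x : M) (i : Fin s) (v : TangentSpace (𝓡 (2 * n + s)) x) : S.η i x (S.f x v) = 0 := by
  rw [← S.f_sub_sum]
  exact S.f_invariant x _ (S.η_sub_sum x v) i

lemma g_ξ (x : M) (i : Fin s) (v : TangentSpace (𝓡 (2 * n + s)) x) :
    S.g.inner x (S.ξ i x) v = S.η i x v := by
  have h := S.compatible x v (S.ξ i x)
  simp only [S.f_ξ, map_zero, S.Q_ξ, S.η_ξ, mul_ite, mul_one, mul_zero, Finset.sum_ite_eq',
    Finset.mem_univ, if_true] at h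
  rw [S.g.symm]
  linarith

lemma f_skew (x : M) (v w : TangentSpace (𝓡 (2 * n + s)) x) :
    S.g.inner x (S.f x v) w = -S.g.inner x v (S.f x w) := by
  obtain ⟨w, rfl⟩ := (S.nonsingular_Q x).2 w
  have h := S.compatible x v (S.f x w)
  have hcomm : S.Q x (S.f x w) = S.f x (S.Q x w) := by
    have hcube := S.f_cube x w
    rw [S.f_sq x (S.f x w)] at hcube
    simpa only [S.η_f, zero_smul, Finset.sum_const_zero, add_zero, neg_add_eq_zero] using hcube
  rw [hcomm, S.f_sq] at h
  simp only [S.η_f, mul_zero, Finset.sum_const_zero, sub_zero, map_add, map_neg, map_sum,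
    map_smul] at h
  rw [Finset.sum_eq_zero (fun i _ => by
    rw [S.g.symm, S.g_ξ, S.η_f, smul_zero]), add_zero] at h
  linarith

lemma eq_zero_of_f_eq_zero (x : M) (v : TangentSpace (𝓡 (2 * n + s)) x)
    (hη : ∀ i, S.η i x v = 0) (hf : S.f x v = 0) : v = 0 := by
  have h := S.f_sq x v
  rw [hf, map_zero] at h
  simp only [hη, zero_smul, Finset.sum_const_zero, add_zero] at h
  exact (S.nonsingular_Q x).1 ((neg_eq_zero.1 h.symm).trans (map_zero _).symm)

lemma app_ξ (i : Fin s) : S.f.app (S.ξ i) = 0 := funext fun x => S.f_ξ x i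

variable {S} {β : M → ℝ} {nabla : LinearConnection (2 * n + s) M}

section Kenmotsu

variable (hN : S.IsNormal) (hLC : IsLeviCivita S.g nabla)
  (hf : ∀ X Y : VField (2 * n + s) M, IsSmoothVField X → IsSmoothVField Y → ∀ x,
      covDerivEnd nabla S.f X Y x
        = β x • (S.g.inner x (S.f x (X x)) (Y x) • S.xiBar x - S.etaBar x (Y x) • S.f x (X x)))

include hf in
lemma f_nabla_ξ {X : VField (2 * n + s) M} (hX : IsSmoothVField X) (i : Fin s) (x : M) :
    S.f x (nabla (S.ξ i) x (X x)) = β x • S.f x (X x) := by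
  have h := hf X (S.ξ i) hX (S.smooth_ξ i) x
  rw [covDerivEnd, S.app_ξ, nabla.zero, S.g.symm, S.g_ξ, S.η_f] at h
  simpa [etaBar, S.η_ξ] using h

lemma two_mul_extDeriv (hLC : IsLeviCivita S.g nabla) {X Y : VField (2 * n + s) M}
    (hX : IsSmoothVField X) (hY : IsSmoothVField Y) (k : Fin s) (x : M) :
    2 * extDerivOneForm (S.η k) X Y x
      = S.g.inner x (nabla (S.ξ k) x (X x)) (Y x)
        - S.g.inner x (nabla (S.ξ k) x (Y x)) (X x) := by
  have hY_deriv := hLC.metric _ _ (S.smooth_ξ k) hY x (X x)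
  have hX_deriv := hLC.metric _ _ (S.smooth_ξ k) hX x (Y x)
  simp only [S.g_ξ] at hY_deriv hX_deriv
  rw [extDerivOneForm, hY_deriv, hX_deriv, ← hLC.sub_eq hX hY, map_sub]
  ring

include hN in
lemma extDeriv_ξ {Y : VField (2 * n + s) M} (hY : IsSmoothVField Y) (i k : Fin s) (x : M) :
    2 * extDerivOneForm (S.η k) (S.ξ i) Y x = 0 := by
  have h := congrArg (S.η k x) (hN (S.ξ i) Y (S.smooth_ξ i) hY x)
  rw [nijenhuis, S.app_ξ, mlieBracket_zero_left, mlieBracket_zero_left] at h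
  simpa [S.η_f, S.η_ξ] using h

include hN in
lemma mlieBracket_ξ_ξ (i j : Fin s) (x : M) :
    mlieBracket (𝓡 (2 * n + s)) (S.ξ i) (S.ξ j) x = 0 := by
  set w := mlieBracket (𝓡 (2 * n + s)) (S.ξ i) (S.ξ j) x
  have hffw : S.f x (S.f x w) = 0 := by
    have h := hN (S.ξ i) (S.ξ j) (S.smooth_ξ i) (S.smooth_ξ j) x
    rw [Finset.sum_eq_zero (fun k _ => by rw [extDeriv_ξ hN (S.smooth_ξ j), zero_smul]), add_zero,
      nijenhuis, S.app_ξ, S.app_ξ, mlieBracket_zero_left, mlieBracket_zero_left,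
      mlieBracket_zero_right] at h
    simpa using h
  have hfw : S.f x w = 0 := S.eq_zero_of_f_eq_zero x _ (fun k => S.η_f x k w) hffw
  have hηw : ∀ k, S.η k x w = 0 := by
    intro k
    have h := extDeriv_ξ hN (S.smooth_ξ j) i k x
    rw [extDerivOneForm] at h
    simpa [S.η_ξ, mvfderiv_const] using h
  exact S.eq_zero_of_f_eq_zero x w hηw hfw

include hLC in
lemma η_nabla_ξ (i k : Fin s) (x : M) (v : TangentSpace (𝓡 (2 * n + s)) x) :
    S.η k x (nabla (S.ξ i) x v) = -S.η i x (nabla (S.ξ k) x v) := by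
  have h := hLC.metric _ _ (S.smooth_ξ i) (S.smooth_ξ k) x v
  rw [S.g.symm x (nabla (S.ξ i) x v)] at h
  simp only [S.g_ξ, S.η_ξ, mvfderiv_const, zero_apply] at h
  linarith

include hN hLC hf in
lemma nabla_ξ_ξ (i j : Fin s) (x : M) : nabla (S.ξ i) x (S.ξ j x) = 0 := by
  have hsymm (i j) : nabla (S.ξ i) x (S.ξ j x) = nabla (S.ξ j) x (S.ξ i x) :=
    sub_eq_zero.1 ((hLC.sub_eq (S.smooth_ξ j) (S.smooth_ξ i) x).trans (mlieBracket_ξ_ξ hN j i x))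
  have hη (k) : S.η k x (nabla (S.ξ i) x (S.ξ j x)) = 0 :=
    eq_zero_of_symm_of_antisymm (c := fun i j k => S.η k x (nabla (S.ξ i) x (S.ξ j x)))
      (fun i j k => by rw [hsymm]) (fun i j k => η_nabla_ξ hLC i k x _) i j k
  refine S.eq_zero_of_f_eq_zero x _ hη ?_
  rw [f_nabla_ξ hf (S.smooth_ξ j), S.f_ξ, smul_zero]

include hN hLC hf in
lemma nabla_ξ {X : VField (2 * n + s) M} (hX : IsSmoothVField X) (i : Fin s) (x : M) :
    nabla (S.ξ i) x (X x) = β x • (X x - ∑ j, S.η j x (X x) • S.ξ j x) := by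
  have hη : ∀ k, S.η k x (nabla (S.ξ i) x (X x)) = 0 := by
    intro k
    have h := extDeriv_ξ hN hX i k x
    rw [two_mul_extDeriv hLC (S.smooth_ξ i) hX, nabla_ξ_ξ hN hLC hf, map_zero, zero_apply, zero_sub,
      neg_eq_zero, S.g.symm, S.g_ξ, η_nabla_ξ hLC, neg_eq_zero] at h
    exact h
  refine sub_eq_zero.1 (S.eq_zero_of_f_eq_zero x _ (fun k => ?_) ?_)
  · rw [map_sub, hη, map_smul, S.η_sub_sum, smul_zero, sub_zero]
  · rw [map_sub, f_nabla_ξ hf hX, map_smul, S.f_sub_sum, sub_self]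

include hN hLC hf in
lemma extDeriv_eq_zero {X Y : VField (2 * n + s) M} (hX : IsSmoothVField X)
    (hY : IsSmoothVField Y) (k : Fin s) (x : M) : 2 * extDerivOneForm (S.η k) X Y x = 0 := by
  rw [two_mul_extDeriv hLC hX hY, nabla_ξ hN hLC hf hX, nabla_ξ hN hLC hf hY]
  simp only [map_smul, smul_apply, map_sub, sub_apply, map_sum, sum_apply, S.g_ξ]
  rw [S.g.symm x (Y x) (X x)]
  simp only [smul_eq_mul, mul_comm]
  ring

include hN hLC hf in
lemma lie_ξ_g {X Y : VField (2 * n + s) M} (hX : IsSmoothVField X)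
    (hY : IsSmoothVField Y) (i : Fin s) (x : M) (hXη : ∀ j, S.η j x (X x) = 0)
    (hYη : ∀ j, S.η j x (Y x) = 0) :
    mvfderiv (𝓡 (2 * n + s)) (fun y => S.g.inner y (X y) (Y y)) x (S.ξ i x)
      - S.g.inner x (mlieBracket (𝓡 (2 * n + s)) (S.ξ i) X x) (Y x)
      - S.g.inner x (X x) (mlieBracket (𝓡 (2 * n + s)) (S.ξ i) Y x)
      = 2 * β x * S.g.inner x (X x) (Y x) := by
  rw [hLC.metric X Y hX hY, ← hLC.sub_eq (S.smooth_ξ i) hX, ← hLC.sub_eq (S.smooth_ξ i) hY,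
    nabla_ξ hN hLC hf hX, nabla_ξ hN hLC hf hY]
  simp only [hXη, hYη, zero_smul, Finset.sum_const_zero, sub_zero, map_sub, sub_apply, map_smul,
    smul_apply, smul_eq_mul]
  ring

include hN hLC hf in
lemma lie_ξ_f {X : VField (2 * n + s) M} (hX : IsSmoothVField X) (i : Fin s) (x : M) :
    mlieBracket (𝓡 (2 * n + s)) (S.ξ i) (S.f.app X) x
      = S.f x (mlieBracket (𝓡 (2 * n + s)) (S.ξ i) X x) := by
  have hfX := S.smooth_f.app hX
  have h := hf (S.ξ i) X (S.smooth_ξ i) hX x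
  rw [S.f_ξ, covDerivEnd] at h
  simp only [map_zero, zero_apply, zero_smul, smul_zero, sub_zero] at h
  rw [← hLC.sub_eq (S.smooth_ξ i) hX, ← hLC.sub_eq (S.smooth_ξ i) hfX, sub_eq_zero.1 h,
    nabla_ξ hN hLC hf hX, nabla_ξ hN hLC hf hfX, map_sub, map_smul, S.f_sub_sum]
  simp [EndField.app, S.η_f]

include hf in
lemma inner_nabla_f_add_eq_zero {X Y Z : VField (2 * n + s) M} (hX : IsSmoothVField X)
    (hY : IsSmoothVField Y) (x : M)
    (hYη : ∀ j, S.η j x (Y x) = 0) (hZη : ∀ j, S.η j x (Z x) = 0) :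
    S.g.inner x (nabla (S.f.app Y) x (X x)) (Z x)
      + S.g.inner x (nabla Y x (X x)) (S.f.app Z x) = 0 := by
  have h := congrArg (fun v => S.g.inner x v (Z x)) (hf X Y hX hY x)
  simp only [covDerivEnd, map_sub, sub_apply, map_smul, smul_apply, S.f_skew] at h
  have hξ : S.g.inner x (S.xiBar x) (Z x) = 0 := by
    simp [xiBar, S.g_ξ, hZη]
  have hη : S.etaBar x (Y x) = 0 := by simp [etaBar, hYη]
  rw [hξ, hη, smul_zero, zero_smul, sub_zero, smul_zero, sub_neg_eq_add] at h
  exact h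

end Kenmotsu

end WeakMetricFStructure

/-! ### Tensors in a parametrization -/

section VectorSpace

variable {E : Type*} [NormedAddCommGroup E] [NormedSpace ℝ E]

lemma mlieBracket_vectorSpace (X Y : E → E) (x : E) :
    mlieBracket 𝓘(ℝ, E) X Y x = fderiv ℝ Y x (X x) - fderiv ℝ X x (Y x) := by
  refine Eq.trans ?_ (congrFun (lieBracketWithin_univ (𝕜 := ℝ) (V := X) (W := Y)) x)
  exact (congrFun mlieBracketWithin_univ.symm x).trans
    (congrFun mlieBracketWithin_eq_lieBracketWithin x)

/-- The Christoffel symbols of the first kind of a metric with derivative `D`, as a function of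
`D = (v, y, z) ↦ v(g(y, z))`. -/
noncomputable def christoffel (D : E →L[ℝ] E →L[ℝ] E →L[ℝ] ℝ) (v y z : E) : ℝ :=
  (D v y z + D y v z - D z v y) / 2

end VectorSpace

section Pullback

variable {E : Type*} [NormedAddCommGroup E] [NormedSpace ℝ E] {m : ℕ} {M : Type*}
  [TopologicalSpace M] [ChartedSpace (EuclideanSpace ℝ (Fin m)) M]

/-- `Φ` is a diffeomorphism from an open part of the vector space `E` onto an open part of `M`. -/
structure IsSmoothParametrization (m : ℕ) {M : Type*} [TopologicalSpace M]
    [ChartedSpace (EuclideanSpace ℝ (Fin m)) M] (Φ : OpenPartialHomeomorph E M) : Prop where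
  contMDiffOn : ContMDiffOn 𝓘(ℝ, E) (𝓡 m) ∞ Φ Φ.source
  contMDiffOn_symm : ContMDiffOn (𝓡 m) 𝓘(ℝ, E) ∞ Φ.symm Φ.target

/-- The vector field on `E` that is `Φ`-related to `X`. -/
noncomputable def pullbackField (Φ : E → M) (X : VField m M) (q : E) : E :=
  mpullback 𝓘(ℝ, E) (𝓡 m) Φ X q

/-- The pullback of a `1`-form along `Φ`. -/
noncomputable def pullbackForm (Φ : E → M) (α : OneForm m M) (q : E) : E →L[ℝ] ℝ :=
  α (Φ q) ∘L mfderiv 𝓘(ℝ, E) (𝓡 m) Φ q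

/-- The `(1,1)`-tensor field on `E` that is `Φ`-related to `S`. -/
noncomputable def pullbackEnd (Φ : E → M) (S : EndField m M) (q : E) : E →L[ℝ] E :=
  (mfderiv 𝓘(ℝ, E) (𝓡 m) Φ q).inverse ∘L S (Φ q) ∘L mfderiv 𝓘(ℝ, E) (𝓡 m) Φ q

/-- The pullback of a Riemannian metric along `Φ`. -/
noncomputable def pullbackMetric [IsManifold (𝓡 m) ∞ M] (Φ : E → M) (g : RMetric m M) (q : E) :
    E →L[ℝ] E →L[ℝ] ℝ :=
  ContinuousLinearMap.bilinearComp
    (show EuclideanSpace ℝ (Fin m) →L[ℝ] EuclideanSpace ℝ (Fin m) →L[ℝ] ℝ from g.inner (Φ q))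
    (show E →L[ℝ] EuclideanSpace ℝ (Fin m) from mfderiv 𝓘(ℝ, E) (𝓡 m) Φ q)
    (show E →L[ℝ] EuclideanSpace ℝ (Fin m) from mfderiv 𝓘(ℝ, E) (𝓡 m) Φ q)

lemma pullbackMetric_apply [IsManifold (𝓡 m) ∞ M] (Φ : E → M) (g : RMetric m M) (q v w : E) :
    pullbackMetric Φ g q v w
      = g.inner (Φ q) (mfderiv 𝓘(ℝ, E) (𝓡 m) Φ q v) (mfderiv 𝓘(ℝ, E) (𝓡 m) Φ q w) := rfl

lemma pullbackMetric_comm [IsManifold (𝓡 m) ∞ M] (Φ : E → M) (g : RMetric m M) (q v w : E) :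
    pullbackMetric Φ g q v w = pullbackMetric Φ g q w v :=
  g.symm _ _ _

end Pullback

namespace IsSmoothParametrization

variable {E : Type*} [NormedAddCommGroup E] [NormedSpace ℝ E] {m : ℕ} {M : Type*}
  [TopologicalSpace M] [ChartedSpace (EuclideanSpace ℝ (Fin m)) M]
  {Φ : OpenPartialHomeomorph E M} (hΦ : IsSmoothParametrization m Φ) {q : E} (hq : q ∈ Φ.source)

include hΦ in
lemma mdifferentiable : Φ.MDifferentiable 𝓘(ℝ, E) (𝓡 m) :=
  ⟨hΦ.contMDiffOn.mdifferentiableOn (by simp), hΦ.contMDiffOn_symm.mdifferentiableOn (by simp)⟩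

include hΦ hq

lemma contMDiffAt : ContMDiffAt 𝓘(ℝ, E) (𝓡 m) ∞ Φ q :=
  hΦ.contMDiffOn.contMDiffAt (Φ.open_source.mem_nhds hq)

lemma inverse_mfderiv_symm :
    (mfderiv (𝓡 m) 𝓘(ℝ, E) Φ.symm (Φ q)).inverse = mfderiv 𝓘(ℝ, E) (𝓡 m) Φ q := by
  have h := hΦ.mdifferentiable.comp_symm_deriv (Φ.map_source hq)
  rw [Φ.left_inv hq] at h
  exact ContinuousLinearMap.inverse_eq (hΦ.mdifferentiable.symm_comp_deriv hq) h

lemma isInvertible_mfderiv : (mfderiv 𝓘(ℝ, E) (𝓡 m) Φ q).IsInvertible :=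
  ⟨hΦ.mdifferentiable.mfderiv hq, rfl⟩

lemma mfderiv_injective : Function.Injective (mfderiv 𝓘(ℝ, E) (𝓡 m) Φ q) :=
  (hΦ.mdifferentiable.mfderiv hq).injective

lemma mfderiv_inverse (v : TangentSpace (𝓡 m) (Φ q)) :
    mfderiv 𝓘(ℝ, E) (𝓡 m) Φ q ((mfderiv 𝓘(ℝ, E) (𝓡 m) Φ q).inverse v) = v := by
  obtain ⟨A, hA⟩ := hΦ.isInvertible_mfderiv hq
  rw [← hA, ContinuousLinearMap.inverse_equiv]
  exact A.apply_symm_apply v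

lemma mfderiv_pullbackField (X : VField m M) :
    mfderiv 𝓘(ℝ, E) (𝓡 m) Φ q (pullbackField Φ X q : E) = X (Φ q) :=
  hΦ.mfderiv_inverse hq _

lemma pullbackField_eq {X : VField m M} {v : E} (hv : mfderiv 𝓘(ℝ, E) (𝓡 m) Φ q v = X (Φ q)) :
    pullbackField Φ X q = v :=
  hΦ.mfderiv_injective hq ((hΦ.mfderiv_pullbackField hq X).trans hv.symm)

lemma mfderiv_pullbackEnd (S : EndField m M) (v : E) :
    mfderiv 𝓘(ℝ, E) (𝓡 m) Φ q (pullbackEnd Φ S q v)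
      = S (Φ q) (mfderiv 𝓘(ℝ, E) (𝓡 m) Φ q v) :=
  hΦ.mfderiv_inverse hq _

lemma pullbackForm_pullbackField (α : OneForm m M) (X : VField m M) :
    pullbackForm Φ α q (pullbackField Φ X q) = α (Φ q) (X (Φ q)) :=
  congrArg (α (Φ q)) (hΦ.mfderiv_pullbackField hq X)

lemma pullbackField_app (S : EndField m M) (X : VField m M) :
    pullbackField Φ (S.app X) q = pullbackEnd Φ S q (pullbackField Φ X q) :=
  hΦ.pullbackField_eq hq
    ((hΦ.mfderiv_pullbackEnd hq S _).trans (congrArg (S (Φ q)) (hΦ.mfderiv_pullbackField hq X)))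

lemma contDiffAt_comp {u : M → ℝ} (hu : ContMDiff (𝓡 m) 𝓘(ℝ, ℝ) ∞ u) :
    ContDiffAt ℝ ∞ (fun q => u (Φ q)) q :=
  ((hu _).comp q (hΦ.contMDiffAt hq)).contDiffAt

lemma fderiv_comp {u : M → ℝ} (hu : MDifferentiableAt (𝓡 m) 𝓘(ℝ, ℝ) u (Φ q)) (w : E) :
    fderiv ℝ (fun q => u (Φ q)) q w
      = mvfderiv (𝓡 m) u (Φ q) (mfderiv 𝓘(ℝ, E) (𝓡 m) Φ q w) := by
  refine Eq.trans ?_ (mvfderiv_comp_apply q hu (hΦ.mdifferentiable.mdifferentiableAt hq) w)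
  rw [mvfderiv, mfderiv_eq_fderiv]
  rfl

variable [IsManifold (𝓡 m) ∞ M]

lemma pullbackMetric_pullbackField (g : RMetric m M) (X Y : VField m M) :
    pullbackMetric Φ g q (pullbackField Φ X q) (pullbackField Φ Y q)
      = g.inner (Φ q) (X (Φ q)) (Y (Φ q)) := by
  rw [pullbackMetric_apply, hΦ.mfderiv_pullbackField hq, hΦ.mfderiv_pullbackField hq]

lemma pullbackMetric_pos (g : RMetric m M) {v : E} (hv : v ≠ 0) : 0 < pullbackMetric Φ g q v v :=
  g.pos _ _ fun h => hv ((hΦ.mdifferentiable.mfderiv hq).map_eq_zero_iff.1 h)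

variable [FiniteDimensional ℝ E]

lemma contDiffAt_pullbackField {X : VField m M} (hX : IsSmoothVField X) :
    ContDiffAt ℝ ∞ (pullbackField Φ X) q := by
  have : IsManifold (𝓡 m) (∞ + 1) M := by simpa
  have : CompleteSpace E := FiniteDimensional.complete ℝ E
  exact contMDiffAt_vectorSpace_iff_contDiffAt.1 <|
    ContMDiffAt.mpullback_vectorField_preimage (hX _) (hΦ.contMDiffAt hq)
      (hΦ.isInvertible_mfderiv hq) (by simp)

lemma mlieBracket_eq {X Y : VField m M} (hX : IsSmoothVField X) (hY : IsSmoothVField Y) :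
    mlieBracket (𝓡 m) X Y (Φ q) = mfderiv 𝓘(ℝ, E) (𝓡 m) Φ q
      (fderiv ℝ (pullbackField Φ Y) q (pullbackField Φ X q)
        - fderiv ℝ (pullbackField Φ X) q (pullbackField Φ Y q)) := by
  have hsmooth : minSmoothness ℝ 2 ≤ ∞ := by
    rw [minSmoothness_of_isRCLikeNormedField]
    exact WithTop.coe_le_coe.2 le_top
  have : IsManifold (𝓡 m) (minSmoothness ℝ 2) M := IsManifold.of_le (n := ∞) hsmooth
  have : CompleteSpace E := FiniteDimensional.complete ℝ E
  have h : pullbackField Φ (mlieBracket (𝓡 m) X Y) q = _ :=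
    (mpullback_mlieBracket (hX.mdifferentiableAt _) (hY.mdifferentiableAt _)
      (hΦ.contMDiffAt hq) hsmooth).trans (mlieBracket_vectorSpace _ _ _)
  exact (hΦ.mfderiv_pullbackField hq _).symm.trans (congrArg _ h)

lemma exists_pullbackField_eventuallyEq [T2Space M] (v : E) :
    ∃ X : VField m M, IsSmoothVField X ∧ pullbackField Φ X =ᶠ[𝓝 q] fun _ => v := by
  have : IsManifold (𝓡 m) (∞ + 1) M := by simpa
  have : CompleteSpace E := FiniteDimensional.complete ℝ E
  obtain ⟨χ, -, hχ⟩ := (SmoothBumpFunction.nhds_basis_tsupport (I := 𝓡 m) (Φ q)).mem_iff.1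
    (Φ.open_target.mem_nhds (Φ.map_source hq))
  let Y : VField m M := mpullback (𝓡 m) 𝓘(ℝ, E) Φ.symm fun _ => v
  have hY : ContMDiffOn (𝓡 m) ((𝓡 m).prod 𝓘(ℝ, EuclideanSpace ℝ (Fin m))) ∞
      (fun x => TotalSpace.mk' (EuclideanSpace ℝ (Fin m)) x (Y x)) Φ.target := fun x hx =>
    (ContMDiffAt.mpullback_vectorField_preimage (n := ∞)
      (contMDiffAt_vectorSpace_iff_contDiffAt.2 contDiffAt_const)
      (hΦ.contMDiffOn_symm.contMDiffAt (Φ.open_target.mem_nhds hx))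
      ⟨hΦ.mdifferentiable.symm.mfderiv hx, rfl⟩ (m := ∞) (by simp)).contMDiffWithinAt
  refine ⟨fun x => χ x • Y x, ContMDiffOn.smul_section_of_tsupport χ.contMDiff.contMDiffOn
    Φ.open_target hχ hY, ?_⟩
  filter_upwards [Φ.open_source.mem_nhds hq,
    (Φ.continuousAt hq).eventually χ.eventuallyEq_one] with z hz hχz
  refine hΦ.pullbackField_eq hz ?_
  have hY_eq : Y (Φ z) = mfderiv 𝓘(ℝ, E) (𝓡 m) Φ z v := by
    change (mfderiv (𝓡 m) 𝓘(ℝ, E) Φ.symm (Φ z)).inverse v = _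
    rw [hΦ.inverse_mfderiv_symm hz]
    rfl
  exact hY_eq.symm.trans ((congrArg (· • Y (Φ z)) hχz).trans (one_smul ℝ _)).symm

end IsSmoothParametrization

section Contractions

variable {m : ℕ} {M : Type*} [TopologicalSpace M] [ChartedSpace (EuclideanSpace ℝ (Fin m)) M]
  [IsManifold (𝓡 m) ∞ M]

lemma IsSmoothOneForm.apply {α : OneForm m M} (hα : IsSmoothOneForm α) {X : VField m M}
    (hX : IsSmoothVField X) : ContMDiff (𝓡 m) 𝓘(ℝ, ℝ) ∞ (fun x => α x (X x)) := fun x =>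
  (Bundle.contMDiffAt_section _).1 <|
    ContMDiff.clm_bundle_apply (F₂ := ℝ) (E₂ := Bundle.Trivial M ℝ) (b := fun x : M => x) hα hX x

lemma contMDiff_inner (g : RMetric m M) {X Y : VField m M} (hX : IsSmoothVField X)
    (hY : IsSmoothVField Y) : ContMDiff (𝓡 m) 𝓘(ℝ, ℝ) ∞ (fun x => g.inner x (X x) (Y x)) :=
  fun x => (Bundle.contMDiffAt_section _).1 <|
    ContMDiff.clm_bundle_apply₂ (F₃ := ℝ) (E₃ := Bundle.Trivial M ℝ) (b := fun x : M => x)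
      g.contMDiff hX hY x

end Contractions

namespace IsSmoothParametrization

variable {E : Type*} [NormedAddCommGroup E] [NormedSpace ℝ E] [FiniteDimensional ℝ E] {m : ℕ}
  {M : Type*} [TopologicalSpace M] [T2Space M] [ChartedSpace (EuclideanSpace ℝ (Fin m)) M]
  [IsManifold (𝓡 m) ∞ M] {Φ : OpenPartialHomeomorph E M} (hΦ : IsSmoothParametrization m Φ)
  {q : E} (hq : q ∈ Φ.source)

include hΦ

lemma contDiffOn_pullbackForm {α : OneForm m M} (hα : IsSmoothOneForm α) :
    ContDiffOn ℝ ∞ (pullbackForm Φ α) Φ.source := by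
  refine contDiffOn_clm_apply.2 fun v q hq => ContDiffAt.contDiffWithinAt ?_
  obtain ⟨X, hX, hXv⟩ := hΦ.exists_pullbackField_eventuallyEq hq v
  refine (hΦ.contDiffAt_comp hq (hα.apply hX)).congr_of_eventuallyEq ?_
  filter_upwards [hXv, Φ.open_source.mem_nhds hq] with z hz hzs
  rw [← hz, hΦ.pullbackForm_pullbackField hzs]

lemma contDiffOn_pullbackEnd {S : EndField m M} (hS : IsSmoothEndField S) :
    ContDiffOn ℝ ∞ (pullbackEnd Φ S) Φ.source := by
  refine contDiffOn_clm_apply.2 fun v q hq => ContDiffAt.contDiffWithinAt ?_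
  obtain ⟨X, hX, hXv⟩ := hΦ.exists_pullbackField_eventuallyEq hq v
  refine (hΦ.contDiffAt_pullbackField hq (hS.app hX)).congr_of_eventuallyEq ?_
  filter_upwards [hXv, Φ.open_source.mem_nhds hq] with z hz hzs
  rw [← hz, hΦ.pullbackField_app hzs]

lemma contDiffOn_pullbackMetric (g : RMetric m M) :
    ContDiffOn ℝ ∞ (pullbackMetric Φ g) Φ.source := by
  refine contDiffOn_clm_apply.2 fun v => contDiffOn_clm_apply.2 fun w q hq =>
    ContDiffAt.contDiffWithinAt ?_
  obtain ⟨X, hX, hXv⟩ := hΦ.exists_pullbackField_eventuallyEq hq v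
  obtain ⟨Y, hY, hYw⟩ := hΦ.exists_pullbackField_eventuallyEq hq w
  refine (hΦ.contDiffAt_comp hq (contMDiff_inner g hX hY)).congr_of_eventuallyEq ?_
  filter_upwards [hXv, hYw, Φ.open_source.mem_nhds hq] with z hzX hzY hzs
  rw [← hΦ.pullbackMetric_pullbackField hzs, hzX, hzY]

include hq

lemma differentiableAt_pullbackForm {α : OneForm m M} (hα : IsSmoothOneForm α) :
    DifferentiableAt ℝ (pullbackForm Φ α) q :=
  ((hΦ.contDiffOn_pullbackForm hα).contDiffAt (Φ.open_source.mem_nhds hq)).differentiableAt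
    (by simp)

lemma differentiableAt_pullbackEnd {S : EndField m M} (hS : IsSmoothEndField S) :
    DifferentiableAt ℝ (pullbackEnd Φ S) q :=
  ((hΦ.contDiffOn_pullbackEnd hS).contDiffAt (Φ.open_source.mem_nhds hq)).differentiableAt
    (by simp)

lemma differentiableAt_pullbackMetric (g : RMetric m M) :
    DifferentiableAt ℝ (pullbackMetric Φ g) q :=
  ((hΦ.contDiffOn_pullbackMetric g).contDiffAt (Φ.open_source.mem_nhds hq)).differentiableAt
    (by simp)

omit [T2Space M] in
lemma hasFDerivAt_pullbackField {X : VField m M} (hX : IsSmoothVField X) :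
    HasFDerivAt (pullbackField Φ X) (fderiv ℝ (pullbackField Φ X) q) q :=
  ((hΦ.contDiffAt_pullbackField hq hX).differentiableAt (by simp)).hasFDerivAt

lemma fderiv_pullbackField_app {S : EndField m M} (hS : IsSmoothEndField S) {X : VField m M}
    (hX : IsSmoothVField X) (w : E) :
    fderiv ℝ (pullbackField Φ (S.app X)) q w
      = fderiv ℝ (pullbackEnd Φ S) q w (pullbackField Φ X q)
        + pullbackEnd Φ S q (fderiv ℝ (pullbackField Φ X) q w) := by
  have h : pullbackField Φ (S.app X) =ᶠ[𝓝 q] fun z => pullbackEnd Φ S z (pullbackField Φ X z) := by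
    filter_upwards [Φ.open_source.mem_nhds hq] with z hz using hΦ.pullbackField_app hz S X
  rw [h.fderiv_eq, ((hΦ.differentiableAt_pullbackEnd hq hS).hasFDerivAt.clm_apply
    (hΦ.hasFDerivAt_pullbackField hq hX)).fderiv]
  simp [add_comm]

lemma mvfderiv_oneForm {α : OneForm m M} (hα : IsSmoothOneForm α) {X : VField m M}
    (hX : IsSmoothVField X) (W : VField m M) :
    mvfderiv (𝓡 m) (fun x => α x (X x)) (Φ q) (W (Φ q))
      = fderiv ℝ (pullbackForm Φ α) q (pullbackField Φ W q) (pullbackField Φ X q)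
        + pullbackForm Φ α q (fderiv ℝ (pullbackField Φ X) q (pullbackField Φ W q)) := by
  have h : (fun q => α (Φ q) (X (Φ q)))
      =ᶠ[𝓝 q] fun q => pullbackForm Φ α q (pullbackField Φ X q) := by
    filter_upwards [Φ.open_source.mem_nhds hq] with z hz
    rw [hΦ.pullbackForm_pullbackField hz]
  rw [← hΦ.mfderiv_pullbackField hq W,
    ← hΦ.fderiv_comp hq ((hα.apply hX _).mdifferentiableAt (by simp)), h.fderiv_eq,
    ((hΦ.differentiableAt_pullbackForm hq hα).hasFDerivAt.clm_apply
      (hΦ.hasFDerivAt_pullbackField hq hX)).fderiv]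
  simp [add_comm]

lemma mvfderiv_inner (g : RMetric m M) {X Y : VField m M} (hX : IsSmoothVField X)
    (hY : IsSmoothVField Y) (W : VField m M) :
    mvfderiv (𝓡 m) (fun x => g.inner x (X x) (Y x)) (Φ q) (W (Φ q))
      = fderiv ℝ (pullbackMetric Φ g) q (pullbackField Φ W q) (pullbackField Φ X q)
          (pullbackField Φ Y q)
        + pullbackMetric Φ g q (fderiv ℝ (pullbackField Φ X) q (pullbackField Φ W q))
            (pullbackField Φ Y q)
        + pullbackMetric Φ g q (pullbackField Φ X q)
            (fderiv ℝ (pullbackField Φ Y) q (pullbackField Φ W q)) := by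
  have h : (fun q => g.inner (Φ q) (X (Φ q)) (Y (Φ q)))
      =ᶠ[𝓝 q] fun q => pullbackMetric Φ g q (pullbackField Φ X q) (pullbackField Φ Y q) := by
    filter_upwards [Φ.open_source.mem_nhds hq] with z hz
    rw [hΦ.pullbackMetric_pullbackField hz]
  rw [← hΦ.mfderiv_pullbackField hq W,
    ← hΦ.fderiv_comp hq ((contMDiff_inner g hX hY _).mdifferentiableAt (by simp)), h.fderiv_eq,
    (((hΦ.differentiableAt_pullbackMetric hq g).hasFDerivAt.clm_apply
      (hΦ.hasFDerivAt_pullbackField hq hX)).clm_apply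
      (hΦ.hasFDerivAt_pullbackField hq hY)).fderiv]
  simp
  ring

omit [T2Space M] in
lemma inner_mlieBracket (g : RMetric m M) {X Y : VField m M} (hX : IsSmoothVField X)
    (hY : IsSmoothVField Y) (Z : VField m M) :
    g.inner (Φ q) (mlieBracket (𝓡 m) X Y (Φ q)) (Z (Φ q))
      = pullbackMetric Φ g q (fderiv ℝ (pullbackField Φ Y) q (pullbackField Φ X q))
          (pullbackField Φ Z q)
        - pullbackMetric Φ g q (fderiv ℝ (pullbackField Φ X) q (pullbackField Φ Y q))
          (pullbackField Φ Z q) := by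
  rw [hΦ.mlieBracket_eq hq hX hY, ← hΦ.mfderiv_pullbackField hq Z, ← pullbackMetric_apply,
    map_sub, sub_apply]

lemma inner_nabla {g : RMetric m M} {nabla : LinearConnection m M} (hLC : IsLeviCivita g nabla)
    {X Y Z : VField m M} (hX : IsSmoothVField X) (hY : IsSmoothVField Y) (hZ : IsSmoothVField Z) :
    g.inner (Φ q) (nabla Y (Φ q) (X (Φ q))) (Z (Φ q))
      = pullbackMetric Φ g q (fderiv ℝ (pullbackField Φ Y) q (pullbackField Φ X q))
          (pullbackField Φ Z q)
        + christoffel (fderiv ℝ (pullbackMetric Φ g) q) (pullbackField Φ X q)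
          (pullbackField Φ Y q) (pullbackField Φ Z q) := by
  have h := hLC.koszul hX hY hZ (Φ q)
  rw [hΦ.mvfderiv_inner hq g hY hZ, hΦ.mvfderiv_inner hq g hX hZ, hΦ.mvfderiv_inner hq g hX hY,
    hΦ.inner_mlieBracket hq g hX hY, hΦ.inner_mlieBracket hq g hX hZ,
    hΦ.inner_mlieBracket hq g hY hZ] at h
  have hcomm := pullbackMetric_comm Φ g q
  rw [hcomm (pullbackField Φ X q), hcomm (pullbackField Φ X q), hcomm (pullbackField Φ Y q)] at h
  rw [christoffel]
  linarith

lemma exists_fderiv_pullbackField_eq_zero (v : E) : ∃ X : VField m M,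
    IsSmoothVField X ∧ pullbackField Φ X q = v ∧ fderiv ℝ (pullbackField Φ X) q = 0 := by
  obtain ⟨X, hX, hXv⟩ := hΦ.exists_pullbackField_eventuallyEq hq v
  exact ⟨X, hX, hXv.eq_of_nhds, by rw [hXv.fderiv_eq, fderiv_fun_const, Pi.zero_apply]⟩

end IsSmoothParametrization

section ParallelTensor

variable {E : Type*} [NormedAddCommGroup E] [NormedSpace ℝ E]

/-- `g((∇_v f) y, z)` in coordinates, for the Levi-Civita connection of `g` and a `g`-skew `f`. -/
noncomputable def koszulDeriv (g : E → E →L[ℝ] E →L[ℝ] ℝ) (f : E → E →L[ℝ] E) (q v y z : E) : ℝ :=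
  g q (fderiv ℝ f q v y) z + christoffel (fderiv ℝ g q) v (f q y) z
    + christoffel (fderiv ℝ g q) v y (f q z)

end ParallelTensor

namespace WeakMetricFStructure.IsWeakKenmotsu

variable {E : Type*} [NormedAddCommGroup E] [NormedSpace ℝ E] [FiniteDimensional ℝ E] {n s : ℕ}
  {M : Type*} [TopologicalSpace M] [T2Space M]
  [ChartedSpace (EuclideanSpace ℝ (Fin (2 * n + s))) M] [IsManifold (𝓡 (2 * n + s)) ∞ M]
  {S : WeakMetricFStructure n s M} {β : M → ℝ} (hS : S.IsWeakKenmotsu β)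
  {Φ : OpenPartialHomeomorph E M} (hΦ : IsSmoothParametrization (2 * n + s) Φ)
  {q : E} (hq : q ∈ Φ.source)

include hS hΦ hq

omit [T2Space M] in
lemma fderiv_ξ_comm (i j : Fin s) :
    fderiv ℝ (pullbackField Φ (S.ξ i)) q (pullbackField Φ (S.ξ j) q)
      = fderiv ℝ (pullbackField Φ (S.ξ j)) q (pullbackField Φ (S.ξ i) q) := by
  have h := hΦ.mlieBracket_eq hq (S.smooth_ξ j) (S.smooth_ξ i)
  rw [mlieBracket_ξ_ξ hS.normal] at h
  exact sub_eq_zero.1 ((hΦ.mdifferentiable.mfderiv hq).map_eq_zero_iff.1 h.symm)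

lemma fderiv_η_comm (i : Fin s) (v w : E) :
    fderiv ℝ (pullbackForm Φ (S.η i)) q v w = fderiv ℝ (pullbackForm Φ (S.η i)) q w v := by
  obtain ⟨nabla, hLC, hf⟩ := hS.nabla_f
  obtain ⟨X, hX, rfl, hDX⟩ := hΦ.exists_fderiv_pullbackField_eq_zero hq v
  obtain ⟨Y, hY, rfl, hDY⟩ := hΦ.exists_fderiv_pullbackField_eq_zero hq w
  have hXY : mlieBracket (𝓡 (2 * n + s)) X Y (Φ q) = 0 := by
    rw [hΦ.mlieBracket_eq hq hX hY, hDX, hDY]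
    exact (congrArg _ (sub_self (0 : E))).trans (map_zero _)
  have h := extDeriv_eq_zero hS.normal hLC hf hX hY i (Φ q)
  rw [extDerivOneForm, hΦ.mvfderiv_oneForm hq (S.smooth_η i) hX,
    hΦ.mvfderiv_oneForm hq (S.smooth_η i) hY, hXY, hDX, hDY] at h
  simp only [zero_apply, map_zero] at h
  linarith

lemma lie_ξ_pullbackMetric (i : Fin s) {v w : E} (hv : ∀ j, pullbackForm Φ (S.η j) q v = 0)
    (hw : ∀ j, pullbackForm Φ (S.η j) q w = 0) :
    fderiv ℝ (pullbackMetric Φ S.g) q (pullbackField Φ (S.ξ i) q) v w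
      + pullbackMetric Φ S.g q (fderiv ℝ (pullbackField Φ (S.ξ i)) q v) w
      + pullbackMetric Φ S.g q v (fderiv ℝ (pullbackField Φ (S.ξ i)) q w)
      = 2 * β (Φ q) * pullbackMetric Φ S.g q v w := by
  obtain ⟨nabla, hLC, hf⟩ := hS.nabla_f
  obtain ⟨X, hX, rfl, hDX⟩ := hΦ.exists_fderiv_pullbackField_eq_zero hq v
  obtain ⟨Y, hY, rfl, hDY⟩ := hΦ.exists_fderiv_pullbackField_eq_zero hq w
  simp only [hΦ.pullbackForm_pullbackField hq] at hv hw
  have h := lie_ξ_g hS.normal hLC hf hX hY i (Φ q) hv hw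
  rw [hΦ.mvfderiv_inner hq S.g hX hY, hΦ.inner_mlieBracket hq S.g (S.smooth_ξ i) hX,
    S.g.symm _ (X (Φ q)) (mlieBracket _ _ _ _), hΦ.inner_mlieBracket hq S.g (S.smooth_ξ i) hY,
    hDX, hDY, ← hΦ.pullbackMetric_pullbackField hq] at h
  simp only [zero_apply, map_zero] at h
  rw [pullbackMetric_comm Φ S.g q (pullbackField Φ X q) (fderiv ℝ _ q _)]
  linarith

lemma lie_ξ_pullbackEnd (i : Fin s) (v : E) :
    fderiv ℝ (pullbackEnd Φ S.f) q (pullbackField Φ (S.ξ i) q) v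
      = fderiv ℝ (pullbackField Φ (S.ξ i)) q (pullbackEnd Φ S.f q v)
        - pullbackEnd Φ S.f q (fderiv ℝ (pullbackField Φ (S.ξ i)) q v) := by
  obtain ⟨nabla, hLC, hf⟩ := hS.nabla_f
  obtain ⟨X, hX, rfl, hDX⟩ := hΦ.exists_fderiv_pullbackField_eq_zero hq v
  have h := lie_ξ_f hS.normal hLC hf hX i (Φ q)
  rw [hΦ.mlieBracket_eq hq (S.smooth_ξ i) (S.smooth_f.app hX),
    hΦ.mlieBracket_eq hq (S.smooth_ξ i) hX, ← hΦ.mfderiv_pullbackEnd hq] at h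
  have h' : (_ : E) = _ := hΦ.mfderiv_injective hq h
  rw [hΦ.fderiv_pullbackField_app hq S.smooth_f hX, hΦ.pullbackField_app hq, hDX, zero_apply,
    map_zero, add_zero, zero_sub, map_neg] at h'
  rw [← sub_eq_zero] at h' ⊢
  rw [← h']
  abel

lemma koszulDeriv_eq_zero (v : E) {y z : E} (hy : ∀ j, pullbackForm Φ (S.η j) q y = 0)
    (hz : ∀ j, pullbackForm Φ (S.η j) q z = 0) :
    koszulDeriv (pullbackMetric Φ S.g) (pullbackEnd Φ S.f) q v y z = 0 := by
  obtain ⟨nabla, hLC, hf⟩ := hS.nabla_f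
  obtain ⟨X, hX, rfl, -⟩ := hΦ.exists_fderiv_pullbackField_eq_zero hq v
  obtain ⟨Y, hY, rfl, hDY⟩ := hΦ.exists_fderiv_pullbackField_eq_zero hq y
  obtain ⟨Z, hZ, rfl, -⟩ := hΦ.exists_fderiv_pullbackField_eq_zero hq z
  simp only [hΦ.pullbackForm_pullbackField hq] at hy hz
  have h := inner_nabla_f_add_eq_zero hf hX hY (Φ q) hy hz
  rw [hΦ.inner_nabla hq hLC hX (S.smooth_f.app hY) hZ,
    hΦ.inner_nabla hq hLC hX hY (S.smooth_f.app hZ),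
    hΦ.fderiv_pullbackField_app hq S.smooth_f hY, hΦ.pullbackField_app hq,
    hΦ.pullbackField_app hq, hDY] at h
  simp only [zero_apply, map_zero, add_zero, zero_add] at h
  rw [koszulDeriv]
  linarith

end WeakMetricFStructure.IsWeakKenmotsu

section Frame

variable {E : Type*} [NormedAddCommGroup E] [NormedSpace ℝ E] {n s : ℕ} {M : Type*}
  [TopologicalSpace M] [ChartedSpace (EuclideanSpace ℝ (Fin (2 * n + s))) M]
  [IsManifold (𝓡 (2 * n + s)) ∞ M] (S : WeakMetricFStructure n s M) (Φ : E → M) (q : E)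

/-- The frame `a ↦ ∑ᵢ aᵢ ξᵢ` in the coordinates `Φ`. -/
noncomputable def pullbackFrame : EuclideanSpace ℝ (Fin s) →L[ℝ] E :=
  ∑ i, (EuclideanSpace.proj i).smulRight (pullbackField Φ (S.ξ i) q)

/-- The vector-valued form `(η¹, …, ηˢ)` in the coordinates `Φ`. -/
noncomputable def pullbackCoframe : E →L[ℝ] EuclideanSpace ℝ (Fin s) :=
  (EuclideanSpace.equiv (Fin s) ℝ).symm ∘L ContinuousLinearMap.pi fun i => pullbackForm Φ (S.η i) q

lemma pullbackFrame_apply (a : EuclideanSpace ℝ (Fin s)) :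
    pullbackFrame S Φ q a = ∑ i, a i • pullbackField Φ (S.ξ i) q := by
  simp [pullbackFrame]

lemma pullbackFrame_single (i : Fin s) :
    pullbackFrame S Φ q (EuclideanSpace.single i 1) = pullbackField Φ (S.ξ i) q := by
  simp [pullbackFrame_apply, PiLp.single_apply]

lemma pullbackCoframe_apply (v : E) (i : Fin s) :
    pullbackCoframe S Φ q v i = pullbackForm Φ (S.η i) q v := rfl

end Frame

namespace WeakMetricFStructure.IsWeakKenmotsu

variable {E : Type} [NormedAddCommGroup E] [NormedSpace ℝ E] [FiniteDimensional ℝ E] {n s : ℕ}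
  {M : Type*} [TopologicalSpace M] [T2Space M]
  [ChartedSpace (EuclideanSpace ℝ (Fin (2 * n + s))) M] [IsManifold (𝓡 (2 * n + s)) ∞ M]
  {S : WeakMetricFStructure n s M} {β : M → ℝ} (hS : S.IsWeakKenmotsu β)
  {Φ : OpenPartialHomeomorph E M} (hΦ : IsSmoothParametrization (2 * n + s) Φ)

include hΦ in
omit [T2Space M] in
lemma contDiffOn_pullbackFrame : ContDiffOn ℝ ∞ (pullbackFrame S Φ) Φ.source := by
  refine contDiffOn_clm_apply.2 fun a => ?_
  simp only [pullbackFrame_apply]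
  exact ContDiffOn.sum fun i _ q hq =>
    ((hΦ.contDiffAt_pullbackField hq (S.smooth_ξ i)).const_smul (a i)).contDiffWithinAt

include hΦ in
lemma contDiffOn_pullbackCoframe : ContDiffOn ℝ ∞ (pullbackCoframe S Φ) Φ.source :=
  contDiffOn_clm_apply.2 fun _ => (contDiffOn_piLp 2).2 fun i =>
    (hΦ.contDiffOn_pullbackForm (S.smooth_η i)).clm_apply contDiffOn_const

include hΦ in
omit [T2Space M] in
lemma fderiv_pullbackFrame {q : E} (hq : q ∈ Φ.source) (v : E) (a : EuclideanSpace ℝ (Fin s)) :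
    fderiv ℝ (pullbackFrame S Φ) q v a
      = ∑ i, a i • fderiv ℝ (pullbackField Φ (S.ξ i)) q v := by
  have hframe := (((contDiffOn_pullbackFrame (S := S) hΦ).contDiffAt
    (Φ.open_source.mem_nhds hq)).differentiableAt (by simp)).hasFDerivAt.clm_apply
    (hasFDerivAt_const a q)
  have hsum := HasFDerivAt.fun_sum (u := Finset.univ) fun i _ =>
    (hΦ.hasFDerivAt_pullbackField hq (S.smooth_ξ i)).const_smul (a i)
  simp only [pullbackFrame_apply] at hframe
  simpa using congr($(hframe.unique hsum) v)

include hΦ in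
lemma fderiv_pullbackCoframe {q : E} (hq : q ∈ Φ.source) (u v : E) (i : Fin s) :
    fderiv ℝ (pullbackCoframe S Φ) q u v i = fderiv ℝ (pullbackForm Φ (S.η i)) q u v := by
  have hdiff := ((contDiffOn_pullbackCoframe (S := S) hΦ).contDiffAt
    (Φ.open_source.mem_nhds hq)).differentiableAt (by simp)
  have hcoframe := (EuclideanSpace.proj i).hasFDerivAt.comp q
    (hdiff.hasFDerivAt.clm_apply (hasFDerivAt_const v q))
  have hform := (hΦ.differentiableAt_pullbackForm hq (S.smooth_η i)).hasFDerivAt.clm_apply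
    (hasFDerivAt_const v q)
  simpa using congr($(hcoframe.unique hform) u)

include hS hΦ in
lemma isCommutingFrame :
    IsCommutingFrame (pullbackFrame S Φ) (pullbackCoframe S Φ) Φ.source where
  isOpen := Φ.open_source
  contDiffOn_frame := contDiffOn_pullbackFrame hΦ
  contDiffOn_form := contDiffOn_pullbackCoframe hΦ
  form_frame q hq a := by
    ext i
    simp [pullbackCoframe_apply, pullbackFrame_apply, hΦ.pullbackForm_pullbackField hq, S.η_ξ]
  comm q hq a b := by
    rw [fderiv_pullbackFrame hΦ hq, fderiv_pullbackFrame hΦ hq]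
    simp only [pullbackFrame_apply, map_sum, map_smul, Finset.smul_sum]
    rw [Finset.sum_comm]
    refine Finset.sum_congr rfl fun i _ => Finset.sum_congr rfl fun j _ => ?_
    rw [hS.fderiv_ξ_comm hΦ hq, smul_comm]
  closed q hq u v := by
    ext i
    rw [fderiv_pullbackCoframe hΦ hq, fderiv_pullbackCoframe hΦ hq, hS.fderiv_η_comm hΦ hq]

end WeakMetricFStructure.IsWeakKenmotsu

lemma isSmoothParametrization_chartAt_symm {m : ℕ} {M : Type*} [TopologicalSpace M]
    [ChartedSpace (EuclideanSpace ℝ (Fin m)) M] [IsManifold (𝓡 m) ∞ M] (p : M) :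
    IsSmoothParametrization m (chartAt (EuclideanSpace ℝ (Fin m)) p).symm where
  contMDiffOn := contMDiffOn_chart_symm
  contMDiffOn_symm := contMDiffOn_chart

lemma IsSmoothParametrization.comp {E E' : Type*} [NormedAddCommGroup E] [NormedSpace ℝ E]
    [NormedAddCommGroup E'] [NormedSpace ℝ E'] {m : ℕ} {M : Type*} [TopologicalSpace M]
    [ChartedSpace (EuclideanSpace ℝ (Fin m)) M] {Φ : OpenPartialHomeomorph E M}
    (hΦ : IsSmoothParametrization m Φ) {Θ : OpenPartialHomeomorph E' E}
    (hΘ : ContDiffOn ℝ ∞ Θ Θ.source) (hΘ' : ContDiffOn ℝ ∞ Θ.symm Θ.target) :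
    IsSmoothParametrization m (Θ.trans Φ) where
  contMDiffOn := hΦ.contMDiffOn.comp' hΘ.contMDiffOn
  contMDiffOn_symm := by
    rw [OpenPartialHomeomorph.trans_target]
    exact hΘ'.contMDiffOn.comp' hΦ.contMDiffOn_symm

/-- Coordinates `Φ : ball 0 r × F → M` in which `ξᵢ = ∂/∂tᵢ` and `ηⁱ = dtᵢ`. -/
structure IsAdaptedParametrization {n s : ℕ} {M F : Type*} [TopologicalSpace M]
    [ChartedSpace (EuclideanSpace ℝ (Fin (2 * n + s))) M] [IsManifold (𝓡 (2 * n + s)) ∞ M]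
    [NormedAddCommGroup F] [NormedSpace ℝ F] (S : WeakMetricFStructure n s M) (r : ℝ)
    (Φ : OpenPartialHomeomorph (EuclideanSpace ℝ (Fin s) × F) M) : Prop
    extends IsSmoothParametrization (2 * n + s) Φ where
  source_eq : Φ.source = Metric.ball 0 r ×ˢ univ
  pullbackField_ξ : ∀ q ∈ Φ.source, ∀ i,
    pullbackField Φ (S.ξ i) q = (EuclideanSpace.single i 1, 0)
  pullbackForm_η : ∀ q ∈ Φ.source, ∀ i w, pullbackForm Φ (S.η i) q w = w.1 i

lemma WeakMetricFStructure.IsWeakKenmotsu.exists_isAdaptedParametrization {n s : ℕ}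
    {M : Type*} [TopologicalSpace M] [T2Space M]
    [ChartedSpace (EuclideanSpace ℝ (Fin (2 * n + s))) M] [IsManifold (𝓡 (2 * n + s)) ∞ M]
    {S : WeakMetricFStructure n s M} {β : M → ℝ} (hS : S.IsWeakKenmotsu β) (p : M) :
    ∃ r > 0, ∃ Φ : OpenPartialHomeomorph
        (EuclideanSpace ℝ (Fin s) × EuclideanSpace ℝ (Fin (2 * n))) M,
      IsAdaptedParametrization S r Φ ∧ Φ 0 = p := by
  set e := (chartAt (EuclideanSpace ℝ (Fin (2 * n + s))) p).symm
  have he : IsSmoothParametrization (2 * n + s) e := isSmoothParametrization_chartAt_symm p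
  obtain ⟨r, hr, Θ, hΘs, hΘ0, hΘe, hΘ, hΘ', hΘξ, hΘη⟩ := exists_adapted_coordinates
    (T := EuclideanSpace ℝ (Fin s)) (F := EuclideanSpace ℝ (Fin (2 * n))) (hS.isCommutingFrame he)
    (mem_chart_target _ p : e.symm p ∈ e.source) (by simp [add_comm])
  have hsource : (Θ.trans e).source = Θ.source := by
    rw [OpenPartialHomeomorph.trans_source]
    exact inter_eq_left.2 hΘe
  have hΦ := he.comp hΘ hΘ'
  have hmfderiv {q} (hq : q ∈ Θ.source) (w) :
      mfderiv 𝓘(ℝ, _) (𝓡 (2 * n + s)) (Θ.trans e) q w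
        = mfderiv (𝓡 (2 * n + s)) (𝓡 (2 * n + s)) e (Θ q) (fderiv ℝ Θ q w) := by
    rw [← mfderiv_eq_fderiv]
    exact mfderiv_comp_apply q (he.mdifferentiable.mdifferentiableAt (hΘe hq))
      ((hΘ.contDiffAt (Θ.open_source.mem_nhds hq)).differentiableAt (by simp)).mdifferentiableAt w
  refine ⟨r, hr, Θ.trans e, ⟨hΦ, hsource.trans hΘs, ?_, ?_⟩, ?_⟩
  · intro q hq i
    refine hΦ.pullbackField_eq hq ?_
    rw [hsource] at hq
    refine (hmfderiv hq _).trans ?_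
    rw [hΘξ q hq, pullbackFrame_single]
    exact he.mfderiv_pullbackField (hΘe hq) _
  · intro q hq i w
    rw [hsource] at hq
    rw [← hΘη q hq w, pullbackCoframe_apply]
    exact congrArg (S.η i _) (hmfderiv hq w)
  · exact (congrArg e hΘ0).trans (e.right_inv (mem_chart_source _ p))

/-! ### Metrics of the leaves -/

section Fiber

variable {T F : Type*} [NormedAddCommGroup T] [NormedSpace ℝ T] [NormedAddCommGroup F]
  [NormedSpace ℝ F]

/-- The restriction of a metric on `T × F` to the fibres `{t} × F`. -/
noncomputable def fiberMetric (g : T × F → (T × F) →L[ℝ] (T × F) →L[ℝ] ℝ) (q : T × F) :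
    F →L[ℝ] F →L[ℝ] ℝ :=
  ContinuousLinearMap.precomp ℝ (ContinuousLinearMap.inr ℝ T F) ∘L
    g q ∘L ContinuousLinearMap.inr ℝ T F

/-- The compression of a `(1,1)`-tensor field on `T × F` to the fibres `{t} × F`. -/
noncomputable def fiberEnd (f : T × F → (T × F) →L[ℝ] T × F) (q : T × F) : F →L[ℝ] F :=
  ContinuousLinearMap.snd ℝ T F ∘L f q ∘L ContinuousLinearMap.inr ℝ T F

lemma fiberMetric_apply (g : T × F → (T × F) →L[ℝ] (T × F) →L[ℝ] ℝ) (q : T × F) (v w : F) :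
    fiberMetric g q v w = g q (0, v) (0, w) := rfl

variable {g : T × F → (T × F) →L[ℝ] (T × F) →L[ℝ] ℝ} {f : T × F → (T × F) →L[ℝ] T × F}
  {t : T} {y : F}

lemma contDiffOn_fiberMetric {U : Set (T × F)} (hg : ContDiffOn ℝ ∞ g U) :
    ContDiffOn ℝ ∞ (fiberMetric g) U :=
  contDiffOn_const.clm_comp (hg.clm_comp contDiffOn_const)

lemma contDiffOn_fiberEnd {U : Set (T × F)} (hf : ContDiffOn ℝ ∞ f U) :
    ContDiffOn ℝ ∞ (fiberEnd f) U :=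
  contDiffOn_const.clm_comp (hf.clm_comp contDiffOn_const)

lemma hasFDerivAt_mk_left (t : T) (y : F) :
    HasFDerivAt (fun t => (t, y)) (ContinuousLinearMap.inl ℝ T F) t :=
  (hasFDerivAt_id t).prodMk (hasFDerivAt_const y t)

lemma hasFDerivAt_mk_right (t : T) (y : F) :
    HasFDerivAt (fun y => (t, y)) (ContinuousLinearMap.inr ℝ T F) y :=
  (hasFDerivAt_const t y).prodMk (hasFDerivAt_id y)

lemma differentiableAt_mk_right_comp {G : Type*} [NormedAddCommGroup G] [NormedSpace ℝ G]
    {u : T × F → G} (hu : DifferentiableAt ℝ u (t, y)) :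
    DifferentiableAt ℝ (fun y => u (t, y)) y :=
  hu.comp y (hasFDerivAt_mk_right t y).differentiableAt

lemma hasFDerivAt_fiberMetric_apply {q : T × F} (hg : DifferentiableAt ℝ g q) (v w : F) :
    HasFDerivAt (fun q => fiberMetric g q v w) (((fderiv ℝ g q).flip (0, v)).flip (0, w)) q := by
  simpa using! (hg.hasFDerivAt.clm_apply (hasFDerivAt_const ((0 : T), v) q)).clm_apply
    (hasFDerivAt_const ((0 : T), w) q)

lemma hasFDerivAt_fiberEnd_apply {q : T × F} (hf : DifferentiableAt ℝ f q) (v : F) :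
    HasFDerivAt (fun q => fiberEnd f q v)
      (ContinuousLinearMap.snd ℝ T F ∘L (fderiv ℝ f q).flip (0, v)) q := by
  simpa using! (hf.hasFDerivAt.clm_apply (hasFDerivAt_const ((0 : T), v) q)).snd

lemma fderiv_fiberMetric_right (hg : DifferentiableAt ℝ g (t, y)) (u v w : F) :
    fderiv ℝ (fun y => fiberMetric g (t, y)) y u v w
      = fderiv ℝ g (t, y) (0, u) (0, v) (0, w) := by
  have hfiber : DifferentiableAt ℝ (fiberMetric g) (t, y) :=
    (differentiableAt_const _).clm_comp (hg.clm_comp (differentiableAt_const _))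
  have hslice : DifferentiableAt ℝ (fun y => fiberMetric g (t, y)) y :=
    differentiableAt_mk_right_comp (G := F →L[ℝ] F →L[ℝ] ℝ) hfiber
  have h' := (hslice.hasFDerivAt.clm_apply (hasFDerivAt_const v y)).clm_apply
    (hasFDerivAt_const w y)
  have h := (hasFDerivAt_fiberMetric_apply hg v w).comp y (hasFDerivAt_mk_right t y)
  simpa using! congr($(h'.unique h) u)

lemma fderiv_fiberEnd_right (hf : DifferentiableAt ℝ f (t, y)) (u v : F) :
    fderiv ℝ (fun y => fiberEnd f (t, y)) y u v = (fderiv ℝ f (t, y) (0, u) (0, v)).2 := by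
  have hfiber : DifferentiableAt ℝ (fiberEnd f) (t, y) :=
    (differentiableAt_const _).clm_comp (hf.clm_comp (differentiableAt_const _))
  have hslice : DifferentiableAt ℝ (fun y => fiberEnd f (t, y)) y :=
    differentiableAt_mk_right_comp hfiber
  have h' := hslice.hasFDerivAt.clm_apply (hasFDerivAt_const v y)
  have h := (hasFDerivAt_fiberEnd_apply hf v).comp y (hasFDerivAt_mk_right t y)
  simpa using! congr($(h'.unique h) u)

end Fiber

lemma div_eq_div_of_hasFDerivAt_smul {T : Type*} [NormedAddCommGroup T] [NormedSpace ℝ T]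
    {U : Set T} (hU : IsOpen U) (hU' : IsPreconnected U) {A : T → T →L[ℝ] ℝ} {u w : T → ℝ}
    (hu : ∀ t ∈ U, HasFDerivAt u (u t • A t) t) (hw : ∀ t ∈ U, HasFDerivAt w (w t • A t) t)
    (hw0 : ∀ t ∈ U, w t ≠ 0) {t t' : T} (ht : t ∈ U) (ht' : t' ∈ U) :
    u t / w t = u t' / w t' := by
  have hdiv (x) (hx : x ∈ U) : HasFDerivAt (fun x => u x / w x) (0 : T →L[ℝ] ℝ) x := by
    have hinv : HasFDerivAt (fun x => (w x)⁻¹) (-(w x ^ 2)⁻¹ • w x • A x) x :=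
      (hasDerivAt_inv (hw0 x hx)).comp_hasFDerivAt x (hw x hx)
    simp only [div_eq_mul_inv]
    refine ((hu x hx).fun_mul hinv).congr_fderiv ?_
    have := hw0 x hx
    match_scalars
    field_simp
    ring
  exact hU.is_const_of_fderiv_eq_zero hU'
    (fun x hx => (hdiv x hx).differentiableAt.differentiableWithinAt)
    (fun x hx => (hdiv x hx).fderiv) ht ht'

lemma exists_contDiff_mem_ball (T : Type*) [NormedAddCommGroup T] [NormedSpace ℝ T]
    [HasContDiffBump T] {r : ℝ} (hr : 0 < r) :
    ∃ κ : T → T, ContDiff ℝ ∞ κ ∧ (∀ t, κ t ∈ Metric.ball 0 r) ∧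
      ∀ t ∈ Metric.ball 0 (r / 2), κ t = t := by
  let χ : ContDiffBump (0 : T) := ⟨r / 2, r, half_pos hr, half_lt_self hr⟩
  refine ⟨fun t => χ t • t, χ.contDiff.smul contDiff_id, fun t => ?_, fun t ht => ?_⟩ <;>
    beta_reduce
  · rcases lt_or_ge ‖t‖ r with ht | ht
    · rw [mem_ball_zero_iff, norm_smul, Real.norm_of_nonneg χ.nonneg]
      exact (mul_le_of_le_one_left (norm_nonneg t) χ.le_one).trans_lt ht
    · rw [χ.zero_of_le_dist ((dist_zero_right t).symm ▸ ht), zero_smul]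
      exact Metric.mem_ball_self hr
  · rw [χ.one_of_mem_closedBall (Metric.ball_subset_closedBall ht), one_smul]

/-- The linear form `∑ᵢ dtᵢ`, the expression of `η̄` in adapted coordinates. -/
noncomputable def coordSum (s : ℕ) : EuclideanSpace ℝ (Fin s) →L[ℝ] ℝ :=
  ∑ i, EuclideanSpace.proj i

lemma coordSum_apply {s : ℕ} (a : EuclideanSpace ℝ (Fin s)) : coordSum s a = ∑ i, a i := by
  simp [coordSum]

lemma map_prod_zero {s : ℕ} {F G : Type*} [NormedAddCommGroup F] [NormedSpace ℝ F]
    [NormedAddCommGroup G] [NormedSpace ℝ G] (L : EuclideanSpace ℝ (Fin s) × F →L[ℝ] G)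
    (a : EuclideanSpace ℝ (Fin s)) :
    L (a, 0) = ∑ i, a i • L (EuclideanSpace.single i 1, 0) := by
  simp only [← map_smul, ← map_sum]
  congr 1
  ext j
  · simp [Prod.fst_sum, Pi.single_apply]
  · simp [Prod.snd_sum]

namespace IsAdaptedParametrization

variable {n s : ℕ} {M F : Type*} [TopologicalSpace M]
  [ChartedSpace (EuclideanSpace ℝ (Fin (2 * n + s))) M] [IsManifold (𝓡 (2 * n + s)) ∞ M]
  [NormedAddCommGroup F] [NormedSpace ℝ F] {S : WeakMetricFStructure n s M} {r : ℝ}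
  {Φ : OpenPartialHomeomorph (EuclideanSpace ℝ (Fin s) × F) M}
  (hΦ : IsAdaptedParametrization S r Φ)

include hΦ

lemma mem_source {t : EuclideanSpace ℝ (Fin s)} (ht : t ∈ Metric.ball 0 r) (y : F) :
    (t, y) ∈ Φ.source := by
  rw [hΦ.source_eq]
  exact ⟨ht, mem_univ y⟩

variable {q : EuclideanSpace ℝ (Fin s) × F} (hq : q ∈ Φ.source)

include hq

lemma fderiv_pullbackField_ξ (i : Fin s) : fderiv ℝ (pullbackField Φ (S.ξ i)) q = 0 := by
  have hconst : pullbackField Φ (S.ξ i) =ᶠ[𝓝 q] fun _ => (EuclideanSpace.single i 1, 0) :=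
    eventually_of_mem (Φ.open_source.mem_nhds hq) fun q hq => hΦ.pullbackField_ξ q hq i
  rw [hconst.fderiv_eq, fderiv_const_apply]

lemma pullbackForm_fiber (w : F) (i : Fin s) : pullbackForm Φ (S.η i) q (0, w) = 0 :=
  hΦ.pullbackForm_η q hq i _

lemma mfderiv_horizontal (a : EuclideanSpace ℝ (Fin s)) :
    mfderiv 𝓘(ℝ, EuclideanSpace ℝ (Fin s) × F) (𝓡 (2 * n + s)) Φ q (a, 0)
      = ∑ i, a i • S.ξ i (Φ q) := by
  have hξ (i : Fin s) : mfderiv 𝓘(ℝ, EuclideanSpace ℝ (Fin s) × F) (𝓡 (2 * n + s)) Φ q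
      (EuclideanSpace.single i 1, 0) = S.ξ i (Φ q) := by
    rw [← hΦ.pullbackField_ξ q hq i]
    exact hΦ.mfderiv_pullbackField hq _
  simp only [← hξ]
  exact map_prod_zero (G := EuclideanSpace ℝ (Fin (2 * n + s))) _ a

lemma pullbackMetric_horizontal (a : EuclideanSpace ℝ (Fin s)) (w : EuclideanSpace ℝ (Fin s) × F) :
    pullbackMetric Φ S.g q (a, 0) w = inner ℝ a w.1 := by
  rw [pullbackMetric_apply, hΦ.mfderiv_horizontal hq]
  simp only [map_sum, map_smul, sum_apply, smul_apply, S.g_ξ, PiLp.inner_apply, smul_eq_mul]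
  refine Finset.sum_congr rfl fun i _ => ?_
  rw [← hΦ.pullbackForm_η q hq i w]
  exact mul_comm _ _

lemma pullbackMetric_eq (v w : EuclideanSpace ℝ (Fin s) × F) :
    pullbackMetric Φ S.g q v w
      = inner ℝ v.1 w.1 + fiberMetric (pullbackMetric Φ S.g) q v.2 w.2 := by
  have hv : v = (v.1, 0) + (0, v.2) := by simp
  have hw : w = (w.1, 0) + (0, w.2) := by simp
  have hvw : pullbackMetric Φ S.g q (0, v.2) (w.1, 0) = 0 := by
    rw [pullbackMetric_comm, hΦ.pullbackMetric_horizontal hq, inner_zero_right]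
  rw [fiberMetric_apply, hv, map_add, add_apply, hΦ.pullbackMetric_horizontal hq, ← hv]
  congr 1
  nth_rw 1 [hw]
  rw [map_add, hvw, zero_add]

lemma fiberMetric_pos {v : F} (hv : v ≠ 0) :
    0 < fiberMetric (pullbackMetric Φ S.g) q v v :=
  hΦ.pullbackMetric_pos hq S.g (by simpa using! hv)

lemma fst_pullbackEnd (v : EuclideanSpace ℝ (Fin s) × F) : (pullbackEnd Φ S.f q v).1 = 0 := by
  ext i
  rw [← hΦ.pullbackForm_η q hq]
  exact (congrArg (S.η i (Φ q)) (hΦ.mfderiv_pullbackEnd hq S.f v)).trans (S.η_f _ _ _)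

lemma pullbackEnd_fiber (w : F) :
    pullbackEnd Φ S.f q (0, w) = (0, fiberEnd (pullbackEnd Φ S.f) q w) :=
  Prod.ext (hΦ.fst_pullbackEnd hq _) rfl

lemma fiberEnd_skew (v w : F) :
    fiberMetric (pullbackMetric Φ S.g) q (fiberEnd (pullbackEnd Φ S.f) q v) w
      = -fiberMetric (pullbackMetric Φ S.g) q v (fiberEnd (pullbackEnd Φ S.f) q w) := by
  rw [fiberMetric_apply, fiberMetric_apply, ← hΦ.pullbackEnd_fiber hq, ← hΦ.pullbackEnd_fiber hq,
    pullbackMetric_apply, pullbackMetric_apply, hΦ.mfderiv_pullbackEnd hq,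
    hΦ.mfderiv_pullbackEnd hq]
  exact S.f_skew _ _ _

lemma fiberEnd_injective : Function.Injective (fiberEnd (pullbackEnd Φ S.f) q) := by
  refine (injective_iff_map_eq_zero _).2 fun w hw => ?_
  have hf := hΦ.mfderiv_pullbackEnd hq S.f (0, w)
  rw [hΦ.pullbackEnd_fiber hq, hw] at hf
  have hzero := S.eq_zero_of_f_eq_zero _ _ (hΦ.pullbackForm_fiber hq w)
    (hf.symm.trans (map_zero _))
  have h0 : ((0, w) : EuclideanSpace ℝ (Fin s) × F) = 0 :=
    hΦ.mfderiv_injective hq (hzero.trans (map_zero _).symm)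
  exact congrArg Prod.snd h0

variable [FiniteDimensional ℝ F] [T2Space M] {β : M → ℝ} (hS : S.IsWeakKenmotsu β)

include hS

lemma fderiv_pullbackMetric_horizontal (a : EuclideanSpace ℝ (Fin s)) (v w : F) :
    fderiv ℝ (pullbackMetric Φ S.g) q (a, 0) (0, v) (0, w)
      = 2 * β (Φ q) * coordSum s a * fiberMetric (pullbackMetric Φ S.g) q v w := by
  have hξ (i : Fin s) :
      fderiv ℝ (pullbackMetric Φ S.g) q (EuclideanSpace.single i 1, 0) (0, v) (0, w)
        = 2 * β (Φ q) * fiberMetric (pullbackMetric Φ S.g) q v w := by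
    have h := hS.lie_ξ_pullbackMetric hΦ.toIsSmoothParametrization hq i
      (hΦ.pullbackForm_fiber hq v) (hΦ.pullbackForm_fiber hq w)
    simpa [hΦ.fderiv_pullbackField_ξ hq, hΦ.pullbackField_ξ q hq] using! h
  refine (map_prod_zero (((fderiv ℝ (pullbackMetric Φ S.g) q).flip (0, v)).flip (0, w)) a).trans ?_
  simp only [ContinuousLinearMap.flip_apply, hξ, coordSum_apply, smul_eq_mul, ← Finset.sum_mul]
  ring

lemma fderiv_pullbackEnd_horizontal (a : EuclideanSpace ℝ (Fin s))
    (v : EuclideanSpace ℝ (Fin s) × F) : fderiv ℝ (pullbackEnd Φ S.f) q (a, 0) v = 0 := by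
  have hξ (i : Fin s) : fderiv ℝ (pullbackEnd Φ S.f) q (EuclideanSpace.single i 1, 0) v = 0 := by
    have h := hS.lie_ξ_pullbackEnd hΦ.toIsSmoothParametrization hq i v
    simpa [hΦ.fderiv_pullbackField_ξ hq, hΦ.pullbackField_ξ q hq] using! h
  refine (map_prod_zero ((fderiv ℝ (pullbackEnd Φ S.f) q).flip v) a).trans ?_
  simp only [ContinuousLinearMap.flip_apply, hξ, smul_zero, Finset.sum_const_zero]

end IsAdaptedParametrization

/-- The metric in adapted coordinates on the leaf `{t = 0}` of the contact distribution. -/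
noncomputable def leafMetric {n s : ℕ} {M F : Type*} [TopologicalSpace M]
    [ChartedSpace (EuclideanSpace ℝ (Fin (2 * n + s))) M] [IsManifold (𝓡 (2 * n + s)) ∞ M]
    [NormedAddCommGroup F] [NormedSpace ℝ F] (S : WeakMetricFStructure n s M)
    (Φ : EuclideanSpace ℝ (Fin s) × F → M) (y : F) : F →L[ℝ] F →L[ℝ] ℝ :=
  fiberMetric (pullbackMetric Φ S.g) (0, y)

/-- The tensor `f` in adapted coordinates on the leaf `{t = 0}` of the contact distribution. -/
noncomputable def leafEnd {n s : ℕ} {M F : Type*} [TopologicalSpace M]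
    [ChartedSpace (EuclideanSpace ℝ (Fin (2 * n + s))) M] [IsManifold (𝓡 (2 * n + s)) ∞ M]
    [NormedAddCommGroup F] [NormedSpace ℝ F] (S : WeakMetricFStructure n s M)
    (Φ : EuclideanSpace ℝ (Fin s) × F → M) (y : F) : F →L[ℝ] F :=
  fiberEnd (pullbackEnd Φ S.f) (0, y)

/-- The ratio of the metrics of the leaves through `(t, y)` and `(0, y)` in the direction `e`. -/
noncomputable def conformalFactor {n s : ℕ} {M F : Type*} [TopologicalSpace M]
    [ChartedSpace (EuclideanSpace ℝ (Fin (2 * n + s))) M] [IsManifold (𝓡 (2 * n + s)) ∞ M]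
    [NormedAddCommGroup F] [NormedSpace ℝ F] (S : WeakMetricFStructure n s M)
    (Φ : EuclideanSpace ℝ (Fin s) × F → M) (e : F) (q : EuclideanSpace ℝ (Fin s) × F) : ℝ :=
  fiberMetric (pullbackMetric Φ S.g) q e e / leafMetric S Φ q.2 e e

namespace IsAdaptedParametrization

variable {n s : ℕ} {M F : Type*} [TopologicalSpace M] [T2Space M]
  [ChartedSpace (EuclideanSpace ℝ (Fin (2 * n + s))) M] [IsManifold (𝓡 (2 * n + s)) ∞ M]
  [NormedAddCommGroup F] [NormedSpace ℝ F] [FiniteDimensional ℝ F]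
  {S : WeakMetricFStructure n s M} {r : ℝ}
  {Φ : OpenPartialHomeomorph (EuclideanSpace ℝ (Fin s) × F) M}
  (hΦ : IsAdaptedParametrization S r Φ) {β : M → ℝ} (hS : S.IsWeakKenmotsu β)

include hΦ hS

lemma hasFDerivAt_fiberMetric {t : EuclideanSpace ℝ (Fin s)} (ht : t ∈ Metric.ball 0 r)
    (y v w : F) :
    HasFDerivAt (fun t => fiberMetric (pullbackMetric Φ S.g) (t, y) v w)
      (fiberMetric (pullbackMetric Φ S.g) (t, y) v w • (2 * β (Φ (t, y))) • coordSum s) t := by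
  have hq := hΦ.mem_source ht y
  refine ((hasFDerivAt_fiberMetric_apply (hΦ.differentiableAt_pullbackMetric hq S.g) v w).comp t
    (hasFDerivAt_mk_left t y)).congr_fderiv ?_
  ext1 a
  refine (hΦ.fderiv_pullbackMetric_horizontal hq hS a v w).trans ?_
  simp only [smul_apply, smul_eq_mul]
  ring

lemma fiberMetric_eq {t : EuclideanSpace ℝ (Fin s)} (ht : t ∈ Metric.ball 0 r) {e : F}
    (he : e ≠ 0) (y v w : F) :
    fiberMetric (pullbackMetric Φ S.g) (t, y) v w
      = conformalFactor S Φ e (t, y) * leafMetric S Φ y v w := by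
  have hne {t} (ht : t ∈ Metric.ball 0 r) : fiberMetric (pullbackMetric Φ S.g) (t, y) e e ≠ 0 :=
    (hΦ.fiberMetric_pos (hΦ.mem_source ht y) he).ne'
  have h0 := Metric.mem_ball_self (x := (0 : EuclideanSpace ℝ (Fin s)))
    (Metric.pos_of_mem_ball ht)
  have hratio := div_eq_div_of_hasFDerivAt_smul Metric.isOpen_ball
    (convex_ball _ _).isPreconnected (fun t ht => hΦ.hasFDerivAt_fiberMetric hS ht y v w)
    (fun t ht => hΦ.hasFDerivAt_fiberMetric hS ht y e e) (fun t => hne) ht h0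
  rw [div_eq_div_iff (hne ht) (hne h0)] at hratio
  rw [conformalFactor, leafMetric, div_mul_eq_mul_div, eq_div_iff (hne h0), hratio, mul_comm]

omit [T2Space M] [FiniteDimensional ℝ F] in
lemma comp_β_eq (hβ : ∀ (x : M) (v : TangentSpace (𝓡 (2 * n + s)) x), S.InContact v →
      mvfderiv (𝓡 (2 * n + s)) β x v = 0)
    {t : EuclideanSpace ℝ (Fin s)} (ht : t ∈ Metric.ball 0 r) (y y' : F) :
    β (Φ (t, y)) = β (Φ (t, y')) := by
  have hslice (y : F) : HasFDerivAt (fun y => β (Φ (t, y))) (0 : F →L[ℝ] ℝ) y := by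
    have hq := hΦ.mem_source ht y
    have hcomp := (((hΦ.contDiffAt_comp hq hS.smooth_β).differentiableAt
      (by simp)).hasFDerivAt.comp y (hasFDerivAt_mk_right t y))
    refine hcomp.congr_fderiv ?_
    ext1 w
    refine (hΦ.fderiv_comp hq (hS.smooth_β.mdifferentiableAt (by simp)) (0, w)).trans ?_
    exact hβ _ _ (hΦ.pullbackForm_fiber hq w)
  exact is_const_of_fderiv_eq_zero (𝕜 := ℝ) (fun y => (hslice y).differentiableAt)
    (fun y => (hslice y).fderiv) y y'

lemma conformalFactor_eq (hβ : ∀ (x : M) (v : TangentSpace (𝓡 (2 * n + s)) x), S.InContact v →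
      mvfderiv (𝓡 (2 * n + s)) β x v = 0)
    {t : EuclideanSpace ℝ (Fin s)} (ht : t ∈ Metric.ball 0 r) {e : F} (he : e ≠ 0) (y y' : F) :
    conformalFactor S Φ e (t, y) = conformalFactor S Φ e (t, y') := by
  have hne {t} (ht : t ∈ Metric.ball 0 r) (y : F) :
      fiberMetric (pullbackMetric Φ S.g) (t, y) e e ≠ 0 :=
    (hΦ.fiberMetric_pos (hΦ.mem_source ht y) he).ne'
  have h0 := Metric.mem_ball_self (x := (0 : EuclideanSpace ℝ (Fin s)))
    (Metric.pos_of_mem_ball ht)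
  have hratio := div_eq_div_of_hasFDerivAt_smul Metric.isOpen_ball
    (convex_ball _ _).isPreconnected (fun t ht => hΦ.hasFDerivAt_fiberMetric hS ht y e e)
    (fun t ht => hΦ.comp_β_eq hS hβ ht y' y ▸ hΦ.hasFDerivAt_fiberMetric hS ht y' e e)
    (fun t ht => hne ht y') ht h0
  rw [div_eq_div_iff (hne ht y') (hne h0 y')] at hratio
  rw [conformalFactor, conformalFactor, leafMetric, leafMetric,
    div_eq_div_iff (hne h0 y) (hne h0 y'), hratio, mul_comm]

lemma fiberEnd_eq {t : EuclideanSpace ℝ (Fin s)} (ht : t ∈ Metric.ball 0 r) (y v : F) :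
    fiberEnd (pullbackEnd Φ S.f) (t, y) v = leafEnd S Φ y v := by
  have hslice (t) (ht : t ∈ Metric.ball 0 r) :
      HasFDerivAt (fun t => fiberEnd (pullbackEnd Φ S.f) (t, y) v)
        (0 : EuclideanSpace ℝ (Fin s) →L[ℝ] F) t := by
    have hq := hΦ.mem_source ht y
    refine ((hasFDerivAt_fiberEnd_apply (hΦ.differentiableAt_pullbackEnd hq S.smooth_f) v).comp t
      (hasFDerivAt_mk_left t y)).congr_fderiv ?_
    ext1 a
    exact congrArg Prod.snd (hΦ.fderiv_pullbackEnd_horizontal hq hS a (0, v))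
  exact Metric.isOpen_ball.is_const_of_fderiv_eq_zero (convex_ball _ _).isPreconnected
    (fun t ht => (hslice t ht).differentiableAt.differentiableWithinAt)
    (fun t ht => (hslice t ht).fderiv) ht (Metric.mem_ball_self (Metric.pos_of_mem_ball ht))

lemma koszulDeriv_leaf_eq_zero (hr : 0 < r) (y u v w : F) :
    koszulDeriv (leafMetric S Φ) (leafEnd S Φ) y u v w = 0 := by
  have hq := hΦ.mem_source (Metric.mem_ball_self hr) y
  have hg := hΦ.differentiableAt_pullbackMetric hq S.g
  have h := hS.koszulDeriv_eq_zero hΦ.toIsSmoothParametrization hq (0, u)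
    (hΦ.pullbackForm_fiber hq v) (hΦ.pullbackForm_fiber hq w)
  rw [koszulDeriv, hΦ.pullbackMetric_eq hq, inner_zero_right, zero_add,
    hΦ.pullbackEnd_fiber hq, hΦ.pullbackEnd_fiber hq,
    ← fderiv_fiberEnd_right (hΦ.differentiableAt_pullbackEnd hq S.smooth_f)] at h
  simpa only [koszulDeriv, christoffel, ← fderiv_fiberMetric_right hg] using! h

omit hS in
lemma contDiff_leafMetric (hr : 0 < r) : ContDiff ℝ ∞ (leafMetric S Φ) :=
  (contDiffOn_fiberMetric (hΦ.contDiffOn_pullbackMetric S.g)).comp_contDiff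
    (contDiff_const.prodMk contDiff_id) fun _ => hΦ.mem_source (Metric.mem_ball_self hr) _

omit hS in
lemma contDiff_leafEnd (hr : 0 < r) : ContDiff ℝ ∞ (leafEnd S Φ) :=
  (contDiffOn_fiberEnd (hΦ.contDiffOn_pullbackEnd S.smooth_f)).comp_contDiff
    (contDiff_const.prodMk contDiff_id) fun _ => hΦ.mem_source (Metric.mem_ball_self hr) _

omit hS [T2Space M] [FiniteDimensional ℝ F] in
lemma leafMetric_pos (hr : 0 < r) (y : F) {v : F} (hv : v ≠ 0) : 0 < leafMetric S Φ y v v :=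
  hΦ.fiberMetric_pos (hΦ.mem_source (Metric.mem_ball_self hr) y) hv

omit hS in
lemma contDiffOn_conformalFactor (hr : 0 < r) {e : F} (he : e ≠ 0) :
    ContDiffOn ℝ ∞ (conformalFactor S Φ e) Φ.source := by
  refine (((contDiffOn_fiberMetric (hΦ.contDiffOn_pullbackMetric S.g)).clm_apply
    contDiffOn_const).clm_apply contDiffOn_const).fun_div ?_ fun q _ =>
    (hΦ.leafMetric_pos hr q.2 he).ne'
  exact ((((hΦ.contDiff_leafMetric hr).comp contDiff_snd).clm_apply contDiff_const).clm_apply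
    contDiff_const).contDiffOn

-- A smooth self-map `κ` of `ℝˢ` with values in the ball and equal to the identity near `0` turns
-- the conformal factor, which is only defined over the ball, into a global function.
lemma exists_twisting_function (hr : 0 < r) {e : F} (he : e ≠ 0) :
    ∃ σ : EuclideanSpace ℝ (Fin s) × F → ℝ, ContDiff ℝ ∞ σ ∧ (∀ q, 0 < σ q) ∧
      (∀ t ∈ Metric.ball 0 (r / 2), ∀ y v w, fiberMetric (pullbackMetric Φ S.g) (t, y) v w
        = σ (t, y) ^ 2 * leafMetric S Φ y v w) ∧
      ((∀ (x : M) (v : TangentSpace (𝓡 (2 * n + s)) x), S.InContact v →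
        mvfderiv (𝓡 (2 * n + s)) β x v = 0) → ∀ t y, σ (t, y) = σ (t, 0)) := by
  obtain ⟨κ, hκ, hκr, hκid⟩ := exists_contDiff_mem_ball (EuclideanSpace ℝ (Fin s)) hr
  have hpos (t y) : 0 < conformalFactor S Φ e (κ t, y) :=
    div_pos (hΦ.fiberMetric_pos (hΦ.mem_source (hκr t) y) he) (hΦ.leafMetric_pos hr y he)
  have hsmooth : ContDiff ℝ ∞ fun q : EuclideanSpace ℝ (Fin s) × F =>
      conformalFactor S Φ e (κ q.1, q.2) :=
    (hΦ.contDiffOn_conformalFactor hr he).comp_contDiff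
      ((hκ.comp contDiff_fst).prodMk contDiff_snd) fun q => hΦ.mem_source (hκr _) _
  refine ⟨fun q => √(conformalFactor S Φ e (κ q.1, q.2)), hsmooth.sqrt fun q => (hpos _ _).ne',
    fun q => Real.sqrt_pos.2 (hpos _ _), fun t ht y v w => ?_, fun hβ t y => ?_⟩
  · rw [Real.sq_sqrt (hpos _ _).le, hκid t ht]
    exact hΦ.fiberMetric_eq hS (Metric.ball_subset_ball (half_le_self hr.le) ht) he y v w
  · exact congrArg Real.sqrt (hΦ.conformalFactor_eq hS hβ (hκr t) he y 0)

end IsAdaptedParametrization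

/-! ### The Levi-Civita connection on a vector space -/

section PositiveDefinite

variable {F : Type*} [NormedAddCommGroup F] [NormedSpace ℝ F] {B : F →L[ℝ] F →L[ℝ] ℝ}
  (hB : ∀ v, v ≠ 0 → 0 < B v v)

include hB

lemma injective_of_pos : Function.Injective B :=
  (injective_iff_map_eq_zero _).2 fun v hv => by
    by_contra hv0
    simpa [hv] using hB v hv0

lemma eq_of_forall_apply_eq {u v : F} (huv : ∀ w, B u w = B v w) : u = v :=
  injective_of_pos hB (ContinuousLinearMap.ext huv)

variable [FiniteDimensional ℝ F]

lemma apply_inverse_of_pos (l : F →L[ℝ] ℝ) : B (B.inverse l) = l := by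
  have hrank : Module.finrank ℝ F = Module.finrank ℝ (F →L[ℝ] ℝ) := by
    rw [LinearMap.toContinuousLinearMap.symm.finrank_eq, Subspace.dual_finrank_eq]
  have hinv : B.IsInvertible := ⟨(LinearEquiv.ofInjectiveOfFinrankEq B.toLinearMap
    (injective_of_pos hB) hrank).toContinuousLinearEquiv, rfl⟩
  exact hinv.self_apply_inverse l

lemma exists_pos_mul_sq_norm_le : ∃ c > 0, ∀ v, c * ‖v‖ ^ 2 ≤ B v v := by
  cases subsingleton_or_nontrivial F
  · exact ⟨1, one_pos, fun v => by simp [Subsingleton.elim v 0]⟩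
  obtain ⟨u, hu, hmin⟩ := (isCompact_sphere (0 : F) 1).exists_isMinOn
    (NormedSpace.sphere_nonempty.2 zero_le_one) (B.continuous.clm_apply continuous_id).continuousOn
  refine ⟨B u u, hB u (ne_zero_of_mem_unit_sphere ⟨u, hu⟩), fun v => ?_⟩
  rcases eq_or_ne v 0 with rfl | hv
  · simp
  have hnormalize : B u u ≤ ‖v‖⁻¹ * (‖v‖⁻¹ * B v v) := by
    simpa using isMinOn_iff.1 hmin (‖v‖⁻¹ • v) (by simp [norm_smul, hv])
  have : 0 < ‖v‖ := norm_pos_iff.2 hv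
  calc B u u * ‖v‖ ^ 2 ≤ ‖v‖⁻¹ * (‖v‖⁻¹ * B v v) * ‖v‖ ^ 2 := by gcongr
    _ = B v v := by field_simp

lemma isVonNBounded_setOf_lt_one : Bornology.IsVonNBounded ℝ {v | B v v < 1} := by
  obtain ⟨c, hc, hBc⟩ := exists_pos_mul_sq_norm_le hB
  refine (NormedSpace.isVonNBounded_ball ℝ F (√(1 / c))).subset fun v hv => ?_
  rw [mem_ball_zero_iff]
  refine Real.lt_sqrt_of_sq_lt ?_
  rw [lt_div_iff₀ hc, mul_comm]
  exact (hBc v).trans_lt hv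

end PositiveDefinite

section ChristoffelSymbols

set_option maxSynthPendingDepth 3

variable {F : Type*} [NormedAddCommGroup F] [NormedSpace ℝ F]

/-- The Christoffel symbols of the first kind, as a continuous trilinear form. -/
noncomputable def christoffelForm (D : F →L[ℝ] F →L[ℝ] F →L[ℝ] ℝ) : F →L[ℝ] F →L[ℝ] F →L[ℝ] ℝ :=
  (1 / 2 : ℝ) • (D + D.flip
    - (ContinuousLinearMap.flipₗᵢ ℝ F F ℝ).toContinuousLinearEquiv.toContinuousLinearMap ∘L D.flip)

lemma christoffelForm_apply (D : F →L[ℝ] F →L[ℝ] F →L[ℝ] ℝ) (v y z : F) :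
    christoffelForm D v y z = christoffel D v y z := by
  change (1 / 2 : ℝ) * (D v y z + D y v z - D z v y) = _
  rw [christoffel]
  ring

/-- The Christoffel symbols of the second kind of the metric `h`. -/
noncomputable def christoffelSymbol (h : F → F →L[ℝ] F →L[ℝ] ℝ) (x : F) : F →L[ℝ] F →L[ℝ] F :=
  ContinuousLinearMap.compL ℝ _ _ _ (h x).inverse ∘L christoffelForm (fderiv ℝ h x)

lemma christoffel_comm {D : F →L[ℝ] F →L[ℝ] F →L[ℝ] ℝ} (hD : ∀ u v w, D u v w = D u w v)
    (u v w : F) : christoffel D u v w = christoffel D v u w := by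
  rw [christoffel, christoffel, hD w u v]
  ring

lemma christoffel_add_christoffel {D : F →L[ℝ] F →L[ℝ] F →L[ℝ] ℝ}
    (hD : ∀ u v w, D u v w = D u w v) (u v w : F) :
    christoffel D u v w + christoffel D w v u = D v u w := by
  rw [christoffel, christoffel, hD u w v, hD v w u, hD w u v]
  ring

variable {h : F → F →L[ℝ] F →L[ℝ] ℝ}

lemma fderiv_apply_apply {Y Z : F → F} {x : F} (hh : DifferentiableAt ℝ h x)
    (hY : DifferentiableAt ℝ Y x) (hZ : DifferentiableAt ℝ Z x) (v : F) :
    fderiv ℝ (fun y => h y (Y y) (Z y)) x v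
      = fderiv ℝ h x v (Y x) (Z x) + h x (fderiv ℝ Y x v) (Z x) + h x (Y x) (fderiv ℝ Z x v) := by
  rw [((hh.hasFDerivAt.clm_apply hY.hasFDerivAt).clm_apply hZ.hasFDerivAt).fderiv]
  simp only [add_apply, ContinuousLinearMap.comp_apply, ContinuousLinearMap.flip_apply]
  ring

lemma fderiv_symm_apply {x : F} (hh : DifferentiableAt ℝ h x)
    (hsymm : ∀ x v w, h x v w = h x w v) (u v w : F) :
    fderiv ℝ h x u v w = fderiv ℝ h x u w v := by
  have hvw := fderiv_apply_apply hh (differentiableAt_const v) (differentiableAt_const w) u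
  have hwv := fderiv_apply_apply hh (differentiableAt_const w) (differentiableAt_const v) u
  simp only [fderiv_fun_const, Pi.zero_apply, zero_apply, map_zero, add_zero,
    hsymm _ w v] at hvw hwv
  exact hvw.symm.trans hwv

variable [FiniteDimensional ℝ F] {x : F} (hpos : ∀ v, v ≠ 0 → 0 < h x v v)

include hpos

lemma apply_christoffelSymbol (u v w : F) :
    h x (christoffelSymbol h x u v) w = christoffel (fderiv ℝ h x) u v w := by
  rw [← christoffelForm_apply]
  exact congr($(apply_inverse_of_pos hpos (christoffelForm (fderiv ℝ h x) u v)) w)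

variable (hh : DifferentiableAt ℝ h x) (hsymm : ∀ x v w, h x v w = h x w v)

include hh hsymm

lemma christoffelSymbol_comm (u v : F) :
    christoffelSymbol h x u v = christoffelSymbol h x v u :=
  eq_of_forall_apply_eq hpos fun w => by
    rw [apply_christoffelSymbol hpos, apply_christoffelSymbol hpos,
      christoffel_comm (fderiv_symm_apply hh hsymm)]

lemma apply_christoffelSymbol_add (u v w : F) :
    h x (christoffelSymbol h x u v) w + h x u (christoffelSymbol h x w v)
      = fderiv ℝ h x v u w := by
  rw [hsymm x u, apply_christoffelSymbol hpos, apply_christoffelSymbol hpos,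
    christoffel_add_christoffel (fderiv_symm_apply hh hsymm)]

lemma fderiv_add_christoffelSymbol_sub_eq_zero {J : F → F →L[ℝ] F}
    (hskew : ∀ v w, h x (J x v) w = -h x v (J x w))
    (hpar : ∀ u v w, koszulDeriv h J x u v w = 0) (u v : F) :
    fderiv ℝ J x u v + christoffelSymbol h x (J x v) u - J x (christoffelSymbol h x v u) = 0 := by
  refine eq_of_forall_apply_eq hpos fun w => ?_
  rw [map_sub, map_add, sub_apply, add_apply, hskew, apply_christoffelSymbol hpos,
    apply_christoffelSymbol hpos, map_zero, zero_apply, sub_neg_eq_add, ← hpar u v w, koszulDeriv,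
    christoffel_comm (fderiv_symm_apply hh hsymm) (J x v),
    christoffel_comm (fderiv_symm_apply hh hsymm) v]

end ChristoffelSymbols

section EuclideanSpace

set_option maxSynthPendingDepth 3

variable {k : ℕ}

/-- A smooth family of inner products on a Euclidean space, as a Riemannian metric. -/
noncomputable def vectorSpaceMetric
    (h : EuclideanSpace ℝ (Fin k) → EuclideanSpace ℝ (Fin k) →L[ℝ] EuclideanSpace ℝ (Fin k) →L[ℝ] ℝ)
    (hh : ContDiff ℝ ∞ h) (hsymm : ∀ x v w, h x v w = h x w v)
    (hpos : ∀ x v, v ≠ 0 → 0 < h x v v) : RMetric k (EuclideanSpace ℝ (Fin k)) where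
  inner x := (h x : EuclideanSpace ℝ (Fin k) →L[ℝ] EuclideanSpace ℝ (Fin k) →L[ℝ] ℝ)
  symm := hsymm
  pos := hpos
  isVonNBounded x := isVonNBounded_setOf_lt_one (F := EuclideanSpace ℝ (Fin k)) (hpos x)
  contMDiff := by
    intro x
    refine (contMDiffAt_section (E := fun x : EuclideanSpace ℝ (Fin k) =>
      TangentSpace (𝓡 k) x →L[ℝ] TangentSpace (𝓡 k) x →L[ℝ] ℝ) (s := h) x).2 ?_
    refine (hh.contMDiff.contMDiffAt (x := x)).congr_of_eventuallyEq (.of_forall fun y => ?_)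
    refine ContinuousLinearMap.ext fun v => ContinuousLinearMap.ext fun w => ?_
    have hsymm_id (u : EuclideanSpace ℝ (Fin k)) :
        (trivializationAt (EuclideanSpace ℝ (Fin k)) (TangentSpace (𝓡 k)) x).symm y u = u :=
      (Trivialization.symmL_apply (R := ℝ) _ (mem_univ y) u).symm.trans
        congr(($(TangentBundle.symmL_model_space (𝕜 := ℝ) x y) :
          EuclideanSpace ℝ (Fin k) →L[ℝ] EuclideanSpace ℝ (Fin k)) u)
    refine (inCoordinates_apply_eq₂ (x₀ := x) (x := y) (F₃ := ℝ)
      (F₁ := EuclideanSpace ℝ (Fin k)) (F₂ := EuclideanSpace ℝ (Fin k))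
      (E₁ := TangentSpace (𝓡 k)) (E₂ := TangentSpace (𝓡 k))
      (E₃ := Bundle.Trivial (EuclideanSpace ℝ (Fin k)) ℝ)
      (ϕ := (h y : TangentSpace (𝓡 k) y →L[ℝ] TangentSpace (𝓡 k) y →L[ℝ] ℝ))
      (mem_univ _) (mem_univ _) (mem_univ _)).trans ?_
    rw [hsymm_id, hsymm_id]
    simp only [Trivial.fiberBundle_trivializationAt', Trivial.linearMapAt_trivialization,
      LinearMap.id_coe, id_eq]
    rfl

lemma isSmoothEndField_vectorSpace
    {J : EuclideanSpace ℝ (Fin k) → EuclideanSpace ℝ (Fin k) →L[ℝ] EuclideanSpace ℝ (Fin k)}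
    (hJ : ContDiff ℝ ∞ J) :
    IsSmoothEndField (M := EuclideanSpace ℝ (Fin k)) (m := k) J := by
  intro x
  refine (contMDiffAt_section (E := fun x : EuclideanSpace ℝ (Fin k) =>
    TangentSpace (𝓡 k) x →L[ℝ] TangentSpace (𝓡 k) x) (s := J) x).2 ?_
  refine (hJ.contMDiff.contMDiffAt (x := x)).congr_of_eventuallyEq (.of_forall fun y => ?_)
  exact inCoordinates_tangent_bundle_core_model_space (I := 𝓡 k) (I' := 𝓡 k) x y x y (J y)

lemma differentiableAt_vectorSpace {Y : VField k (EuclideanSpace ℝ (Fin k))}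
    {x : EuclideanSpace ℝ (Fin k)}
    (hY : MDifferentiableAt (𝓡 k) ((𝓡 k).prod 𝓘(ℝ, EuclideanSpace ℝ (Fin k)))
      (fun x => TotalSpace.mk' (EuclideanSpace ℝ (Fin k)) x (Y x)) x) :
    DifferentiableAt ℝ (F := EuclideanSpace ℝ (Fin k)) Y x :=
  ((((contMDiff_snd_tangentBundle_modelSpace (EuclideanSpace ℝ (Fin k)) (𝓡 k)).contMDiffAt
    (n := 1)).mdifferentiableAt (by simp)).comp x hY).differentiableAt

lemma isCovariantDerivativeOn_fderiv :
    IsCovariantDerivativeOn (I := 𝓡 k) (EuclideanSpace ℝ (Fin k))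
      (fun (Y : VField k (EuclideanSpace ℝ (Fin k))) x =>
        (fderiv ℝ (F := EuclideanSpace ℝ (Fin k)) Y x :
          EuclideanSpace ℝ (Fin k) →L[ℝ] EuclideanSpace ℝ (Fin k))) univ where
  add hσ hσ' _ := fderiv_add (differentiableAt_vectorSpace hσ) (differentiableAt_vectorSpace hσ')
  leibniz hσ hg _ := by
    refine (fderiv_smul hg.differentiableAt (differentiableAt_vectorSpace hσ)).trans ?_
    rw [mvfderiv, mfderiv_eq_fderiv]
    rfl

variable
  {h : EuclideanSpace ℝ (Fin k) → EuclideanSpace ℝ (Fin k) →L[ℝ] EuclideanSpace ℝ (Fin k) →L[ℝ] ℝ}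

variable (h) in
/-- The Levi-Civita connection of the metric `h` on a Euclidean space, defined by its Christoffel
symbols. -/
noncomputable def vectorSpaceLeviCivita : LinearConnection k (EuclideanSpace ℝ (Fin k)) where
  toFun Y x := (fderiv ℝ (F := EuclideanSpace ℝ (Fin k)) Y x + christoffelSymbol h x (Y x) :
    EuclideanSpace ℝ (Fin k) →L[ℝ] EuclideanSpace ℝ (Fin k))
  isCovariantDerivativeOnUniv := isCovariantDerivativeOn_fderiv.add_one_form (christoffelSymbol h)

variable (hh : ContDiff ℝ ∞ h) (hsymm : ∀ x v w, h x v w = h x w v)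
  (hpos : ∀ x v, v ≠ 0 → 0 < h x v v)

lemma isLeviCivita_vectorSpaceLeviCivita :
    IsLeviCivita (vectorSpaceMetric h hh hsymm hpos) (vectorSpaceLeviCivita h) where
  torsion_free := by
    refine (vectorSpaceLeviCivita h).torsion_eq_zero_iff.2 fun {X Y x} _ _ => ?_
    refine Eq.trans ?_ (mlieBracket_vectorSpace X Y x).symm
    have hcomm := christoffelSymbol_comm (hpos x) (hh.differentiable (by simp) x) hsymm (Y x) (X x)
    refine (congrArg (fun a => _ + a - _) hcomm).trans ?_
    exact add_sub_add_right_eq_sub (G := EuclideanSpace ℝ (Fin k)) _ _ _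
  metric Y Z hY hZ x v := by
    have hdiff := (hh.differentiable (by simp)) x
    have hderiv := fderiv_apply_apply hdiff
      (differentiableAt_vectorSpace (hY.mdifferentiableAt x))
      (differentiableAt_vectorSpace (hZ.mdifferentiableAt x)) v
    have hchristoffel (v y dy z dz : EuclideanSpace ℝ (Fin k)) :
        fderiv ℝ h x v y z + h x dy z + h x y dz
          = h x (dy + christoffelSymbol h x y v) z + h x y (dz + christoffelSymbol h x z v) := by
      rw [map_add, map_add, add_apply, ← apply_christoffelSymbol_add (hpos x) hdiff hsymm]
      ring
    rw [mvfderiv, mfderiv_eq_fderiv]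
    exact hderiv.trans (hchristoffel _ _ _ _ _)

lemma isWeakKahlerian_vectorSpace
    {J : EuclideanSpace ℝ (Fin k) → EuclideanSpace ℝ (Fin k) →L[ℝ] EuclideanSpace ℝ (Fin k)}
    (hJ : ContDiff ℝ ∞ J) (hskew : ∀ x v w, h x (J x v) w = -h x v (J x w))
    (hinj : ∀ x, Function.Injective (J x)) (hpar : ∀ x u v w, koszulDeriv h J x u v w = 0) :
    IsWeakKahlerian (M := EuclideanSpace ℝ (Fin k)) (vectorSpaceMetric h hh hsymm hpos) J where
  smooth := isSmoothEndField_vectorSpace hJ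
  skew := hskew
  sq_neg x v hv :=
    (hskew x (J x v) v).trans_lt (neg_lt_zero.2 (hpos x _ ((map_ne_zero_iff _ (hinj x)).2 hv)))
  parallel := by
    refine ⟨vectorSpaceLeviCivita h, isLeviCivita_vectorSpaceLeviCivita hh hsymm hpos,
      fun X Y _ hY x => ?_⟩
    have hderiv (u : EuclideanSpace ℝ (Fin k)) : fderiv ℝ (F := EuclideanSpace ℝ (Fin k))
        (EndField.app (M := EuclideanSpace ℝ (Fin k)) J Y) x u
          = J x (fderiv ℝ (F := EuclideanSpace ℝ (Fin k)) Y x u) + fderiv ℝ J x u (Y x) :=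
      congr($((((hJ.differentiable (by simp)) x).hasFDerivAt.clm_apply
        (differentiableAt_vectorSpace (hY.mdifferentiableAt x)).hasFDerivAt).fderiv) u)
    have hparallel (u y dy : EuclideanSpace ℝ (Fin k)) : J x dy + fderiv ℝ J x u y
        + christoffelSymbol h x (J x y) u - J x (dy + christoffelSymbol h x y u) = 0 := by
      rw [← fderiv_add_christoffelSymbol_sub_eq_zero (hpos x) ((hh.differentiable (by simp)) x)
        hsymm (hskew x) (hpar x) u y, map_add]
      abel
    exact (congrArg (fun a : EuclideanSpace ℝ (Fin k) => a + _ - _) (hderiv (X x))).trans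
      (hparallel (X x) (Y x) _)

end EuclideanSpace

/-! ### The twisted product -/

section ProductModel

variable {T F : Type*} [NormedAddCommGroup T] [NormedSpace ℝ T] [NormedAddCommGroup F]
  [NormedSpace ℝ F] {E H M : Type*} [NormedAddCommGroup E] [NormedSpace ℝ E] [TopologicalSpace H]
  {I : ModelWithCorners ℝ E H} [TopologicalSpace M] [ChartedSpace H M]

lemma mfderiv_prodModel (Φ : T × F → M) (q : T × F) :
    mfderiv (𝓘(ℝ, T).prod 𝓘(ℝ, F)) I Φ q = mfderiv 𝓘(ℝ, T × F) I Φ q := by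
  rw [modelWithCornersSelf_prod, ← chartedSpaceSelf_prod]

lemma contMDiffOn_prodModel_iff {Φ : T × F → M} {U : Set (T × F)} :
    ContMDiffOn (𝓘(ℝ, T).prod 𝓘(ℝ, F)) I ∞ Φ U ↔ ContMDiffOn 𝓘(ℝ, T × F) I ∞ Φ U := by
  rw [modelWithCornersSelf_prod, ← chartedSpaceSelf_prod]

lemma contMDiffOn_prodModel_symm_iff {Ψ : M → T × F} {V : Set M} :
    ContMDiffOn I (𝓘(ℝ, T).prod 𝓘(ℝ, F)) ∞ Ψ V ↔ ContMDiffOn I 𝓘(ℝ, T × F) ∞ Ψ V := by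
  rw [modelWithCornersSelf_prod, ← chartedSpaceSelf_prod]

lemma mfderiv_mk_left {Φ : T × F → M} {q : T × F} (hΦ : MDifferentiableAt 𝓘(ℝ, T × F) I Φ q)
    (a : T) : mfderiv 𝓘(ℝ, T) I (fun t => Φ (t, q.2)) q.1 a = mfderiv 𝓘(ℝ, T × F) I Φ q (a, 0) :=
  congr($((hΦ.hasMFDerivAt.comp q.1 (hasFDerivAt_mk_left q.1 q.2).hasMFDerivAt).mfderiv) a)

lemma mfderiv_mk_right {Φ : T × F → M} {q : T × F} (hΦ : MDifferentiableAt 𝓘(ℝ, T × F) I Φ q)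
    (w : F) : mfderiv 𝓘(ℝ, F) I (fun y => Φ (q.1, y)) q.2 w = mfderiv 𝓘(ℝ, T × F) I Φ q (0, w) :=
  congr($((hΦ.hasMFDerivAt.comp q.2 (hasFDerivAt_mk_right q.1 q.2).hasMFDerivAt).mfderiv) w)

end ProductModel

lemma twistedInner_vectorSpace {s k : ℕ} (h : RMetric k (EuclideanSpace ℝ (Fin k)))
    (σ : EuclideanSpace ℝ (Fin s) × EuclideanSpace ℝ (Fin k) → ℝ)
    (q v w : EuclideanSpace ℝ (Fin s) × EuclideanSpace ℝ (Fin k)) :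
    twistedInner h σ q v w = inner ℝ v.1 w.1 + σ q ^ 2 * h.inner q.2 v.2 w.2 := by
  have hfst := congr($((hasMFDerivAt_fst (I := 𝓡 s) (I' := 𝓡 k) q).mfderiv))
  have hsnd := congr($((hasMFDerivAt_snd (I := 𝓡 s) (I' := 𝓡 k) q).mfderiv))
  exact congrArg₂ (· + ·) (congrArg₂ (inner ℝ) congr($hfst v) congr($hfst w))
    (congrArg (σ q ^ 2 * ·) (congrArg₂ (h.inner q.2 · ·) congr($hsnd v) congr($hsnd w)))

namespace IsAdaptedParametrization

variable {n s : ℕ} {M : Type*} [TopologicalSpace M]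
  [ChartedSpace (EuclideanSpace ℝ (Fin (2 * n + s))) M] [IsManifold (𝓡 (2 * n + s)) ∞ M]
  {S : WeakMetricFStructure n s M} {r : ℝ}

lemma restrict {F : Type*} [NormedAddCommGroup F] [NormedSpace ℝ F]
    {Φ : OpenPartialHomeomorph (EuclideanSpace ℝ (Fin s) × F) M}
    (hΦ : IsAdaptedParametrization S r Φ) {r' : ℝ} (hr : r' ≤ r) :
    IsAdaptedParametrization S r'
      (Φ.restrOpen (Metric.ball 0 r' ×ˢ univ) (Metric.isOpen_ball.prod isOpen_univ)) where
  contMDiffOn := hΦ.contMDiffOn.mono inter_subset_left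
  contMDiffOn_symm := hΦ.contMDiffOn_symm.mono inter_subset_left
  source_eq := by
    rw [OpenPartialHomeomorph.restrOpen_source, hΦ.source_eq, inter_eq_right]
    exact prod_mono_left (Metric.ball_subset_ball hr)
  pullbackField_ξ q hq := hΦ.pullbackField_ξ q hq.1
  pullbackForm_η q hq := hΦ.pullbackForm_η q hq.1

lemma mfderiv_fiberEnd {F : Type*} [NormedAddCommGroup F] [NormedSpace ℝ F]
    {Φ : OpenPartialHomeomorph (EuclideanSpace ℝ (Fin s) × F) M}
    (hΦ : IsAdaptedParametrization S r Φ) {q : EuclideanSpace ℝ (Fin s) × F} (hq : q ∈ Φ.source)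
    (w : F) :
    mfderiv 𝓘(ℝ, F) (𝓡 (2 * n + s)) (fun y => Φ (q.1, y)) q.2 (fiberEnd (pullbackEnd Φ S.f) q w)
      = S.f (Φ q) (mfderiv 𝓘(ℝ, F) (𝓡 (2 * n + s)) (fun y => Φ (q.1, y)) q.2 w) := by
  have hd := hΦ.mdifferentiable.mdifferentiableAt hq
  refine (mfderiv_mk_right hd _).trans ?_
  rw [← hΦ.pullbackEnd_fiber hq, hΦ.mfderiv_pullbackEnd hq]
  exact congrArg _ (mfderiv_mk_right hd w).symm

lemma isWeakKahlerian_leaf [T2Space M]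
    {Φ : OpenPartialHomeomorph (EuclideanSpace ℝ (Fin s) × EuclideanSpace ℝ (Fin (2 * n))) M}
    (hΦ : IsAdaptedParametrization S r Φ) (hr : 0 < r) {β : M → ℝ} (hS : S.IsWeakKenmotsu β) :
    IsWeakKahlerian (M := EuclideanSpace ℝ (Fin (2 * n)))
      (vectorSpaceMetric (leafMetric S Φ) (hΦ.contDiff_leafMetric hr)
        (fun y _ _ => pullbackMetric_comm Φ S.g (0, y) _ _) (hΦ.leafMetric_pos hr)) (leafEnd S Φ) :=
  have hq (y) := hΦ.mem_source (Metric.mem_ball_self hr) y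
  isWeakKahlerian_vectorSpace _ _ _ (hΦ.contDiff_leafEnd hr) (fun y => hΦ.fiberEnd_skew (hq y))
    (fun y => hΦ.fiberEnd_injective (hq y)) (hΦ.koszulDeriv_leaf_eq_zero hS hr)

lemma isTwistedProductChart
    {Φ : OpenPartialHomeomorph (EuclideanSpace ℝ (Fin s) × EuclideanSpace ℝ (Fin (2 * n))) M}
    (hΦ : IsAdaptedParametrization S r Φ) (hr : 0 < r)
    {h : RMetric (2 * n) (EuclideanSpace ℝ (Fin (2 * n)))}
    {J : EndField (2 * n) (EuclideanSpace ℝ (Fin (2 * n)))}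
    {σ : EuclideanSpace ℝ (Fin s) × EuclideanSpace ℝ (Fin (2 * n)) → ℝ}
    (hmetric : ∀ t ∈ Metric.ball 0 r, ∀ y v w,
      fiberMetric (pullbackMetric Φ S.g) (t, y) v w = σ (t, y) ^ 2 * h.inner y v w)
    (hend : ∀ t ∈ Metric.ball 0 r, ∀ y w, fiberEnd (pullbackEnd Φ S.f) (t, y) w = J y w) :
    IsTwistedProductChart S (Φ 0) h J σ r Φ where
  source_eq := hΦ.source_eq
  mem_target := Φ.map_source (hΦ.mem_source (Metric.mem_ball_self hr) 0)
  smooth := contMDiffOn_prodModel_iff.2 hΦ.contMDiffOn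
  smooth_symm := contMDiffOn_prodModel_symm_iff.2 hΦ.contMDiffOn_symm
  isometry q hq v w := by
    rw [mfderiv_prodModel]
    refine (hΦ.pullbackMetric_eq hq v w).trans ?_
    refine Eq.trans ?_ (twistedInner_vectorSpace h σ q v w).symm
    exact congrArg _ (hmetric q.1 (hΦ.source_eq ▸ hq).1 q.2 v.2 w.2)
  map_ξ q hq i :=
    (mfderiv_mk_left (hΦ.mdifferentiable.mdifferentiableAt hq) _).trans <| by
      rw [hΦ.mfderiv_horizontal hq]
      simp
  map_f q hq w :=
    (congrArg _ (hend q.1 (hΦ.source_eq ▸ hq).1 q.2 w).symm).trans (hΦ.mfderiv_fiberEnd hq w)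

end IsAdaptedParametrization

end WeakKenmotsu

open WeakKenmotsu in
theorem theorem2p2_general (n s : ℕ) (hn : 0 < n) (M : Type*) [TopologicalSpace M] [T2Space M]
    [ChartedSpace (EuclideanSpace ℝ (Fin (2 * n + s))) M] [IsManifold (𝓡 (2 * n + s)) ∞ M]
    (S : WeakMetricFStructure n s M) (β : M → ℝ) (hS : S.IsWeakKenmotsu β) (p : M) :
    ∃ (h : RMetric (2 * n) (EuclideanSpace ℝ (Fin (2 * n))))
      (J : EndField (2 * n) (EuclideanSpace ℝ (Fin (2 * n))))
      (σ : EuclideanSpace ℝ (Fin s) × EuclideanSpace ℝ (Fin (2 * n)) → ℝ) (r : ℝ)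
      (Φ : OpenPartialHomeomorph
        (EuclideanSpace ℝ (Fin s) × EuclideanSpace ℝ (Fin (2 * n))) M),
      IsWeakKahlerian h J ∧
      ContMDiff ((𝓡 s).prod (𝓡 (2 * n))) 𝓘(ℝ, ℝ) ∞ σ ∧ (∀ q, 0 < σ q) ∧
      IsTwistedProductChart S p h J σ r Φ ∧
      ((∀ (x : M) (v : TangentSpace (𝓡 (2 * n + s)) x), S.InContact v →
          mvfderiv (𝓡 (2 * n + s)) β x v = 0) →
        ∃ ρ : EuclideanSpace ℝ (Fin s) → ℝ, ContDiff ℝ ∞ ρ ∧ ∀ t y, σ (t, y) = ρ t) := by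
  obtain ⟨r, hr, Φ, hΦ, rfl⟩ := hS.exists_isAdaptedParametrization p
  have : Nonempty (Fin (2 * n)) := ⟨0, by lia⟩
  obtain ⟨e, he⟩ := exists_ne (0 : EuclideanSpace ℝ (Fin (2 * n)))
  obtain ⟨σ, hσ, hσpos, hmetric, hwarped⟩ := hΦ.exists_twisting_function hS hr he
  have hr' : r / 2 ≤ r := half_le_self hr.le
  refine ⟨_, _, σ, r / 2, _, hΦ.isWeakKahlerian_leaf hr hS,
    contMDiffOn_univ.1 (contMDiffOn_prodModel_iff.2 hσ.contMDiff.contMDiffOn), hσpos,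
    (hΦ.restrict hr').isTwistedProductChart (half_pos hr) hmetric fun t ht =>
      hΦ.fiberEnd_eq hS (Metric.ball_subset_ball hr' ht),
    fun hβ => ⟨fun t => σ (t, 0), hσ.comp (contDiff_id.prodMk contDiff_const), hwarped hβ⟩⟩

theorem theorem2p2 (n s : ℕ) (hn : 0 < n) (hs : 1 < s) (M : Type*) [TopologicalSpace M]
    [T2Space M] [SecondCountableTopology M]
    [ChartedSpace (EuclideanSpace ℝ (Fin (2 * n + s))) M] [IsManifold (𝓡 (2 * n + s)) ∞ M]
    (S : WeakKenmotsu.WeakMetricFStructure n s M) (β : M → ℝ) (hS : S.IsWeakKenmotsu β) (p : M) :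
    ∃ (N : Type) (_ : TopologicalSpace N) (_ : T2Space N) (_ : SecondCountableTopology N)
      (_ : ChartedSpace (EuclideanSpace ℝ (Fin (2 * n))) N) (_ : IsManifold (𝓡 (2 * n)) ∞ N)
      (h : WeakKenmotsu.RMetric (2 * n) N) (J : WeakKenmotsu.EndField (2 * n) N)
      (σ : EuclideanSpace ℝ (Fin s) × N → ℝ) (r : ℝ)
      (Φ : OpenPartialHomeomorph (EuclideanSpace ℝ (Fin s) × N) M),
      WeakKenmotsu.IsWeakKahlerian h J ∧
      ContMDiff ((𝓡 s).prod (𝓡 (2 * n))) 𝓘(ℝ, ℝ) ∞ σ ∧ (∀ q, 0 < σ q) ∧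
      WeakKenmotsu.IsTwistedProductChart S p h J σ r Φ ∧
      ((∀ (x : M) (v : TangentSpace (𝓡 (2 * n + s)) x), S.InContact v →
          mvfderiv (𝓡 (2 * n + s)) β x v = 0) →
        ∃ ρ : EuclideanSpace ℝ (Fin s) → ℝ, ContDiff ℝ ∞ ρ ∧ ∀ t y, σ (t, y) = ρ t) := by
  exact ⟨_, _, TopologicalSpace.t2Space_of_metrizableSpace, inferInstance, _, inferInstance,
    theorem2p2_general n s hn M S β hS p⟩
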